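/- **The graphs.** A graph has vertices and edges, each edge has two orientations, and its realization is the one-dimensional CW complex with these vertices and edges as cells. Set $$\begin{aligned} &v_0=\tfrac18(5,5,5),\quad v_1=\tfrac18(3,7,5),\quad v_2=\tfrac18(3,1,7),\quad v_3=\tfrac18(5,3,7),\\ &v_4=\tfrac18(7,5,3),\quad v_5=\tfrac18(1,7,3),\quad v_6=\tfrac18(1,1,1),\quad v_7=\tfrac18(7,3,1).\end{aligned}$$ The Gyroid skeletal graph $\Gamma_+$ has as vertices all $\mathbb Z^3$-translates of $v_0,\dots,v_7$, and as edges all $\mathbb Z^3$-translates of the twelve line segments $$\overline{v_0v_1},\ \overline{v_0v_3},\ \overline{v_0v_4},\ \overline{v_2v_3},\ \overline{v_4v_7},\ \overline{v_1v_5},\ \overline{v_4T_x(v_5)},\ \overline{v_7T_x(v_6)},\ \overline{v_1T_y(v_2)},\ \overline{v_5T_y(v_6)},\ \overline{v_2T_z(v_6)},\ \overline{v_3T_z(v_7)},$$ where $T_x,T_y,T_z$ are the translations by $(1,0,0),(0,1,0),(0,0,1)$, with the obvious incidence relations. Let $L\subset\mathbb R^3$ be the body centered cubic lattice generated by $(1,0,0)$,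 $(0,1,0)$ and $\tfrac12(1,1,1)$, and let $\bar\Gamma_+=\Gamma_+/L$ be the quotient graph by translations. **The channels.** Let $g(x,y,z)=\sin(2\pi x)\cos(2\pi y)+\sin(2\pi y)\cos(2\pi z)+\sin(2\pi z)\cos(2\pi x)$. For $0\le w<\sqrt2$ the double Gyroid (in its level surface model, in coordinates in which the cubic unit cell has edge length $1$) is $\{g=w\}\cup\{g=-w\}$; for $w=0$ this is the single Gyroid. A channel is a connected component of the complement of $\{g=w\}\cup\{g=-w\}$ in $\mathbb R^3$ that contains a point with $|g|>w$; for $w=0$ these are all components of the complement of the Gyroid. A continuous map $p:E\to B$ is called the maximal abelian cover of $B$ if it is a surjective covering map, $E$ is path connected, and $p_*\pi_1(E,x)=[\pi_1(B,p(x)),\pi_1(B,p(x))]$ for every $x\in E$. **Proposition.** Let $\mathbb F_3$ be the free group on three generators. For every choice of base points, the realizations of $\Gamma_+$ and $\bar\Gamma_+$ have the following fundamental groups: 1. $\pi_1(\Gamma_+)\cong[\mathbb F_3,\mathbb F_3]$; 2. $\bar\Gamma_+$ is isomorphic to the complete graph $K_4$, and $\pi_1(\bar\Gamma_+)\cong\mathbb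 F_3$. The map of realizations induced by the quotient map $\Gamma_+\to\bar\Gamma_+$ is the maximal abelian cover of $\bar\Gamma_+$. The same holds for each channel: for every $0\le w<\sqrt2$ and every channel $C$ of the corresponding (double) Gyroid, and for every choice of base points, $\pi_1(C)\cong[\mathbb F_3,\mathbb F_3]$, $\pi_1(C/L)\cong\mathbb F_3$, where $C/L$ is the quotient of $C$ by translations in $L$, and the quotient map $C\to C/L$ is the maximal abelian cover of $C/L$. -/

import Mathlib

namespace Gyroid

noncomputable section

/-! ### Graphs and their realizations -/

/-- A graph, given by its vertices and its oriented edges. Every edge has exactly two orientations,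
exchanged by the fixed point free involution `rev`; an edge is thus a pair `{d, rev d}`. Loops and
multiple edges are allowed. -/
structure OrGraph where
  /-- The vertices. -/
  V : Type
  /-- The oriented edges. -/
  D : Type
  /-- The starting vertex of an oriented edge. -/
  src : D → V
  /-- The same edge with the opposite orientation. -/
  rev : D → D
  rev_rev : ∀ d, rev (rev d) = d
  rev_ne : ∀ d, rev d ≠ d

namespace OrGraph

/-- The target vertex of an oriented edge. -/
def tgt (G : OrGraph) (d : G.D) : G.V := G.src (G.rev d)

/-- The disjoint union of one point for every vertex and one unit interval for every oriented
edge, with its disjoint union topology. -/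
abbrev Cells (G : OrGraph) : Type := (Σ _ : G.V, Unit) ⊕ (Σ _ : G.D, unitInterval)

/-- The identifications made in the realization: the interval of `d` starts at the vertex `src d`,
and the intervals of the two orientations of an edge are the same interval, run through in opposite
directions. (So the interval of `d` ends at `tgt d`.) -/
inductive Glue (G : OrGraph) : G.Cells → G.Cells → Prop
  | src (d : G.D) : Glue G (Sum.inr ⟨d, 0⟩) (Sum.inl ⟨G.src d, ()⟩)
  | rev (d : G.D) (t : unitInterval) :
      Glue G (Sum.inr ⟨d, t⟩) (Sum.inr ⟨G.rev d, unitInterval.symm t⟩)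

/-- The realization of a graph: the 1-dimensional CW complex with its vertices and edges as cells,
with the quotient topology. -/
def Realization (G : OrGraph) : Type := Quot G.Glue

instance (G : OrGraph) : TopologicalSpace G.Realization :=
  inferInstanceAs (TopologicalSpace (Quot G.Glue))

/-- A morphism of graphs. -/
structure Hom (G H : OrGraph) where
  /-- The map on vertices. -/
  onV : G.V → H.V
  /-- The map on oriented edges. -/
  onD : G.D → H.D
  src_onD : ∀ d, H.src (onD d) = onV (G.src d)
  rev_onD : ∀ d, H.rev (onD d) = onD (G.rev d)

/-- A morphism of graphs on cells. -/
def Hom.cells {G H : OrGraph} (f : Hom G H) : G.Cells → H.Cells :=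
  Sum.map (Sigma.map f.onV fun _ => id) (Sigma.map f.onD fun _ => id)

/-- The continuous map between the realizations that is induced by a morphism of graphs. -/
def Hom.realize {G H : OrGraph} (f : Hom G H) : C(G.Realization, H.Realization) where
  toFun := Quot.map f.cells (by
    intro a b h
    cases h with
    | src d =>
      have h := Glue.src (G := H) (f.onD d)
      rw [f.src_onD] at h
      exact h
    | rev d t =>
      have h := Glue.rev (G := H) (f.onD d) t
      rw [f.rev_onD] at h
      exact h)
  continuous_toFun := by
    refine continuous_quot_lift _ ?_
    exact continuous_quot_mk.comp (Continuous.sumMap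
      (Continuous.sigma_map fun _ => continuous_id) (Continuous.sigma_map fun _ => continuous_id))

/-- An isomorphism of graphs. -/
structure Iso (G H : OrGraph) extends Hom G H where
  onV_bijective : Function.Bijective onV
  onD_bijective : Function.Bijective onD

/-- A simple graph as a graph with oriented edges. -/
def ofSimpleGraph {V : Type} (G : SimpleGraph V) : OrGraph where
  V := V
  D := G.Dart
  src d := d.fst
  rev d := d.symm
  rev_rev d := d.symm_symm
  rev_ne d := d.symm_ne

end OrGraph

/-! ### The Gyroid graph and its quotient by the bcc lattice -/

/-- The coordinates of the vertices `v₀, …, v₇` in the unit cell, multiplied by `8`. -/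
def v8 : Fin 8 → Fin 3 → ℤ :=
  ![![5, 5, 5], ![3, 7, 5], ![3, 1, 7], ![5, 3, 7], ![7, 5, 3], ![1, 7, 3], ![1, 1, 1], ![7, 3, 1]]

/-- The vertices `v₀ = (5/8, 5/8, 5/8), …, v₇ = (7/8, 3/8, 1/8)` in the unit cell. -/
def v (i : Fin 8) : Fin 3 → ℝ := fun j => (v8 i j : ℝ) / 8

/-- A vector with integer coordinates, as a vector of `ℝ³`. -/
def intVec (n : Fin 3 → ℤ) : Fin 3 → ℝ := fun i => (n i : ℝ)

/-- The twelve line segments that generate the edges of the graph: the entry `(i, j, n)` stands for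
the segment from `v i` to the translate of `v j` by the integral vector `n`. -/
def baseIndex : Fin 12 → Fin 8 × Fin 8 × (Fin 3 → ℤ) :=
  ![(0, 1, 0), (0, 3, 0), (0, 4, 0), (2, 3, 0), (4, 7, 0), (1, 5, 0),
    (4, 5, ![1, 0, 0]), (7, 6, ![1, 0, 0]), (1, 2, ![0, 1, 0]),
    (5, 6, ![0, 1, 0]), (2, 6, ![0, 0, 1]), (3, 7, ![0, 0, 1])]

/-- The endpoints of the twelve line segments. -/
def baseEdge (k : Fin 12) : (Fin 3 → ℝ) × (Fin 3 → ℝ) :=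
  (v (baseIndex k).1, v (baseIndex k).2.1 + intVec (baseIndex k).2.2)

/-- The vertices of the graph `Γ₊`: all `ℤ³`-translates of `v₀, …, v₇`. -/
def vertexSet : Set (Fin 3 → ℝ) := {p | ∃ i n, p = v i + intVec n}

/-- The oriented edges of the graph `Γ₊`: all `ℤ³`-translates of the twelve segments, in both
orientations. An oriented line segment is recorded by its initial point and its final point. -/
def dartSet : Set ((Fin 3 → ℝ) × (Fin 3 → ℝ)) :=
  {d | ∃ k n, d = ((baseEdge k).1 + intVec n, (baseEdge k).2 + intVec n) ∨
    d = ((baseEdge k).2 + intVec n, (baseEdge k).1 + intVec n)}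

theorem intVec_add (m n : Fin 3 → ℤ) : intVec (m + n) = intVec m + intVec n := by
  ext i; simp [intVec]

theorem baseEdge_fst (k : Fin 12) : (baseEdge k).1 ∈ vertexSet :=
  ⟨(baseIndex k).1, 0, by ext; simp [intVec, baseEdge]⟩

theorem baseEdge_snd (k : Fin 12) : (baseEdge k).2 ∈ vertexSet := ⟨_, _, rfl⟩

theorem baseEdge_ne (k : Fin 12) : (baseEdge k).1 ≠ (baseEdge k).2 := by
  intro h
  have key : ∀ k, ∃ j, v8 (baseIndex k).1 j ≠
      v8 (baseIndex k).2.1 j + 8 * (baseIndex k).2.2 j := by decide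
  obtain ⟨j, hj⟩ := key k
  have h' := congrFun h j
  simp only [baseEdge, v, intVec, Pi.add_apply] at h'
  apply hj
  have : (v8 (baseIndex k).1 j : ℝ) = v8 (baseIndex k).2.1 j + 8 * (baseIndex k).2.2 j := by
    linarith
  exact_mod_cast this

theorem vertexSet_add {p : Fin 3 → ℝ} (hp : p ∈ vertexSet) (n : Fin 3 → ℤ) :
    p + intVec n ∈ vertexSet := by
  obtain ⟨i, m, rfl⟩ := hp
  exact ⟨i, m + n, by rw [intVec_add, add_assoc]⟩

theorem dart_fst {d : (Fin 3 → ℝ) × (Fin 3 → ℝ)} (hd : d ∈ dartSet) : d.1 ∈ vertexSet := by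
  obtain ⟨k, n, rfl | rfl⟩ := hd
  · exact vertexSet_add (baseEdge_fst k) n
  · exact vertexSet_add (baseEdge_snd k) n

theorem dart_swap {d : (Fin 3 → ℝ) × (Fin 3 → ℝ)} (hd : d ∈ dartSet) : d.swap ∈ dartSet := by
  obtain ⟨k, n, rfl | rfl⟩ := hd
  · exact ⟨k, n, Or.inr rfl⟩
  · exact ⟨k, n, Or.inl rfl⟩

theorem dart_ne {d : (Fin 3 → ℝ) × (Fin 3 → ℝ)} (hd : d ∈ dartSet) : d.1 ≠ d.2 := by
  obtain ⟨k, n, rfl | rfl⟩ := hd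
  · exact fun h => baseEdge_ne k (add_right_cancel h)
  · exact fun h => baseEdge_ne k (add_right_cancel h).symm

/-- The skeletal graph `Γ₊` of the Gyroid. -/
def gyroidGraph : OrGraph where
  V := vertexSet
  D := dartSet
  src d := ⟨d.1.1, dart_fst d.2⟩
  rev d := ⟨d.1.swap, dart_swap d.2⟩
  rev_rev _ := rfl
  rev_ne d h := dart_ne d.2 (congrArg (fun e => e.1.2) h)

/-- The body centered cubic lattice, generated by `(1,0,0)`, `(0,1,0)`, `(1/2,1/2,1/2)`. -/
def bcc : AddSubgroup (Fin 3 → ℝ) :=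
  AddSubgroup.closure {![1, 0, 0], ![0, 1, 0], ![1/2, 1/2, 1/2]}

/-- Two points of a subset of `ℝ³` are equivalent if they differ by a vector of the bcc lattice. -/
def bccSetoid (C : Set (Fin 3 → ℝ)) : Setoid C where
  r x y := (y : Fin 3 → ℝ) - x ∈ bcc
  iseqv :=
    { refl := fun x => by simp
      symm := fun {x y} h => by simpa using bcc.neg_mem h
      trans := fun {x y z} h h' => by simpa using bcc.add_mem h h' }

/-- Two oriented edges are equivalent if they differ by a translation in the bcc lattice. -/
def bccDartSetoid : Setoid dartSet where
  r d e := ∃ l ∈ bcc, e.1 = (d.1.1 + l, d.1.2 + l)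
  iseqv :=
    { refl := fun d => ⟨0, bcc.zero_mem, by simp⟩
      symm := by
        rintro d e ⟨l, hl, h⟩
        exact ⟨-l, bcc.neg_mem hl, by simp [h]⟩
      trans := by
        rintro d e f ⟨l, hl, h⟩ ⟨m, hm, h'⟩
        exact ⟨l + m, bcc.add_mem hl hm, by simp [h, h', add_assoc]⟩ }

/-- The quotient graph `Γ̄₊ = Γ₊ / bcc`: its vertices and its oriented edges are the classes of
vertices and of oriented edges of `Γ₊` modulo translations in the bcc lattice. -/
def quotientGraph : OrGraph where
  V := Quotient (bccSetoid vertexSet)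
  D := Quotient bccDartSetoid
  src := Quotient.map gyroidGraph.src (by
    rintro d e ⟨l, hl, h⟩
    change e.1.1 - d.1.1 ∈ bcc
    simpa [h] using hl)
  rev := Quotient.map gyroidGraph.rev (by
    rintro d e ⟨l, hl, h⟩
    refine ⟨l, hl, ?_⟩
    change e.1.swap = _
    rw [h]
    rfl)
  rev_rev := by
    rintro ⟨d⟩
    rfl
  rev_ne := by
    rintro ⟨d⟩ h
    obtain ⟨l, -, h⟩ := Quotient.exact h
    have h1 : d.1.1 = d.1.2 + l := congrArg Prod.fst h
    have h2 : d.1.2 = d.1.1 + l := congrArg Prod.snd h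
    refine dart_ne d.2 (funext fun i => ?_)
    have h1' := congrFun h1 i
    have h2' := congrFun h2 i
    simp only [Pi.add_apply] at h1' h2'
    linarith

/-- The quotient morphism `Γ₊ → Γ̄₊`. -/
def quotientHom : OrGraph.Hom gyroidGraph quotientGraph where
  onV := Quotient.mk (bccSetoid vertexSet)
  onD := Quotient.mk bccDartSetoid
  src_onD _ := rfl
  rev_onD _ := rfl

/-! ### Maximal abelian covers -/

/-- `p : E → B` is the maximal abelian cover of `B`: the connected covering space of `B` that
corresponds to the commutator subgroup of the fundamental group of `B`. -/
structure IsMaximalAbelianCover {E B : Type} [TopologicalSpace E] [TopologicalSpace B]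
    (p : C(E, B)) : Prop where
  isCoveringMap : IsCoveringMap p
  surjective : Function.Surjective p
  pathConnectedSpace : PathConnectedSpace E
  range_eq : ∀ x : E, (FundamentalGroup.map p x).range = commutator (FundamentalGroup B (p x))

/-! ### The Gyroid channels -/

/-- The function whose level surfaces model the Gyroid, in coordinates in which the cubic unit cell
has edge length `1`. -/
def level (p : Fin 3 → ℝ) : ℝ :=
  Real.sin (2 * Real.pi * p 0) * Real.cos (2 * Real.pi * p 1) +
  Real.sin (2 * Real.pi * p 1) * Real.cos (2 * Real.pi * p 2) +
  Real.sin (2 * Real.pi * p 2) * Real.cos (2 * Real.pi * p 0)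

/-- The double Gyroid: the union of the level surfaces at the levels `w` and `-w`. For `w = 0` this
is a single Gyroid. -/
def doubleGyroid (w : ℝ) : Set (Fin 3 → ℝ) := {p | level p = w ∨ level p = -w}

/-- A channel is a connected component of the complement of the double Gyroid, other than the
thickened surface `{p | |level p| < w}` between the two level surfaces. For `w = 0` the latter is
empty, and the channels are all the components of the complement of the single Gyroid. -/
def IsChannel (w : ℝ) (C : Set (Fin 3 → ℝ)) : Prop :=
  ∃ p, w < |level p| ∧ C = connectedComponentIn (doubleGyroid w)ᶜ p

/-- The quotient of a subset of `ℝ³` by translations in the bcc lattice. -/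
abbrev BccQuotient (C : Set (Fin 3 → ℝ)) : Type := Quotient (bccSetoid C)

/-- The quotient map. -/
def bccProj (C : Set (Fin 3 → ℝ)) : C(C, BccQuotient C) where
  toFun := Quotient.mk (bccSetoid C)
  continuous_toFun := continuous_quotient_mk'

end

end Gyroid

/-! The body centered cubic lattice is isomorphic to `ℤ³` and acts freely and properly
discontinuously on the graph and on each channel, so both projections are regular coverings with
deck group `ℤ³`. Monodromy gives a surjection from the fundamental group of the quotient onto `ℤ³`
whose kernel is the image of the fundamental group above. If the quotient has fundamental group
`𝔽₃`, this kernel is forced: the surjection factors through the abelianization `ℤ³`, and a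
surjective endomorphism of `ℤ³` is injective, so the kernel is the commutator subgroup
(`ker_eq_commutator_of_surjective`, `isMaximalAbelianCover_of_quotientCoveringMap`). It remains to
show, for graph and channel alike, that the total space is path connected and that the quotient has
fundamental group `𝔽₃`.

The latter rests on `GraphCover.nonempty_mulEquiv`, a van Kampen theorem for spaces covered by open
simply connected pieces that meet like the vertices and edges of a graph with a star as spanning
tree. The loops through the edges outside the tree generate, by subdivision of paths. They are
independent, because a covering with the free group as fibre can be glued from the pieces, and its
monodromy recovers each word. For `K₄` three edges lie outside the star.

For the graph, residues modulo 4 of the integral coordinates identify the quotient with `K₄`; the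
pieces are open stars and open edges.

For the channel where the Gyroid function exceeds `w`, the vertex piece comes from a prism around a
cube diagonal and the edge piece from a thin box around the middle of an edge; the tetrahedral
symmetry generated by `cyc` and `rot` produces the rest (`symmetricCover`). Twice the Gyroid
function is a sum of six sines, one for each edge of `K₄`. Estimates of these sines keep different
pieces apart, an integer pigeonhole argument shows that the pieces cover, and each piece contracts
along homotopies that never leave the channel. The bound `w < √2` enters because `√2` is the minimum
of the function along each edge, attained in the middle: up to this level the channel contains the
graph. The graph also joins all lattice translates of one point, which makes the channel path
connected. Point reflection exchanges this channel with the other one. -/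

namespace Gyroid

noncomputable section

/-! ### Free groups and maximal abelian covers -/

/-- A surjective homomorphism from the free group of rank `n` onto `ℤⁿ` has the commutator
subgroup as its kernel. -/
theorem ker_eq_commutator_of_surjective {ι G A : Type} [Finite ι] [Group G] [CommGroup A]
    (e : G ≃* FreeGroup ι) (a : A ≃* Multiplicative (ι → ℤ)) (ψ : G →* A)
    (hψ : Function.Surjective ψ) : ψ.ker = commutator G := by
  have := Fintype.ofFinite ι
  refine le_antisymm (fun g hg => ?_) (Abelianization.commutator_subset_ker ψ)
  let χ : FreeGroup ι →* Multiplicative (ι → ℤ) := (a : A →* _).comp (ψ.comp e.symm)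
  have hχ : Function.Surjective χ := a.surjective.comp (hψ.comp e.symm.surjective)
  let f : FreeAbelianGroup ι →+ (ι → ℤ) := MonoidHom.toAdditiveLeft (Abelianization.lift χ)
  have hf : Function.Surjective f := by
    intro y
    obtain ⟨w, hw⟩ := hχ (Multiplicative.ofAdd y)
    exact ⟨Additive.ofMul (Abelianization.of w), by
      change Multiplicative.toAdd (Abelianization.lift χ (Abelianization.of w)) = y
      rw [Abelianization.lift_apply_of, hw]; rfl⟩
  let k : (ι → ℤ) ≃+ FreeAbelianGroup ι :=
    ((FreeAbelianGroup.equivFinsupp ι).trans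
      (Finsupp.linearEquivFunOnFinite ℤ ℤ ι).toAddEquiv).symm
  -- A surjective endomorphism of a finitely generated module over a commutative ring is injective;
  -- this is where the equality of the two ranks enters.
  have hinj : Function.Injective (f.comp k.toAddMonoidHom).toIntLinearMap :=
    OrzechProperty.injective_of_surjective_endomorphism _ (hf.comp k.surjective)
  have hfi : Function.Injective f := by
    intro x y hxy
    have h := @hinj (k.symm x) (k.symm y) (by simpa using hxy)
    exact k.symm.injective h
  have h1 : Abelianization.of (e g) = 1 := by
    apply Additive.ofMul.injective
    apply @hfi
    change Multiplicative.toAdd (Abelianization.lift χ (Abelianization.of (e g))) =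
      Multiplicative.toAdd (Abelianization.lift χ 1)
    rw [Abelianization.lift_apply_of, map_one]
    have : χ (e g) = 1 := by
      have hg' : ψ g = 1 := hg
      simp [χ, hg']
    rw [this]
  have h2 : e g ∈ commutator (FreeGroup ι) := by
    rw [← Abelianization.ker_of]; exact h1
  have h3 : (commutator G).map (e : G →* FreeGroup ι) = commutator (FreeGroup ι) := by
    rw [commutator_def, Subgroup.map_commutator, ← MonoidHom.range_eq_map,
      MonoidHom.range_eq_top.2 e.surjective, commutator_def]
  rw [← h3] at h2
  obtain ⟨g', hg', h⟩ := h2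
  exact e.injective h ▸ hg'

/-- A quotient covering map of a path connected space by a group of rank three, such that the
fundamental group of the base is free of rank three, is the maximal abelian cover. -/
theorem isMaximalAbelianCover_of_quotientCoveringMap {E B G : Type} [TopologicalSpace E]
    [TopologicalSpace B] [AddCommGroup G] [AddAction G E] (p : C(E, B))
    (hp : IsAddQuotientCoveringMap p G) [PathConnectedSpace E] (a : G ≃+ (Fin 3 → ℤ))
    (hB : ∀ y : B, Nonempty (FundamentalGroup B y ≃* FreeGroup (Fin 3))) :
    (∀ x : E, Nonempty (FundamentalGroup E x ≃* commutator (FreeGroup (Fin 3)))) ∧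
      IsMaximalAbelianCover p := by
  have range_eq : ∀ x : E, (FundamentalGroup.map p x).range =
      commutator (FundamentalGroup B (p x)) := by
    intro x
    obtain ⟨e⟩ := hB (p x)
    let x' : p ⁻¹' {p x} := ⟨x, rfl⟩
    have h1 := hp.ker_fundamentalGroupToMulOpposite x'
    rw [hp.ker_monodromyPerm x'] at h1
    -- Monodromy takes values in the opposite of the deck group, which is the deck group itself by
    -- commutativity. It is onto because `E` is path connected.
    have h2 := ker_eq_commutator_of_surjective e
      (MulEquiv.trans (MulOpposite.opMulEquiv (M := Multiplicative G)).symm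
        (AddEquiv.toMultiplicative a))
      (hp.fundamentalGroupToMulOpposite x') (hp.fundamentalGroupToMulOpposite_surjective x')
    rw [← h2, h1]
    congr 1
    ext γ
    exact ((FundamentalGroup.mapOfEq_apply p (rfl : p x = p x) γ).trans
      (Path.Homotopic.Quotient.cast_rfl_rfl _)).symm
  refine ⟨fun x => ?_, hp.isCoveringMap, hp.surjective, inferInstance, range_eq⟩
  obtain ⟨e⟩ := hB (p x)
  have hinj : Function.Injective (FundamentalGroup.map p x) :=
    hp.isCoveringMap.injective_path_homotopic_map x x
  have h3 : (commutator (FundamentalGroup B (p x))).map (e : _ →* FreeGroup (Fin 3)) =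
      commutator (FreeGroup (Fin 3)) := by
    rw [commutator_def, Subgroup.map_commutator, ← MonoidHom.range_eq_map,
      MonoidHom.range_eq_top.2 e.surjective, commutator_def]
  exact ⟨((MonoidHom.ofInjective hinj).trans (MulEquiv.subgroupCongr (range_eq x))).trans
    (((commutator _).equivMapOfInjective (e : _ →* FreeGroup (Fin 3)) e.injective).trans
      (MulEquiv.subgroupCongr h3))⟩

end

end Gyroid

/-! ### A van Kampen theorem for covers modelled on a graph -/

namespace Gyroid

noncomputable section

/-! ### Paths in simply connected subsets -/

section SimplyConnected

open CategoryTheory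

variable {X : Type} [TopologicalSpace X]

/-- The class of a path, as a morphism of the fundamental groupoid. -/
def pathHom {x y : X} (γ : Path x y) : FundamentalGroupoid.mk x ⟶ FundamentalGroupoid.mk y :=
  Path.Homotopic.Quotient.mk γ

theorem pathHom_refl (x : X) : pathHom (Path.refl x) = 𝟙 (FundamentalGroupoid.mk x) := rfl

theorem pathHom_trans {x y z : X} (γ : Path x y) (δ : Path y z) :
    pathHom (γ.trans δ) = pathHom γ ≫ pathHom δ := rfl

/-- The class of the paths from `x` to `y` in a simply connected set. -/
def homIn {A : Set X} (hA : IsSimplyConnected A) {x y : X} (hx : x ∈ A) (hy : y ∈ A) :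
    FundamentalGroupoid.mk x ⟶ FundamentalGroupoid.mk y :=
  pathHom (hA.isPathConnected.joinedIn x hx y hy).somePath

theorem pathHom_eq_of_range_subset {A : Set X} (hA : IsSimplyConnected A) {x y : X}
    (γ δ : Path x y) (hγ : ∀ t, γ t ∈ A) (hδ : ∀ t, δ t ∈ A) : pathHom γ = pathHom δ := by
  have := hA.simplyConnectedSpace
  have hx : x ∈ A := by simpa using hγ 0
  have hy : y ∈ A := by simpa using hγ 1
  let γ' : Path (⟨x, hx⟩ : A) ⟨y, hy⟩ :=
    { toFun := fun t => ⟨γ t, hγ t⟩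
      continuous_toFun := by fun_prop
      source' := by simp
      target' := by simp }
  let δ' : Path (⟨x, hx⟩ : A) ⟨y, hy⟩ :=
    { toFun := fun t => ⟨δ t, hδ t⟩
      continuous_toFun := by fun_prop
      source' := by simp
      target' := by simp }
  exact Path.Homotopic.Quotient.eq.2
    ((SimplyConnectedSpace.paths_homotopic γ' δ').map ⟨Subtype.val, continuous_subtype_val⟩)

theorem pathHom_eq_homIn {A : Set X} (hA : IsSimplyConnected A) {x y : X} (hx : x ∈ A)
    (hy : y ∈ A) (γ : Path x y) (hγ : ∀ t, γ t ∈ A) : pathHom γ = homIn hA hx hy :=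
  pathHom_eq_of_range_subset hA _ _ hγ (JoinedIn.somePath_mem _)

theorem homIn_comp {A : Set X} (hA : IsSimplyConnected A) {x y z : X} (hx : x ∈ A)
    (hy : y ∈ A) (hz : z ∈ A) : homIn hA hx hy ≫ homIn hA hy hz = homIn hA hx hz := by
  rw [homIn, homIn, ← pathHom_trans]
  refine pathHom_eq_homIn hA hx hz _ fun t => ?_
  have h : ∀ t, ((hA.isPathConnected.joinedIn x hx y hy).somePath.trans
      (hA.isPathConnected.joinedIn y hy z hz).somePath) t ∈ A := by
    rw [← Set.range_subset_iff, Path.trans_range]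
    exact Set.union_subset (Set.range_subset_iff.2 (JoinedIn.somePath_mem _))
      (Set.range_subset_iff.2 (JoinedIn.somePath_mem _))
  exact h t

theorem homIn_self {A : Set X} (hA : IsSimplyConnected A) {x : X} (hx : x ∈ A) :
    homIn hA hx hx = 𝟙 _ := by
  rw [← pathHom_refl]
  exact (pathHom_eq_homIn hA hx hx _ fun t => hx).symm

/-- A single path inside `A ∩ B` represents both classes, so the intersection need only be path
connected. -/
theorem homIn_eq_homIn {A B : Set X} (hA : IsSimplyConnected A) (hB : IsSimplyConnected B)
    (hAB : IsPathConnected (A ∩ B)) {x y : X} (hx : x ∈ A ∩ B) (hy : y ∈ A ∩ B) :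
    homIn hA hx.1 hy.1 = homIn hB hx.2 hy.2 := by
  have h := (hAB.joinedIn x hx y hy).somePath_mem
  rw [← pathHom_eq_homIn hA hx.1 hy.1 _ fun t => (h t).1,
    ← pathHom_eq_homIn hB hx.2 hy.2 _ fun t => (h t).2]

/-- Multiplication in the fundamental group is composition in reverse order: `f ≫ g` is the product
`g * f`. -/
theorem comp_mem {x : X} {H : Subgroup (FundamentalGroup X x)}
    {f g : FundamentalGroupoid.mk x ⟶ FundamentalGroupoid.mk x} (hf : f ∈ H) (hg : g ∈ H) :
    f ≫ g ∈ H := H.mul_mem hg hf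

theorem inv_mem_of_mem {x : X} {H : Subgroup (FundamentalGroup X x)}
    {f : FundamentalGroupoid.mk x ⟶ FundamentalGroupoid.mk x} (hf : f ∈ H) : inv f ∈ H := by
  rw [← Groupoid.inv_eq_inv]
  exact H.inv_mem hf

/-- A property of paths that holds for the constituents of a sufficiently fine subdivision and is
inherited by concatenations holds for all paths. -/
theorem pathHom_induction {ι : Type} (A : ι → Set X) (hA : ∀ i, IsOpen (A i))
    (hc : ∀ x, ∃ i, x ∈ A i)
    (P : ∀ x y : X, (FundamentalGroupoid.mk x ⟶ FundamentalGroupoid.mk y) → Prop)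
    (hP : ∀ i x y (γ : Path x y), (∀ t, γ t ∈ A i) → P x y (pathHom γ))
    (hmul : ∀ x y z f g, P x y f → P y z g → P x z (f ≫ g)) {x y : X} (γ : Path x y) :
    P x y (pathHom γ) := by
  -- Subpaths of `γ` start and end at values of `γ`, and `γ 0`, `γ 1` agree with `x`, `y` only up to
  -- a propositional equality.
  have step : ∀ (a b : X) (ha : a = x) (hb : b = y), P a b (pathHom (γ.cast ha hb)) →
      P x y (pathHom γ) := by
    rintro a b rfl rfl h
    exact h
  apply step _ _ γ.source γ.target
  rw [← Path.subpath_zero_one]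
  -- The Lebesgue number argument: `t` increases from `0`, equals `1` from the index `n` on, and `γ`
  -- maps each interval between consecutive terms into one set of the cover.
  obtain ⟨t, h0, hm, ⟨n, hn⟩, ht⟩ := exists_monotone_Icc_subset_open_cover_unitInterval
    (c := fun i => γ ⁻¹' A i) (fun i => (hA i).preimage γ.continuous)
    (fun s _ => Set.mem_iUnion.2 (hc (γ s)))
  have key : ∀ m, P _ _ (pathHom (γ.subpath 0 (t m))) := by
    intro m
    induction m with
    | zero =>
      rw [h0, Path.subpath_self]
      obtain ⟨i, hi⟩ := hc (γ 0)
      exact hP i _ _ _ fun _ => hi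
    | succ m ih =>
      have h1 : pathHom (γ.subpath 0 (t (m + 1))) =
          pathHom (γ.subpath 0 (t m)) ≫ pathHom (γ.subpath (t m) (t (m + 1))) := by
        rw [← pathHom_trans]
        exact (Path.Homotopic.Quotient.eq.2
          ⟨Path.Homotopy.subpathTransSubpath γ 0 (t m) (t (m + 1))⟩).symm
      rw [h1]
      refine hmul _ _ _ _ _ ih ?_
      obtain ⟨i, hi⟩ := ht m
      refine hP i _ _ _ ?_
      rw [← Set.range_subset_iff, Path.range_subpath_of_le _ _ _ (hm (Nat.le_succ m))]
      exact Set.image_subset_iff.2 hi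
  have := key n
  rwa [hn n le_rfl] at this

end SimplyConnected

/-! ### Spaces covered by simply connected pieces along a graph -/

/-- A cover of a space by open simply connected sets, one for each vertex and one for each edge of
a graph. The graph has the vertices `Option ι`, edges from `none` to every `some i`, and further
edges from `s k` to `t k` for `k : κ`. -/
structure GraphCover (X : Type) [TopologicalSpace X] (ι κ : Type) (s t : κ → Option ι) where
  /-- The set of a vertex. -/
  O : Option ι → Set X
  /-- The set of an edge. -/
  T : ι ⊕ κ → Set X
  isOpen_O : ∀ i, IsOpen (O i)
  isOpen_T : ∀ j, IsOpen (T j)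
  cover : ∀ x, (∃ i, x ∈ O i) ∨ ∃ j, x ∈ T j
  eq_of_mem_O : ∀ x i i', x ∈ O i → x ∈ O i' → i = i'
  eq_of_mem_T : ∀ x j j', x ∈ T j → x ∈ T j' → j = j'
  isSimplyConnected_O : ∀ i, IsSimplyConnected (O i)
  isSimplyConnected_T : ∀ j, IsSimplyConnected (T j)
  isPathConnected_src : ∀ j, IsPathConnected (O (Sum.elim (fun _ => none) s j) ∩ T j)
  isPathConnected_tgt : ∀ j, IsPathConnected (O (Sum.elim some t j) ∩ T j)
  incident : ∀ x i j, x ∈ O i → x ∈ T j →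
    i = Sum.elim (fun _ => none) s j ∨ i = Sum.elim some t j
  ne : ∀ k, s k ≠ t k

namespace GraphCover

open CategoryTheory

variable {X : Type} [TopologicalSpace X] {ι κ : Type} {s t : κ → Option ι}
  (U : GraphCover X ι κ s t)

/-- The initial vertex of an edge. -/
def src (_ : GraphCover X ι κ s t) (j : ι ⊕ κ) : Option ι := Sum.elim (fun _ => none) s j

/-- The final vertex of an edge. -/
def tgt (_ : GraphCover X ι κ s t) (j : ι ⊕ κ) : Option ι := Sum.elim some t j

theorem src_ne_tgt (j : ι ⊕ κ) : U.src j ≠ U.tgt j := by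
  rcases j with i | k
  · simp [src, tgt]
  · exact U.ne k

/-- All the sets of the cover. -/
def A (a : Option ι ⊕ (ι ⊕ κ)) : Set X := Sum.elim U.O U.T a

theorem isOpen_A (a) : IsOpen (U.A a) := by
  rcases a with i | j
  · exact U.isOpen_O i
  · exact U.isOpen_T j

theorem isSimplyConnected_A (a) : IsSimplyConnected (U.A a) := by
  rcases a with i | j
  · exact U.isSimplyConnected_O i
  · exact U.isSimplyConnected_T j

theorem exists_mem_A (x : X) : ∃ a, x ∈ U.A a := by
  rcases U.cover x with ⟨i, h⟩ | ⟨j, h⟩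
  · exact ⟨.inl i, h⟩
  · exact ⟨.inr j, h⟩

/-- A base point in the set of a vertex. -/
def vertexPt (i : Option ι) : X := (U.isSimplyConnected_O i).nonempty.choose

theorem vertexPt_mem (i) : U.vertexPt i ∈ U.O i := (U.isSimplyConnected_O i).nonempty.choose_spec

/-- A point of the set of an edge that also belongs to the set of the initial vertex. -/
def srcPt (j : ι ⊕ κ) : X := (U.isPathConnected_src j).nonempty.choose

theorem srcPt_mem (j) : U.srcPt j ∈ U.O (U.src j) ∩ U.T j :=
  (U.isPathConnected_src j).nonempty.choose_spec

/-- A point of the set of an edge that also belongs to the set of the final vertex. -/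
def tgtPt (j : ι ⊕ κ) : X := (U.isPathConnected_tgt j).nonempty.choose

theorem tgtPt_mem (j) : U.tgtPt j ∈ U.O (U.tgt j) ∩ U.T j :=
  (U.isPathConnected_tgt j).nonempty.choose_spec

/-- The base point of the space. -/
abbrev base : X := U.vertexPt none

/-- The path from the base point to the base point of a vertex, along the spanning tree. -/
def treeHom : (i : Option ι) →
    (FundamentalGroupoid.mk U.base ⟶ FundamentalGroupoid.mk (U.vertexPt i))
  | none => 𝟙 _
  | some i => homIn (U.isSimplyConnected_O none) (U.vertexPt_mem none) (U.srcPt_mem (.inl i)).1 ≫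
      homIn (U.isSimplyConnected_T (.inl i)) (U.srcPt_mem (.inl i)).2 (U.tgtPt_mem (.inl i)).2 ≫
      homIn (U.isSimplyConnected_O (some i)) (U.tgtPt_mem (.inl i)).1 (U.vertexPt_mem (some i))

/-- The standard path from the base point to a point of one of the sets of the cover. -/
def stdHom : (a : Option ι ⊕ (ι ⊕ κ)) → (x : X) → (hx : x ∈ U.A a) →
    (FundamentalGroupoid.mk U.base ⟶ FundamentalGroupoid.mk x)
  | .inl i, _, hx => U.treeHom i ≫ homIn (U.isSimplyConnected_O i) (U.vertexPt_mem i) hx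
  | .inr j, _, hx => U.treeHom (U.src j) ≫
      homIn (U.isSimplyConnected_O _) (U.vertexPt_mem _) (U.srcPt_mem j).1 ≫
      homIn (U.isSimplyConnected_T j) (U.srcPt_mem j).2 hx

theorem stdHom_comp (a) {x y : X} (hx : x ∈ U.A a) (hy : y ∈ U.A a) :
    U.stdHom a x hx ≫ homIn (U.isSimplyConnected_A a) hx hy = U.stdHom a y hy := by
  rcases a with i | j
  · simp only [stdHom, Category.assoc]
    rw [← homIn_comp (U.isSimplyConnected_O i) (U.vertexPt_mem i) hx hy]
    rfl
  · simp only [stdHom, Category.assoc]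
    rw [← homIn_comp (U.isSimplyConnected_T j) (U.srcPt_mem j).2 hx hy]
    rfl

theorem stdHom_base : U.stdHom (.inl none) U.base (U.vertexPt_mem none) = 𝟙 _ := by
  exact (Category.id_comp _).trans (homIn_self _ _)

/-- The standard path into the set of an edge enters through the initial vertex, so on this overlap
the two standard paths agree without any correction. -/
theorem stdHom_src (j) {x : X} (hx : x ∈ U.O (U.src j) ∩ U.T j) :
    U.stdHom (.inl (U.src j)) x hx.1 = U.stdHom (.inr j) x hx.2 := by
  simp only [stdHom]
  rw [← homIn_comp _ (U.vertexPt_mem _) (U.srcPt_mem j).1 hx.1]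
  exact congrArg (fun f => U.treeHom (U.src j) ≫ homIn _ _ _ ≫ f) (homIn_eq_homIn _
    (U.isSimplyConnected_T j) (U.isPathConnected_src j) (U.srcPt_mem j) hx)

/-- The loop that runs from the base point through an edge and back. -/
def loop (j : ι ⊕ κ) : FundamentalGroup X U.base :=
  U.stdHom (.inr j) (U.tgtPt j) (U.tgtPt_mem j).2 ≫
    inv (U.stdHom (.inl (U.tgt j)) (U.tgtPt j) (U.tgtPt_mem j).1)

/-- At the final vertex the two standard paths differ by the loop of the edge. Path connectedness of
the overlap makes this independent of the point `x`. -/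
theorem stdHom_tgt (j) {x : X} (hx : x ∈ U.O (U.tgt j) ∩ U.T j) :
    U.stdHom (.inr j) x hx.2 ≫ inv (U.stdHom (.inl (U.tgt j)) x hx.1) = U.loop j := by
  have h1 := U.stdHom_comp (.inr j) (U.tgtPt_mem j).2 hx.2
  have h2 := U.stdHom_comp (.inl (U.tgt j)) (U.tgtPt_mem j).1 hx.1
  have h3 := homIn_eq_homIn (U.isSimplyConnected_O _) (U.isSimplyConnected_T j)
    (U.isPathConnected_tgt j) (U.tgtPt_mem j) hx
  have h3' : homIn (U.isSimplyConnected_A (.inl (U.tgt j))) (U.tgtPt_mem j).1 hx.1 =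
    homIn (U.isSimplyConnected_A (.inr j)) (U.tgtPt_mem j).2 hx.2 := h3
  rw [← h1, ← h2, h3', loop, IsIso.inv_comp, Category.assoc, IsIso.hom_inv_id_assoc]

/-- The path to the vertex `some i` was chosen through this very edge of the tree, so going out and
back cancels. -/
theorem loop_inl (i : ι) : U.loop (.inl i) = 𝟙 _ := by
  have h : U.stdHom (.inr (.inl i)) (U.tgtPt (.inl i)) (U.tgtPt_mem (.inl i)).2 =
      U.stdHom (.inl (some i)) (U.tgtPt (.inl i)) (U.tgtPt_mem (.inl i)).1 := by
    have h1 : U.stdHom (.inl (some i)) (U.tgtPt (.inl i)) (U.tgtPt_mem (.inl i)).1 =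
        homIn (U.isSimplyConnected_O none) (U.vertexPt_mem none) (U.srcPt_mem (.inl i)).1 ≫
          homIn (U.isSimplyConnected_T (.inl i)) (U.srcPt_mem (.inl i)).2
            (U.tgtPt_mem (.inl i)).2 := by
      have e : homIn (U.isSimplyConnected_O (some i)) (U.tgtPt_mem (.inl i)).1
          (U.vertexPt_mem (some i)) ≫ homIn (U.isSimplyConnected_O (some i))
            (U.vertexPt_mem (some i)) (U.tgtPt_mem (.inl i)).1 = 𝟙 _ :=
        (homIn_comp _ _ _ _).trans (homIn_self _ _)
      have assoc : ∀ {a b c d : FundamentalGroupoid X} (f : a ⟶ b) (g : b ⟶ c) (k : c ⟶ d)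
          (k' : d ⟶ c), k ≫ k' = 𝟙 _ → (f ≫ g ≫ k) ≫ k' = f ≫ g := by
        intro a b c d f g k k' h
        simp [h]
      exact assoc _ _ _ _ e
    rw [h1]
    exact Category.id_comp _
  rw [loop]
  have h2 : ∀ (f g : FundamentalGroupoid.mk U.base ⟶ FundamentalGroupoid.mk (U.tgtPt (.inl i))),
    f = g → f ≫ inv g = 𝟙 _ := by rintro f _ rfl; simp
  exact h2 _ _ h

/-- The homomorphism from a free group to the fundamental group. -/
def hom : FreeGroup κ →* FundamentalGroup X U.base := FreeGroup.lift fun k => U.loop (.inr k)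

theorem loop_mem_range (j) : U.loop j ∈ U.hom.range := by
  rcases j with i | k
  · rw [loop_inl]; exact one_mem _
  · exact ⟨.of k, by simp [hom]⟩

/-- Two different sets of the cover share a point only if one belongs to a vertex and the other to
an incident edge. The discrepancy of the standard paths is then trivial at the initial vertex, and
the loop of the edge or its inverse at the final vertex. -/
theorem stdHom_inv_mem_range {a b} {x : X} (ha : x ∈ U.A a) (hb : x ∈ U.A b) :
    (U.stdHom a x ha ≫ inv (U.stdHom b x hb) : FundamentalGroup X U.base) ∈ U.hom.range := by
  have hinv : ∀ {a b} (ha : x ∈ U.A a) (hb : x ∈ U.A b),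
      (U.stdHom a x ha ≫ inv (U.stdHom b x hb) : FundamentalGroup X U.base) ∈ U.hom.range →
      (U.stdHom b x hb ≫ inv (U.stdHom a x ha) : FundamentalGroup X U.base) ∈ U.hom.range := by
    intro a b ha hb h
    simpa using inv_mem_of_mem h
  have hself : ∀ {a} (ha : x ∈ U.A a),
      (U.stdHom a x ha ≫ inv (U.stdHom a x ha) : FundamentalGroup X U.base) ∈ U.hom.range := by
    intro a ha
    rw [IsIso.hom_inv_id]
    exact one_mem _
  have hOT : ∀ i j (hi : x ∈ U.A (.inl i)) (hj : x ∈ U.A (.inr j)),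
      (U.stdHom (.inr j) x hj ≫ inv (U.stdHom (.inl i) x hi) : FundamentalGroup X U.base) ∈
        U.hom.range := by
    intro i j hi hj
    rcases U.incident x i j hi hj with h | h
    · obtain rfl : i = U.src j := h
      rw [U.stdHom_src j ⟨hi, hj⟩, IsIso.hom_inv_id]
      exact one_mem _
    · obtain rfl : i = U.tgt j := h
      rw [U.stdHom_tgt j ⟨hi, hj⟩]
      exact U.loop_mem_range j
  rcases a with i | j <;> rcases b with i' | j'
  · obtain rfl := U.eq_of_mem_O x i i' ha hb
    exact hself ha
  · exact hinv _ _ (hOT i j' ha hb)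
  · exact hOT i' j hb ha
  · obtain rfl := U.eq_of_mem_T x j j' ha hb
    exact hself ha

/-- A path is closed up by standard paths to its two endpoints, and the claim is that the result
lies in the range for every choice of pieces containing them. This form is stable under
concatenation, so subdivision reduces it to paths inside one piece, where it is a comparison of
standard paths. -/
theorem hom_surjective : Function.Surjective U.hom := by
  rw [← MonoidHom.range_eq_top, Subgroup.eq_top_iff']
  intro f
  let P : ∀ x y : X, (FundamentalGroupoid.mk x ⟶ FundamentalGroupoid.mk y) → Prop :=
    fun x y f => ∀ a b (ha : x ∈ U.A a) (hb : y ∈ U.A b),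
      (U.stdHom a x ha ≫ f ≫ inv (U.stdHom b y hb) : FundamentalGroup X U.base) ∈ U.hom.range
  have hP : ∀ {x y : X} (γ : Path x y), P x y (pathHom γ) := by
    intro x y γ
    refine pathHom_induction U.A U.isOpen_A U.exists_mem_A P ?_ ?_ γ
    · intro i x y γ hγ a b ha hb
      have hx : x ∈ U.A i := by simpa using hγ 0
      have hy : y ∈ U.A i := by simpa using hγ 1
      rw [pathHom_eq_homIn (U.isSimplyConnected_A i) hx hy γ hγ]
      have h1 : U.stdHom a x ha ≫ homIn (U.isSimplyConnected_A i) hx hy ≫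
          inv (U.stdHom b y hb) = (U.stdHom a x ha ≫ inv (U.stdHom i x hx)) ≫
            (U.stdHom i y hy ≫ inv (U.stdHom b y hb)) := by
        rw [← U.stdHom_comp i hx hy]
        simp
      rw [h1]
      exact comp_mem (U.stdHom_inv_mem_range ha hx) (U.stdHom_inv_mem_range hy hb)
    · intro x y z f g hf hg a b ha hb
      obtain ⟨c, hc⟩ := U.exists_mem_A y
      have h1 : U.stdHom a x ha ≫ (f ≫ g) ≫ inv (U.stdHom b z hb) =
          (U.stdHom a x ha ≫ f ≫ inv (U.stdHom c y hc)) ≫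
            (U.stdHom c y hc ≫ g ≫ inv (U.stdHom b z hb)) := by
        simp
      rw [h1]
      exact comp_mem (hf a c ha hc) (hg c b hc hb)
  obtain ⟨γ, rfl⟩ := Path.Homotopic.Quotient.mk_surjective f
  have h := hP γ (.inl none) (.inl none) (U.vertexPt_mem none) (U.vertexPt_mem none)
  have h1 : ∀ (f g : FundamentalGroupoid.mk U.base ⟶ FundamentalGroupoid.mk U.base),
      g = 𝟙 _ → g ≫ f ≫ inv g = f := by rintro f _ rfl; simp
  have h2 := h1 (pathHom γ) _ U.stdHom_base
  have h3 : ∀ f g : FundamentalGroupoid.mk U.base ⟶ FundamentalGroupoid.mk U.base,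
      f = g → f ∈ U.hom.range → g ∈ U.hom.range := by
    rintro f _ rfl hf
    exact hf
  exact h3 _ _ h2 h

/-! ### The covering space with fibre the free group -/

open Classical in
/-- The transition from the set of an edge to the set of a vertex. -/
def edgeTrans (j : ι ⊕ κ) (i : Option ι) : FreeGroup κ :=
  if i = U.tgt j then Sum.elim (fun _ => 1) FreeGroup.of j else 1

/-- The transitions between the sets of the cover. -/
def trans : Option ι ⊕ (ι ⊕ κ) → Option ι ⊕ (ι ⊕ κ) → FreeGroup κ
  | .inl _, .inl _ => 1
  | .inr _, .inr _ => 1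
  | .inr j, .inl i => U.edgeTrans j i
  | .inl i, .inr j => (U.edgeTrans j i)⁻¹

theorem trans_self (a) : U.trans a a = 1 := by
  rcases a with i | j <;> rfl

/-- Among three sets of the cover two are of the same kind, and sets of the same kind with a common
point coincide. The cocycle condition therefore has no genuine triple overlaps to check. -/
theorem trans_mul {a b c} {x : X} (ha : x ∈ U.A a) (hb : x ∈ U.A b) (hc : x ∈ U.A c) :
    U.trans b c * U.trans a b = U.trans a c := by
  have hO : ∀ {i i'}, x ∈ U.A (.inl i) → x ∈ U.A (.inl i') → i = i' :=
    fun h h' => U.eq_of_mem_O x _ _ h h'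
  have hT : ∀ {i i'}, x ∈ U.A (.inr i) → x ∈ U.A (.inr i') → i = i' :=
    fun h h' => U.eq_of_mem_T x _ _ h h'
  rcases a with i | j <;> rcases b with i' | j' <;> rcases c with i'' | j''
  · simp [trans]
  · obtain rfl := hO ha hb
    simp [trans]
  · obtain rfl := hO ha hc
    simp [trans]
  · obtain rfl := hT hb hc
    simp [trans]
  · obtain rfl := hO hb hc
    simp [trans]
  · obtain rfl := hT ha hc
    simp [trans]
  · obtain rfl := hT ha hb
    simp [trans]
  · simp [trans]

instance : TopologicalSpace (FreeGroup κ) := ⊥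

instance : DiscreteTopology (FreeGroup κ) := ⟨rfl⟩

/-- The fibre bundle with fibre the free group. -/
def bundle : FiberBundleCore (Option ι ⊕ (ι ⊕ κ)) X (FreeGroup κ) where
  baseSet := U.A
  isOpen_baseSet := U.isOpen_A
  indexAt x := (U.exists_mem_A x).choose
  mem_baseSet_at x := (U.exists_mem_A x).choose_spec
  coordChange a b _ v := U.trans a b * v
  coordChange_self a x _ v := by rw [trans_self, one_mul]
  continuousOn_coordChange a b :=
    ((continuous_of_discreteTopology (f := fun v : FreeGroup κ => U.trans a b * v)).comp
      continuous_snd).continuousOn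
  coordChange_comp a b c x hx v := by
    rw [← mul_assoc, U.trans_mul hx.1.1 hx.1.2 hx.2]

theorem isCoveringMap_bundle : IsCoveringMap U.bundle.proj :=
  FiberBundle.isCoveringMap (F := FreeGroup κ) (E := U.bundle.Fiber)

/-- The point over `x` with given coordinate in one of the local trivializations. -/
def fiberPt (a : Option ι ⊕ (ι ⊕ κ)) (x : X) (v : FreeGroup κ) : U.bundle.proj ⁻¹' {x} :=
  ⟨⟨x, U.trans a (U.bundle.indexAt x) * v⟩, rfl⟩

theorem fiberPt_injective (a) (x : X) : Function.Injective (U.fiberPt a x) := by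
  intro v w h
  exact mul_left_cancel (G := FreeGroup κ)
    (Bundle.TotalSpace.mk_inj (E := U.bundle.Fiber).1 (congrArg Subtype.val h))

theorem fiberPt_eq {a b} {x : X} (ha : x ∈ U.A a) (hb : x ∈ U.A b) (v : FreeGroup κ) :
    U.fiberPt a x v = U.fiberPt b x (U.trans a b * v) := by
  rw [fiberPt, fiberPt]
  congr 2
  rw [← mul_assoc, U.trans_mul ha hb (U.bundle.mem_baseSet_at x)]

/-- In the local trivialization over `U.A a` the lift of `γ` keeps its coordinate `v` constant. -/
theorem monodromy_pathHom (a) {x y : X} (γ : Path x y) (hγ : ∀ t, γ t ∈ U.A a)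
    (v : FreeGroup κ) :
    U.isCoveringMap_bundle.monodromy (pathHom γ) (U.fiberPt a x v) = U.fiberPt a y v := by
  have hx : x ∈ U.A a := by simpa using hγ 0
  have hc : Continuous fun t => ((U.bundle.localTriv a).toOpenPartialHomeomorph.symm (γ t, v)) := by
    rw [← continuousOn_univ]
    refine (U.bundle.localTriv a).toOpenPartialHomeomorph.continuousOn_symm.comp
      (by fun_prop) fun t _ => ?_
    exact (U.bundle.mem_localTriv_target a _).2 (hγ t)
  let Γ : Path (U.fiberPt a x v).1 (U.fiberPt a y v).1 :=
    { toFun := fun t => (U.bundle.localTriv a).toOpenPartialHomeomorph.symm (γ t, v)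
      continuous_toFun := hc
      source' := by rw [γ.source]; rfl
      target' := by rw [γ.target]; rfl }
  refine U.isCoveringMap_bundle.monodromy_eq_of_map_eq (Path.Homotopic.Quotient.mk Γ) ?_
  rfl

theorem monodromy_comp {x y z : X} (f : FundamentalGroupoid.mk x ⟶ FundamentalGroupoid.mk y)
    (g : FundamentalGroupoid.mk y ⟶ FundamentalGroupoid.mk z) (e) :
    U.isCoveringMap_bundle.monodromy (f ≫ g) e =
      U.isCoveringMap_bundle.monodromy g (U.isCoveringMap_bundle.monodromy f e) :=
  U.isCoveringMap_bundle.monodromy_trans_apply f g e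

theorem monodromy_id {x : X} (e) :
    U.isCoveringMap_bundle.monodromy (𝟙 (FundamentalGroupoid.mk x)) e = e :=
  congrFun U.isCoveringMap_bundle.monodromy_refl e

theorem monodromy_homIn (a) {x y : X} (hx : x ∈ U.A a) (hy : y ∈ U.A a) (v : FreeGroup κ) :
    U.isCoveringMap_bundle.monodromy (homIn (U.isSimplyConnected_A a) hx hy) (U.fiberPt a x v) =
      U.fiberPt a y v :=
  U.monodromy_pathHom a _ (JoinedIn.somePath_mem _) v

/-- The absence of loops in the model graph matters here: the transition can be trivial at one end
of an edge and a generator at the other only if the ends are different vertices. -/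
theorem edgeTrans_src (j) : U.edgeTrans j (U.src j) = 1 := if_neg (U.src_ne_tgt j)

theorem fiberPt_src (j) {x : X} (hx : x ∈ U.O (U.src j) ∩ U.T j) (v : FreeGroup κ) :
    U.fiberPt (.inl (U.src j)) x v = U.fiberPt (.inr j) x v := by
  rw [U.fiberPt_eq (a := .inl (U.src j)) (b := .inr j) hx.1 hx.2, trans, edgeTrans_src, inv_one,
    one_mul]

theorem fiberPt_tgt (j) {x : X} (hx : x ∈ U.O (U.tgt j) ∩ U.T j) (v : FreeGroup κ) :
    U.fiberPt (.inr j) x v =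
      U.fiberPt (.inl (U.tgt j)) x (Sum.elim (fun _ => 1) FreeGroup.of j * v) := by
  rw [U.fiberPt_eq (a := .inr j) (b := .inl (U.tgt j)) hx.2 hx.1, trans, edgeTrans, if_pos rfl]

theorem monodromy_treeHom (i : Option ι) (v : FreeGroup κ) :
    U.isCoveringMap_bundle.monodromy (U.treeHom i) (U.fiberPt (.inl none) U.base v) =
      U.fiberPt (.inl i) (U.vertexPt i) v := by
  rcases i with _ | i
  · exact U.monodromy_id _
  · rw [treeHom, monodromy_comp, monodromy_comp]
    have h1 := U.monodromy_homIn (.inl none) (U.vertexPt_mem none) (U.srcPt_mem (.inl i)).1 v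
    have h2 := U.fiberPt_src (.inl i) (U.srcPt_mem (.inl i)) v
    have h3 := U.monodromy_homIn (.inr (.inl i)) (U.srcPt_mem (.inl i)).2
      (U.tgtPt_mem (.inl i)).2 v
    have h4 := U.fiberPt_tgt (.inl i) (U.tgtPt_mem (.inl i)) v
    rw [Sum.elim_inl, one_mul] at h4
    have h5 := U.monodromy_homIn (.inl (some i)) (U.tgtPt_mem (.inl i)).1
      (U.vertexPt_mem (some i)) v
    exact (congrArg _ ((congrArg _ (h1.trans h2)).trans (h3.trans h4))).trans h5

theorem monodromy_stdHom (a) {x : X} (hx : x ∈ U.A a) (v : FreeGroup κ) :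
    U.isCoveringMap_bundle.monodromy (U.stdHom a x hx) (U.fiberPt (.inl none) U.base v) =
      U.fiberPt a x v := by
  rcases a with i | j
  · rw [stdHom, monodromy_comp, monodromy_treeHom]
    exact U.monodromy_homIn (.inl i) (U.vertexPt_mem i) hx v
  · rw [stdHom, monodromy_comp, monodromy_comp, monodromy_treeHom]
    have h1 := U.monodromy_homIn (.inl (U.src j)) (U.vertexPt_mem _) (U.srcPt_mem j).1 v
    have h2 := U.fiberPt_src j (U.srcPt_mem j) v
    exact (congrArg _ (h1.trans h2)).trans (U.monodromy_homIn (.inr j) (U.srcPt_mem j).2 hx v)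

/-- The coordinate changes only once along the loop, where the lift passes from the edge to its
final vertex; a tree edge contributes `1`, any other edge its generator. -/
theorem monodromy_loop (j) (v : FreeGroup κ) :
    U.isCoveringMap_bundle.monodromy (U.loop j) (U.fiberPt (.inl none) U.base v) =
      U.fiberPt (.inl none) U.base (Sum.elim (fun _ => 1) FreeGroup.of j * v) := by
  have hinv : ∀ {x y : X} (f : FundamentalGroupoid.mk x ⟶ FundamentalGroupoid.mk y) e e',
      U.isCoveringMap_bundle.monodromy f e = e' →
        U.isCoveringMap_bundle.monodromy (inv f) e' = e := by
    rintro x y f e _ rfl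
    rw [← monodromy_comp, IsIso.hom_inv_id, monodromy_id]
  have h1 := U.monodromy_stdHom (.inr j) (U.tgtPt_mem j).2 v
  have h2 := U.fiberPt_tgt j (U.tgtPt_mem j) v
  rw [loop, monodromy_comp]
  exact (congrArg _ (h1.trans h2)).trans
    (hinv _ _ _ (U.monodromy_stdHom (.inl (U.tgt j)) (U.tgtPt_mem j).1 _))

theorem monodromy_hom (w v : FreeGroup κ) :
    U.isCoveringMap_bundle.monodromy (U.hom w) (U.fiberPt (.inl none) U.base v) =
      U.fiberPt (.inl none) U.base (w * v) := by
  let m := U.isCoveringMap_bundle.monodromyPerm U.base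
  suffices h : ∀ v, m (U.hom w) (U.fiberPt (.inl none) U.base v) =
      U.fiberPt (.inl none) U.base (w * v) from h v
  induction w using FreeGroup.induction_on with
  | C1 =>
    intro v
    rw [map_one, map_one, one_mul]
    rfl
  | of k =>
    intro v
    have := U.monodromy_loop (.inr k) v
    simpa [hom, m] using this
  | inv_of k ih =>
    intro v
    rw [map_inv, map_inv, Equiv.Perm.inv_eq_iff_eq, ih, mul_inv_cancel_left]
  | mul x y hx hy =>
    intro v
    rw [map_mul, map_mul, Equiv.Perm.mul_apply, hy, hx, mul_assoc]

/-- The monodromy of the image of `w` carries the coordinate `1` to `w`. If the image is trivial,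
then `w = 1`. -/
theorem hom_injective : Function.Injective U.hom := by
  rw [injective_iff_map_eq_one]
  intro w hw
  have h1 := U.monodromy_hom w 1
  rw [hw] at h1
  have h2 := U.fiberPt_injective _ _ ((U.monodromy_id _).symm.trans h1)
  simpa using h2.symm

theorem nonempty_hom (x : X) :
    Nonempty (FundamentalGroupoid.mk U.base ⟶ FundamentalGroupoid.mk x) := by
  obtain ⟨a, ha⟩ := U.exists_mem_A x
  exact ⟨U.stdHom a x ha⟩

theorem pathConnectedSpace (U : GraphCover X ι κ s t) : PathConnectedSpace X where
  nonempty := ⟨U.base⟩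
  joined x y := by
    obtain ⟨f⟩ := U.nonempty_hom x
    obtain ⟨g⟩ := U.nonempty_hom y
    obtain ⟨γ, -⟩ := Path.Homotopic.Quotient.mk_surjective (inv f ≫ g)
    exact ⟨γ⟩

/-- The fundamental group of a space covered by simply connected pieces along a graph. -/
theorem nonempty_mulEquiv (U : GraphCover X ι κ s t) (x : X) : Nonempty (FundamentalGroup X x ≃* FreeGroup κ) := by
  have := U.pathConnectedSpace
  exact ⟨(FundamentalGroup.fundamentalGroupMulEquivOfPathConnected x U.base).trans
    (MulEquiv.ofBijective U.hom ⟨U.hom_injective, U.hom_surjective⟩).symm⟩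

end GraphCover

end

end Gyroid

/-! ### Realizations of graphs, the quotient graph `K₄` and the covering by the skeletal graph -/

namespace Gyroid

noncomputable section

/-! ### The topology of the realization of a graph -/

namespace OrGraph

variable {G H : OrGraph}

/-- The point of the realization given by a vertex. -/
def vertexPoint (i : G.V) : G.Realization := Quot.mk G.Glue (Sum.inl ⟨i, ()⟩)

/-- The point with parameter `t` on an oriented edge. -/
def edgePoint (d : G.D) (t : unitInterval) : G.Realization := Quot.mk G.Glue (Sum.inr ⟨d, t⟩)

theorem edgePoint_zero (d : G.D) : edgePoint d 0 = vertexPoint (G.src d) := Quot.sound (.src d)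

theorem edgePoint_symm (d : G.D) (t : unitInterval) :
    edgePoint (G.rev d) (unitInterval.symm t) = edgePoint d t := (Quot.sound (.rev d t)).symm

theorem edgePoint_one (d : G.D) : edgePoint d 1 = vertexPoint (G.tgt d) := by
  rw [← edgePoint_symm, unitInterval.symm_one, edgePoint_zero]
  rfl

theorem continuous_edgePoint (d : G.D) : Continuous (edgePoint d) :=
  continuous_quot_mk.comp (continuous_inr.comp continuous_sigmaMk)

/-- The vertices form a discrete space, so the quotient topology imposes conditions only on the
edges. -/
theorem isOpen_realization_iff {s : Set G.Realization} :
    IsOpen s ↔ ∀ d, IsOpen (edgePoint d ⁻¹' s) := by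
  refine ⟨fun h d => h.preimage (continuous_edgePoint d), fun h => ?_⟩
  change IsOpen (Quot.mk G.Glue ⁻¹' s)
  rw [isOpen_sum_iff]
  refine ⟨isOpen_sigma_iff.2 fun i => isOpen_discrete _, isOpen_sigma_iff.2 h⟩

theorem continuous_realization {Y : Type*} [TopologicalSpace Y] {f : G.Realization → Y}
    (h : ∀ d, Continuous fun t => f (edgePoint d t)) : Continuous f :=
  ⟨fun _ hs => isOpen_realization_iff.2 fun d => hs.preimage (h d)⟩

theorem exists_point (x : G.Realization) :
    (∃ i, x = vertexPoint i) ∨ ∃ d t, 0 < t ∧ t < 1 ∧ x = edgePoint d t := by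
  obtain ⟨⟨i, u⟩ | ⟨d, t⟩⟩ := x
  · exact .inl ⟨i, rfl⟩
  · rcases eq_or_ne t 0 with rfl | h0
    · exact .inl ⟨_, edgePoint_zero d⟩
    · rcases eq_or_ne t 1 with rfl | h1
      · exact .inl ⟨_, edgePoint_one d⟩
      · exact .inr ⟨d, t, unitInterval.pos_iff_ne_zero.2 h0, unitInterval.lt_one_iff_ne_one.2 h1,
          rfl⟩

/-- The membership in the open star of a vertex. -/
def starPred (i : G.V) : G.Cells → Prop :=
  Sum.elim (fun v => v.1 = i)
    fun e => G.src e.1 = i ∧ (e.2 : ℝ) < 1 / 3 ∨ G.tgt e.1 = i ∧ (2 / 3 : ℝ) < e.2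

/-- The open star of a vertex: all points at distance less than `1/3` on the edges. -/
def star (i : G.V) : Set G.Realization :=
  {x | Quot.lift (starPred i) (by
    rintro a b (d | ⟨d, t⟩)
    · have h : ¬ (2 / 3 : ℝ) < 0 := by norm_num
      simp [starPred, h]
    · simp only [starPred, Sum.elim_inr, tgt, G.rev_rev, unitInterval.coe_symm_eq]
      have h1 : ((2 / 3 : ℝ) < 1 - t) ↔ (t : ℝ) < 1 / 3 := by
        constructor <;> intro h <;> linarith
      have h2 : ((1 - t : ℝ) < 1 / 3) ↔ (2 / 3 : ℝ) < t := by
        constructor <;> intro h <;> linarith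
      rw [h1, h2, or_comm]) x}

theorem vertexPoint_mem_star {i j : G.V} : vertexPoint j ∈ star i ↔ j = i := Iff.rfl

theorem edgePoint_mem_star {d : G.D} {t : unitInterval} {i : G.V} : edgePoint d t ∈ star i ↔
    G.src d = i ∧ (t : ℝ) < 1 / 3 ∨ G.tgt d = i ∧ (2 / 3 : ℝ) < t := Iff.rfl

theorem isOpen_star (i : G.V) : IsOpen (star i) := by
  refine isOpen_realization_iff.2 fun d => ?_
  change IsOpen {t : unitInterval | G.src d = i ∧ (t : ℝ) < 1 / 3 ∨ G.tgt d = i ∧ (2 / 3 : ℝ) < t}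
  exact IsOpen.union (isOpen_const.and (isOpen_lt continuous_subtype_val continuous_const))
    (isOpen_const.and (isOpen_lt continuous_const continuous_subtype_val))

/-- Stars of radius `1/3` meet each edge in its first and last third, which are disjoint. For a loop
both thirds belong to the same star. -/
theorem eq_of_mem_star {x : G.Realization} {i j : G.V} (hi : x ∈ star i) (hj : x ∈ star j) :
    i = j := by
  rcases exists_point x with ⟨k, rfl⟩ | ⟨d, t, -, -, rfl⟩
  · rw [vertexPoint_mem_star] at hi hj
    exact hi.symm.trans hj
  · rw [edgePoint_mem_star] at hi hj
    rcases hi with ⟨hi, h⟩ | ⟨hi, h⟩ <;> rcases hj with ⟨hj, h'⟩ | ⟨hj, h'⟩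
    · exact hi.symm.trans hj
    · linarith
    · linarith
    · exact hi.symm.trans hj

/-- The membership in an open edge. -/
def edgePred (d : G.D) : G.Cells → Prop :=
  Sum.elim (fun _ => False) fun e => (e.1 = d ∨ e.1 = G.rev d) ∧ 0 < e.2 ∧ e.2 < 1

/-- An open edge. -/
def openEdge (d : G.D) : Set G.Realization :=
  {x | Quot.lift (edgePred d) (by
    rintro a b (e | ⟨e, t⟩)
    · simp [edgePred]
    · simp only [edgePred, Sum.elim_inr, eq_iff_iff]
      have h1 : G.rev e = d ↔ e = G.rev d :=
        ⟨fun h => by rw [← h, G.rev_rev], fun h => by rw [h, G.rev_rev]⟩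
      have h2 : G.rev e = G.rev d ↔ e = d :=
        ⟨fun h => by rw [← G.rev_rev e, h, G.rev_rev], fun h => by rw [h]⟩
      have h3 : 0 < unitInterval.symm t ↔ t < 1 := by
        rw [← Subtype.coe_lt_coe, ← Subtype.coe_lt_coe]; simp
      have h4 : unitInterval.symm t < 1 ↔ 0 < t := by
        rw [← Subtype.coe_lt_coe, ← Subtype.coe_lt_coe]; simp
      rw [h1, h2, h3, h4, or_comm, and_comm (a := t < 1)]) x}

theorem isOpen_openEdge (d : G.D) : IsOpen (openEdge d) := by
  refine isOpen_realization_iff.2 fun e => ?_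
  change IsOpen {t : unitInterval | (e = d ∨ e = G.rev d) ∧ 0 < t ∧ t < 1}
  exact isOpen_const.and (isOpen_Ioi.inter isOpen_Iio)

theorem exists_of_mem_openEdge {d : G.D} {x : G.Realization} (hx : x ∈ openEdge d) :
    ∃ t, 0 < t ∧ t < 1 ∧ x = edgePoint d t := by
  obtain ⟨⟨i, u⟩ | ⟨e, t⟩⟩ := x
  · exact hx.elim
  · obtain ⟨rfl | rfl, h0, h1⟩ := hx
    · exact ⟨t, h0, h1, rfl⟩
    · refine ⟨unitInterval.symm t, ?_, ?_, ?_⟩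
      · rw [← Subtype.coe_lt_coe] at h1 ⊢; simpa using h1
      · rw [← Subtype.coe_lt_coe] at h0 ⊢; simpa using h0
      · rw [← edgePoint_symm, unitInterval.symm_symm]
        rfl

theorem eq_of_mem_openEdge {x : G.Realization} {d e : G.D} (hd : x ∈ openEdge d)
    (he : x ∈ openEdge e) : d = e ∨ d = G.rev e := by
  obtain ⟨t, -, -, rfl⟩ := exists_of_mem_openEdge hd
  exact he.1

/-- The function that shrinks both ends of the unit interval. -/
def shrinkFun (s t : unitInterval) : ℝ := (1 - s) * t + s * max 0 (min 1 (3 * (t : ℝ) - 1))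

theorem shrinkFun_mem (s t : unitInterval) : shrinkFun s t ∈ unitInterval := by
  have hs := s.2.1
  have hs' := s.2.2
  have ht := t.2.1
  have ht' := t.2.2
  have h0 : (0 : ℝ) ≤ max 0 (min 1 (3 * (t : ℝ) - 1)) := le_max_left _ _
  have h1 : max 0 (min 1 (3 * (t : ℝ) - 1)) ≤ 1 := max_le zero_le_one (min_le_left _ _)
  constructor <;> unfold shrinkFun <;> nlinarith

/-- The homotopy of the unit interval that shrinks both ends. -/
def shrink : C(unitInterval × unitInterval, unitInterval) where
  toFun p := ⟨shrinkFun p.2 p.1, shrinkFun_mem p.2 p.1⟩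
  continuous_toFun := by
    unfold shrinkFun
    fun_prop

/-- The final map, `3t - 1` clamped to the unit interval, commutes with reversal. Hence the homotopy
is compatible with the identification of the two orientations of an edge. -/
theorem shrink_symm (t s : unitInterval) :
    shrink (unitInterval.symm t, s) = unitInterval.symm (shrink (t, s)) := by
  ext
  simp only [shrink, shrinkFun, ContinuousMap.coe_mk, unitInterval.coe_symm_eq]
  have : max 0 (min 1 (3 * (1 - (t : ℝ)) - 1)) = 1 - max 0 (min 1 (3 * (t : ℝ) - 1)) := by
    rcases le_total (3 * (t : ℝ) - 1) 0 with h | h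
    · rw [max_eq_left (min_le_of_right_le h), min_eq_left (by linarith)]; simp
    · rcases le_total (3 * (t : ℝ) - 1) 1 with h' | h'
      · rw [min_eq_right h', max_eq_right h, min_eq_right (by linarith), max_eq_right (by linarith)]
        ring
      · rw [min_eq_left h', min_eq_right (by linarith), max_eq_left (by linarith)]; simp
  rw [this]
  ring

theorem shrink_of_lt {t : unitInterval} (ht : (t : ℝ) < 1 / 3) (s : unitInterval) :
    (shrink (t, s) : ℝ) = (1 - s) * t := by
  simp only [shrink, shrinkFun, ContinuousMap.coe_mk]
  rw [max_eq_left (min_le_of_right_le (by linarith))]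
  simp

theorem shrink_zero_left (s : unitInterval) : shrink (0, s) = 0 := by
  ext
  rw [shrink_of_lt (by norm_num)]
  simp

theorem shrink_zero_right (t : unitInterval) : shrink (t, 0) = t := by
  ext
  simp [shrink, shrinkFun]

/-- The homotopy of the realization that shrinks the stars of all vertices. -/
def shrinkCurry : C(G.Realization, C(unitInterval, G.Realization)) where
  toFun := Quot.lift (Sum.elim (fun v => ContinuousMap.const _ (vertexPoint v.1))
    fun e => ⟨fun s => edgePoint e.1 (shrink (e.2, s)),
      (continuous_edgePoint e.1).comp (by fun_prop)⟩) (by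
    rintro a b (d | ⟨d, t⟩)
    · ext s
      simp [shrink_zero_left, edgePoint_zero]
    · ext s
      simp only [Sum.elim_inr, ContinuousMap.coe_mk]
      rw [shrink_symm, edgePoint_symm])
  continuous_toFun := by
    -- As a map into the space of paths, the homotopy can be tested for continuity edge by edge; no
    -- product of a quotient map with the interval has to be a quotient map.
    refine continuous_realization fun d => ?_
    exact (ContinuousMap.curry (⟨fun p : unitInterval × unitInterval => edgePoint d (shrink p),
      (continuous_edgePoint d).comp shrink.continuous⟩ :
        C(unitInterval × unitInterval, G.Realization))).continuous

theorem shrinkCurry_edgePoint (d : G.D) (t s) :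
    shrinkCurry (edgePoint d t) s = edgePoint d (shrink (t, s)) := rfl

theorem exists_of_mem_star {i : G.V} {x : G.Realization} (hx : x ∈ star i) :
    x = vertexPoint i ∨ ∃ (d : G.D) (t : unitInterval), G.src d = i ∧ (t : ℝ) < 1 / 3 ∧
      x = edgePoint d t := by
  obtain ⟨⟨j, u⟩ | ⟨d, t⟩⟩ := x
  · exact .inl (congrArg vertexPoint (show j = i from hx))
  · obtain ⟨h, h'⟩ | ⟨h, h'⟩ := hx
    · exact .inr ⟨d, t, h, h', rfl⟩
    · refine .inr ⟨G.rev d, unitInterval.symm t, h, ?_, (edgePoint_symm d t).symm⟩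
      rw [unitInterval.coe_symm_eq]
      dsimp only at h'
      linarith

theorem shrinkCurry_mem_star {i : G.V} {x : G.Realization} (hx : x ∈ star i) (s) :
    shrinkCurry x s ∈ star i := by
  rcases exists_of_mem_star hx with rfl | ⟨d, t, h, ht, rfl⟩
  · rfl
  · rw [shrinkCurry_edgePoint]
    refine .inl ⟨h, ?_⟩
    change (shrink (t, s) : ℝ) < 1 / 3
    rw [shrink_of_lt ht]
    have hs := s.2.1
    have ht' := t.2.1
    nlinarith

theorem shrinkCurry_zero (x : G.Realization) : shrinkCurry x 0 = x := by
  rcases exists_point x with ⟨i, rfl⟩ | ⟨d, t, -, -, rfl⟩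
  · rfl
  · rw [shrinkCurry_edgePoint, shrink_zero_right]

theorem shrinkCurry_one {i : G.V} {x : G.Realization} (hx : x ∈ star i) :
    shrinkCurry x 1 = vertexPoint i := by
  rcases exists_of_mem_star hx with rfl | ⟨d, t, h, ht, rfl⟩
  · rfl
  · rw [shrinkCurry_edgePoint, ← h, ← edgePoint_zero]
    congr 1
    ext
    rw [shrink_of_lt ht]
    simp

/-- On a star the shrinking homotopy is a linear contraction to the vertex that stays in the star.
-/
theorem isSimplyConnected_star (i : G.V) : IsSimplyConnected (star i) := by
  have : ContractibleSpace (star i) := by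
    rw [contractible_iff_id_nullhomotopic]
    refine ⟨⟨vertexPoint i, rfl⟩, ⟨⟨⟨fun p => ⟨shrinkCurry p.2.1 p.1,
      shrinkCurry_mem_star p.2.2 p.1⟩, ?_⟩, ?_, ?_⟩⟩⟩
    · refine Continuous.subtype_mk ?_ _
      exact continuous_eval.comp ((shrinkCurry.continuous.comp
        (continuous_subtype_val.comp continuous_snd)).prodMk continuous_fst)
    · intro x
      exact Subtype.ext (shrinkCurry_zero _)
    · intro x
      exact Subtype.ext (shrinkCurry_one x.2)
  exact SimplyConnectedSpace.ofContractible (star i)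

theorem isOpenEmbedding_edgePoint (d : G.D) :
    Topology.IsOpenEmbedding fun t : Set.Ioo (0 : unitInterval) 1 => edgePoint d t.1 := by
  refine .of_continuous_injective_isOpenMap ((continuous_edgePoint d).comp continuous_subtype_val)
    ?_ ?_
  · intro t t' h
    by_contra hne
    -- `P` selects the point with parameter `t` on the edge `d`, in either orientation. It is
    -- invariant under the gluing, hence a well-defined predicate on the realization that separates
    -- interior points.
    let P : G.Cells → Prop := Sum.elim (fun _ => False)
      fun e => (e.1 = d ∧ e.2 = t.1) ∨ (G.rev e.1 = d ∧ unitInterval.symm e.2 = t.1)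
    have hP : ∀ a b, G.Glue a b → P a = P b := by
      rintro a b (e | ⟨e, s⟩)
      · have h0 : (0 : unitInterval) ≠ t.1 := t.2.1.ne
        have h1 : (1 : unitInterval) ≠ t.1 := t.2.2.ne'
        simp [P, h0, h1]
      · simp only [P, Sum.elim_inr, G.rev_rev, unitInterval.symm_symm]
        rw [or_comm]
    have h1 : Quot.lift P hP (edgePoint d t.1) = Quot.lift P hP (edgePoint d t'.1) :=
      congrArg (Quot.lift P hP) h
    have h2 : P (Sum.inr ⟨d, t'.1⟩) := by
      refine cast h1 (.inl ⟨rfl, rfl⟩)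
    rcases h2 with ⟨-, h3⟩ | ⟨h3, -⟩
    · exact hne (Subtype.ext h3.symm)
    · exact G.rev_ne d h3
  · intro s hs
    obtain ⟨s', hs', rfl⟩ := isOpen_induced_iff.1 hs
    refine isOpen_realization_iff.2 fun e => ?_
    have himg : ∀ x, x ∈ (fun t : Set.Ioo (0 : unitInterval) 1 => edgePoint d t.1) ''
        (Subtype.val ⁻¹' s') ↔ ∃ t, t ∈ s' ∩ Set.Ioo 0 1 ∧ x = edgePoint d t := by
      intro x
      constructor
      · rintro ⟨t, ht, rfl⟩
        exact ⟨t, ⟨ht, t.2⟩, rfl⟩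
      · rintro ⟨t, ⟨ht, h⟩, rfl⟩
        exact ⟨⟨t, h⟩, ht, rfl⟩
    have hopen : IsOpen (s' ∩ Set.Ioo 0 1) := hs'.inter isOpen_Ioo
    let P : G.Cells → Prop := Sum.elim (fun _ => False)
      fun e => (e.1 = d ∧ e.2 ∈ s' ∩ Set.Ioo 0 1) ∨
        (G.rev e.1 = d ∧ unitInterval.symm e.2 ∈ s' ∩ Set.Ioo 0 1)
    have hP : ∀ a b, G.Glue a b → P a = P b := by
      rintro a b (e | ⟨e, s⟩)
      · simp [P]
      · simp only [P, Sum.elim_inr, G.rev_rev, unitInterval.symm_symm]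
        rw [or_comm]
    have key : ∀ t, edgePoint e t ∈ (fun t : Set.Ioo (0 : unitInterval) 1 => edgePoint d t.1) ''
        (Subtype.val ⁻¹' s') ↔ P (Sum.inr ⟨e, t⟩) := by
      intro t
      rw [himg]
      constructor
      · rintro ⟨t', ht', h⟩
        have h1 : Quot.lift P hP (edgePoint e t) = Quot.lift P hP (edgePoint d t') :=
          congrArg (Quot.lift P hP) h
        exact cast h1.symm (.inl ⟨rfl, ht'⟩)
      · rintro (⟨rfl, ht⟩ | ⟨rfl, ht⟩)
        · exact ⟨t, ht, rfl⟩
        · exact ⟨_, ht, (edgePoint_symm e t).symm⟩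
    have : edgePoint e ⁻¹' ((fun t : Set.Ioo (0 : unitInterval) 1 => edgePoint d t.1) ''
        (Subtype.val ⁻¹' s')) = {t | (e = d ∧ t ∈ s' ∩ Set.Ioo 0 1) ∨
          (G.rev e = d ∧ unitInterval.symm t ∈ s' ∩ Set.Ioo 0 1)} := Set.ext key
    rw [this]
    exact IsOpen.union (isOpen_const.and hopen)
      (isOpen_const.and (hopen.preimage unitInterval.continuous_symm))

theorem isSimplyConnected_openEdge (d : G.D) : IsSimplyConnected (openEdge d) := by
  have hr : Set.range (fun t : Set.Ioo (0 : unitInterval) 1 => edgePoint d t.1) = openEdge d := by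
    ext x
    constructor
    · rintro ⟨t, rfl⟩
      exact ⟨.inl rfl, t.2⟩
    · intro hx
      obtain ⟨t, h0, h1, rfl⟩ := exists_of_mem_openEdge hx
      exact ⟨⟨t, h0, h1⟩, rfl⟩
  have hs : IsSimplyConnected (Set.univ : Set (Set.Ioo (0 : unitInterval) 1)) := by
    have he : Topology.IsEmbedding fun t : Set.Ioo (0 : unitInterval) 1 => (t.1.1 : ℝ) :=
      Topology.IsEmbedding.subtypeVal.comp Topology.IsEmbedding.subtypeVal
    rw [← he.isSimplyConnected_image]
    have himg : (fun t : Set.Ioo (0 : unitInterval) 1 => (t.1.1 : ℝ)) '' Set.univ =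
        Set.Ioo 0 1 := by
      ext x
      constructor
      · rintro ⟨t, -, rfl⟩
        exact ⟨t.2.1, t.2.2⟩
      · rintro ⟨h0, h1⟩
        exact ⟨⟨⟨x, h0.le, h1.le⟩, h0, h1⟩, trivial, rfl⟩
    rw [himg]
    have := (convex_Ioo (0 : ℝ) 1).contractibleSpace ⟨1 / 2, by norm_num, by norm_num⟩
    exact SimplyConnectedSpace.ofContractible _
  rw [← hr, ← Set.image_univ]
  exact (isOpenEmbedding_edgePoint d).isEmbedding.isSimplyConnected_image.2 hs

/-- For a loop the star would meet the open edge in two pieces, one at each end; this is why the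
endpoints must differ. -/
theorem isPathConnected_star_inter {d : G.D} (hd : G.src d ≠ G.tgt d) :
    IsPathConnected (star (G.src d) ∩ openEdge d) := by
  have : star (G.src d) ∩ openEdge d = edgePoint d '' {t | 0 < t ∧ (t : ℝ) < 1 / 3} := by
    ext x
    constructor
    · rintro ⟨hx, hx'⟩
      obtain ⟨t, h0, h1, rfl⟩ := exists_of_mem_openEdge hx'
      rcases hx with ⟨-, h⟩ | ⟨h, -⟩
      · exact ⟨t, ⟨h0, h⟩, rfl⟩
      · exact absurd h.symm hd
    · rintro ⟨t, ⟨h0, h⟩, rfl⟩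
      exact ⟨.inl ⟨rfl, h⟩, .inl rfl, h0, by
        rw [← Subtype.coe_lt_coe]; change (t : ℝ) < 1; linarith⟩
  rw [this]
  refine IsPathConnected.image ?_ (continuous_edgePoint d)
  rw [Topology.IsInducing.subtypeVal.isPathConnected_iff]
  have himg : Subtype.val '' {t : unitInterval | 0 < t ∧ (t : ℝ) < 1 / 3} =
      Set.Ioo (0 : ℝ) (1 / 3) := by
    ext x
    constructor
    · rintro ⟨t, ⟨h0, h1⟩, rfl⟩
      exact ⟨h0, h1⟩
    · rintro ⟨h0, h1⟩
      exact ⟨⟨x, h0.le, by linarith⟩, ⟨h0, h1⟩, rfl⟩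
  rw [himg]
  exact (convex_Ioo (0 : ℝ) (1 / 3)).isPathConnected ⟨1 / 4, by norm_num, by norm_num⟩

theorem src_eq_of_mem {x : G.Realization} {i : G.V} {d : G.D} (hi : x ∈ star i)
    (hd : x ∈ openEdge d) : i = G.src d ∨ i = G.tgt d := by
  obtain ⟨t, -, -, rfl⟩ := exists_of_mem_openEdge hd
  rcases hi with ⟨h, -⟩ | ⟨h, -⟩
  · exact .inl h.symm
  · exact .inr h.symm

theorem openEdge_rev (d : G.D) : openEdge (G.rev d) = openEdge d := by
  ext x
  obtain ⟨⟨i, u⟩ | ⟨e, t⟩⟩ := x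
  · exact Iff.rfl
  · change (e = G.rev d ∨ e = G.rev (G.rev d)) ∧ _ ↔ (e = d ∨ e = G.rev d) ∧ _
    rw [G.rev_rev, or_comm]

end OrGraph

end

end Gyroid

namespace Gyroid

noncomputable section

/-! ### Covers of realizations by stars and open edges, and the complete graph `K₄` -/

namespace OrGraph

variable {G H : OrGraph}

/-- The cover of the realization of a graph by open stars and open edges. -/
def graphCover {ι κ : Type} {s t : κ → Option ι} (vtx : Option ι → G.V) (edge : ι ⊕ κ → G.D)
    (hv : Function.Bijective vtx)
    (hsrc : ∀ j, G.src (edge j) = vtx (Sum.elim (fun _ => none) s j))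
    (htgt : ∀ j, G.tgt (edge j) = vtx (Sum.elim some t j))
    (he : ∀ d, ∃ j, d = edge j ∨ d = G.rev (edge j))
    (hinj : ∀ j j', edge j = edge j' ∨ edge j = G.rev (edge j') → j = j')
    (hne : ∀ k, s k ≠ t k) : GraphCover G.Realization ι κ s t where
  O i := star (vtx i)
  T j := openEdge (edge j)
  isOpen_O i := isOpen_star _
  isOpen_T j := isOpen_openEdge _
  cover x := by
    rcases exists_point x with ⟨i, rfl⟩ | ⟨d, u, h0, h1, rfl⟩
    · obtain ⟨i, rfl⟩ := hv.2 i
      exact .inl ⟨i, rfl⟩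
    · obtain ⟨j, rfl | rfl⟩ := he d
      · exact .inr ⟨j, .inl rfl, h0, h1⟩
      · exact .inr ⟨j, .inr rfl, h0, h1⟩
  eq_of_mem_O x i i' h h' := hv.1 (eq_of_mem_star h h')
  eq_of_mem_T x j j' h h' := hinj j j' (eq_of_mem_openEdge h h')
  isSimplyConnected_O i := isSimplyConnected_star _
  isSimplyConnected_T j := isSimplyConnected_openEdge _
  isPathConnected_src j := by
    rw [← hsrc]
    refine isPathConnected_star_inter ?_
    rw [hsrc, htgt]
    intro h
    rcases j with i | k
    · exact absurd (hv.1 h) (by simp)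
    · exact hne k (hv.1 h)
  isPathConnected_tgt j := by
    rw [← htgt, ← openEdge_rev]
    refine isPathConnected_star_inter (d := G.rev (edge j)) ?_
    change G.tgt (edge j) ≠ G.src (G.rev (G.rev (edge j)))
    rw [G.rev_rev, hsrc, htgt]
    intro h
    rcases j with i | k
    · exact absurd (hv.1 h) (by simp)
    · exact hne k (hv.1 h).symm
  incident x i j hi hj := by
    rcases src_eq_of_mem hi hj with h | h
    · rw [hsrc] at h
      exact .inl (hv.1 h)
    · rw [htgt] at h
      exact .inr (hv.1 h)
  ne := hne

/-- The inverse of an isomorphism of graphs. -/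
def Iso.inv (f : Iso G H) : Hom H G where
  onV := Function.surjInv f.onV_bijective.2
  onD := Function.surjInv f.onD_bijective.2
  src_onD d := by
    apply f.onV_bijective.1
    rw [← f.src_onD, Function.surjInv_eq f.onD_bijective.2 d]
    exact (Function.surjInv_eq f.onV_bijective.2 _).symm
  rev_onD d := by
    apply f.onD_bijective.1
    rw [← f.rev_onD, Function.surjInv_eq f.onD_bijective.2 d]
    exact (Function.surjInv_eq f.onD_bijective.2 _).symm

/-- An isomorphism of graphs induces a homeomorphism of the realizations. -/
def Iso.homeomorph (f : Iso G H) : G.Realization ≃ₜ H.Realization where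
  toFun := f.toHom.realize
  invFun := f.inv.realize
  left_inv x := by
    rcases exists_point x with ⟨i, rfl⟩ | ⟨d, t, -, -, rfl⟩
    · exact congrArg vertexPoint (Function.leftInverse_surjInv f.onV_bijective i)
    · exact congrArg (edgePoint · t) (Function.leftInverse_surjInv f.onD_bijective d)
  right_inv x := by
    rcases exists_point x with ⟨i, rfl⟩ | ⟨d, t, -, -, rfl⟩
    · exact congrArg vertexPoint (Function.surjInv_eq f.onV_bijective.2 i)
    · exact congrArg (edgePoint · t) (Function.surjInv_eq f.onD_bijective.2 d)
  continuous_toFun := f.toHom.realize.continuous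
  continuous_invFun := f.inv.realize.continuous

/-- The oriented edge of the complete graph between two vertices. -/
def completeDart {n : ℕ} (i j : Fin n) (h : i ≠ j) :
    (ofSimpleGraph (⊤ : SimpleGraph (Fin n))).D := ⟨(i, j), h⟩

/-- The cover of the realization of the complete graph on four vertices. -/
def completeCover : GraphCover (ofSimpleGraph (⊤ : SimpleGraph (Fin 4))).Realization (Fin 3)
    (Fin 3) (fun k => some (k + 1)) (fun k => some (k + 2)) :=
  graphCover (G := ofSimpleGraph (⊤ : SimpleGraph (Fin 4)))
    -- The vertex `0` is the centre of the spanning star. Addition in `Fin 3` is cyclic, so the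
    -- edges from `k + 1` to `k + 2` form the triangle on the other three vertices.
    (fun i => (i.elim 0 Fin.succ : Fin 4))
    (Sum.elim (fun k => completeDart 0 k.succ (Fin.succ_ne_zero k).symm)
      fun k => completeDart (k + 1).succ (k + 2).succ (by revert k; decide))
    (by
      constructor
      · have : ∀ a b : Option (Fin 3), (a.elim 0 Fin.succ : Fin 4) = b.elim 0 Fin.succ → a = b := by
          decide
        exact this
      · have : ∀ a : Fin 4, ∃ b : Option (Fin 3), (b.elim 0 Fin.succ : Fin 4) = a := by decide
        exact this)
    (by rintro (k | k) <;> rfl)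
    (by rintro (k | k) <;> rfl)
    (by
      rintro ⟨⟨a, b⟩, h⟩
      have key : ∀ a b : Fin 4, a ≠ b → (∃ k : Fin 3, (a = 0 ∧ b = k.succ) ∨ (a = k.succ ∧ b = 0)) ∨
          ∃ k : Fin 3, (a = (k + 1).succ ∧ b = (k + 2).succ) ∨
            (a = (k + 2).succ ∧ b = (k + 1).succ) := by decide
      rcases key a b h with ⟨k, ⟨rfl, rfl⟩ | ⟨rfl, rfl⟩⟩ | ⟨k, ⟨rfl, rfl⟩ | ⟨rfl, rfl⟩⟩
      · exact ⟨.inl k, .inl rfl⟩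
      · exact ⟨.inl k, .inr rfl⟩
      · exact ⟨.inr k, .inl rfl⟩
      · exact ⟨.inr k, .inr rfl⟩)
    (by
      have key : ∀ j j' : Fin 3 ⊕ Fin 3,
          let e : Fin 3 ⊕ Fin 3 → Fin 4 × Fin 4 :=
            Sum.elim (fun k => (0, k.succ)) fun k => ((k + 1).succ, (k + 2).succ)
          e j = e j' ∨ e j = (e j').swap → j = j' := by decide
      intro j j' h
      refine key j j' (h.imp (fun h => ?_) fun h => ?_)
      · have h1 := congrArg SimpleGraph.Dart.toProd h
        rcases j with k | k <;> rcases j' with k' | k' <;> exact h1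
      · have h1 := congrArg SimpleGraph.Dart.toProd h
        rcases j with k | k <;> rcases j' with k' | k' <;> exact h1)
    (by decide)

end OrGraph

/-! ### The body centered cubic lattice -/

/-- The vector with the coordinates `a i / 8`. -/
def eighth (a : Fin 3 → ℤ) : Fin 3 → ℝ := fun i => (a i : ℝ) / 8

theorem eighth_injective : Function.Injective eighth := by
  intro a b h
  ext i
  have := congrFun h i
  simp only [eighth] at this
  exact_mod_cast (div_left_inj' (by norm_num : (8 : ℝ) ≠ 0)).1 this

theorem eighth_add (a b : Fin 3 → ℤ) : eighth (a + b) = eighth a + eighth b := by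
  ext i
  simp [eighth, add_div]

theorem intVec_eq (n : Fin 3 → ℤ) : intVec n = eighth (8 • n) := by
  ext i
  simp [eighth, intVec]

/-- The elements of the body centered cubic lattice in terms of their coordinates with respect to
a basis. -/
def bccVec : (Fin 3 → ℤ) →+ (Fin 3 → ℝ) where
  toFun n := ![n 0 + n 2 / 2, n 1 + n 2 / 2, n 2 / 2]
  map_zero' := by ext i; fin_cases i <;> simp
  map_add' m n := by ext i; fin_cases i <;> simp <;> ring

theorem bccVec_injective : Function.Injective bccVec := by
  intro m n h
  have h0 := congrFun h 0
  have h1 := congrFun h 1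
  have h2 := congrFun h 2
  simp only [bccVec, AddMonoidHom.coe_mk, ZeroHom.coe_mk, Matrix.cons_val] at h0 h1 h2
  have h2' : (m 2 : ℝ) = n 2 := by linarith
  have h1' : (m 1 : ℝ) = n 1 := by linarith
  have h0' : (m 0 : ℝ) = n 0 := by linarith
  ext i
  fin_cases i
  · exact_mod_cast h0'
  · exact_mod_cast h1'
  · exact_mod_cast h2'

theorem range_bccVec : bccVec.range = bcc := by
  apply le_antisymm
  · rintro _ ⟨n, rfl⟩
    have : bccVec n = n 0 • ![1, 0, 0] + n 1 • ![0, 1, 0] + n 2 • ![1/2, 1/2, 1/2] := by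
      ext i
      fin_cases i <;> simp [bccVec] <;> ring
    rw [this]
    refine add_mem (add_mem ?_ ?_) ?_ <;> refine zsmul_mem (AddSubgroup.subset_closure ?_) _ <;> simp
  · refine (AddSubgroup.closure_le _).2 ?_
    rintro _ (rfl | rfl | rfl)
    · exact ⟨![1, 0, 0], by ext i; fin_cases i <;> simp [bccVec]⟩
    · exact ⟨![0, 1, 0], by ext i; fin_cases i <;> simp [bccVec]⟩
    · exact ⟨![0, 0, 1], by ext i; fin_cases i <;> simp [bccVec]⟩

/-- The body centered cubic lattice is free of rank three. -/
def bccEquiv : bcc ≃+ (Fin 3 → ℤ) :=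
  ((AddMonoidHom.ofInjective bccVec_injective).trans
    (AddEquiv.addSubgroupCongr range_bccVec)).symm

theorem mem_bcc_iff {l : Fin 3 → ℝ} : l ∈ bcc ↔
    ∃ k : Fin 3 → ℤ, (2 ∣ k 0 - k 2 ∧ 2 ∣ k 1 - k 2) ∧ ∀ i, l i = k i / 2 := by
  rw [← range_bccVec]
  constructor
  · rintro ⟨n, rfl⟩
    refine ⟨![2 * n 0 + n 2, 2 * n 1 + n 2, n 2], by simp, fun i => ?_⟩
    fin_cases i <;> simp [bccVec] <;> ring
  · rintro ⟨k, ⟨⟨a, ha⟩, ⟨b, hb⟩⟩, h⟩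
    refine ⟨![a, b, k 2], ?_⟩
    have ha' : (k 0 : ℝ) - k 2 = 2 * a := by exact_mod_cast ha
    have hb' : (k 1 : ℝ) - k 2 = 2 * b := by exact_mod_cast hb
    ext i
    rw [h]
    fin_cases i <;> simp [bccVec] <;> linarith

theorem mem_bcc_iff_eighth {l : Fin 3 → ℝ} : l ∈ bcc ↔
    ∃ k : Fin 3 → ℤ, (2 ∣ k 0 - k 2 ∧ 2 ∣ k 1 - k 2) ∧ l = eighth (4 • k) := by
  rw [mem_bcc_iff]
  refine exists_congr fun k => and_congr_right fun _ => ⟨fun h => ?_, ?_⟩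
  · ext i
    rw [h]
    simp [eighth]
    ring
  · rintro rfl i
    simp [eighth]
    ring

theorem intVec_mem_bcc (n : Fin 3 → ℤ) : intVec n ∈ bcc :=
  mem_bcc_iff.2 ⟨2 • n, by simp [← mul_sub], fun i => by simp [intVec]⟩

/-! ### The graph in integral coordinates -/

/-- The vertices in integral coordinates. -/
def IsVtx (a : Fin 3 → ℤ) : Prop := ∃ i n, a = v8 i + 8 • n

/-- The initial points of the twelve segments, in integral coordinates. -/
def edgeSrc (k : Fin 12) : Fin 3 → ℤ := v8 (baseIndex k).1

/-- The final points of the twelve segments, in integral coordinates. -/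
def edgeTgt (k : Fin 12) : Fin 3 → ℤ := v8 (baseIndex k).2.1 + 8 • (baseIndex k).2.2

/-- The oriented edges in integral coordinates. -/
def IsEdge (a b : Fin 3 → ℤ) : Prop :=
  ∃ k n, (a = edgeSrc k + 8 • n ∧ b = edgeTgt k + 8 • n) ∨
    (a = edgeTgt k + 8 • n ∧ b = edgeSrc k + 8 • n)

theorem mem_vertexSet {p : Fin 3 → ℝ} : p ∈ vertexSet ↔ ∃ a, IsVtx a ∧ p = eighth a := by
  constructor
  · rintro ⟨i, n, rfl⟩
    exact ⟨_, ⟨i, n, rfl⟩, by rw [eighth_add, intVec_eq]; rfl⟩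
  · rintro ⟨_, ⟨i, n, rfl⟩, rfl⟩
    exact ⟨i, n, by rw [eighth_add, intVec_eq]; rfl⟩

theorem mem_dartSet {d : (Fin 3 → ℝ) × (Fin 3 → ℝ)} :
    d ∈ dartSet ↔ ∃ a b, IsEdge a b ∧ d = (eighth a, eighth b) := by
  have h1 : ∀ k n, (baseEdge k).1 + intVec n = eighth (edgeSrc k + 8 • n) := by
    intro k n
    rw [eighth_add, intVec_eq]
    rfl
  have h2 : ∀ k n, (baseEdge k).2 + intVec n = eighth (edgeTgt k + 8 • n) := by
    intro k n
    rw [eighth_add, edgeTgt, eighth_add, intVec_eq, baseEdge, intVec_eq]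
    rfl
  constructor
  · rintro ⟨k, n, rfl | rfl⟩
    · exact ⟨_, _, ⟨k, n, .inl ⟨rfl, rfl⟩⟩, by rw [h1, h2]⟩
    · exact ⟨_, _, ⟨k, n, .inr ⟨rfl, rfl⟩⟩, by rw [h1, h2]⟩
  · rintro ⟨_, _, ⟨k, n, ⟨rfl, rfl⟩ | ⟨rfl, rfl⟩⟩, rfl⟩
    · exact ⟨k, n, .inl (by rw [h1, h2])⟩
    · exact ⟨k, n, .inr (by rw [h1, h2])⟩

/-- The class of a vertex modulo the body centered cubic lattice. -/
def label (a : Fin 3 → ℤ) : Fin 4 :=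
  if a 0 % 4 = 1 then (if a 1 % 4 = 1 then 0 else 3) else (if a 1 % 4 = 3 then 1 else 2)

/-- In coordinates multiplied by 8, lattice vectors are divisible by 4, so residues modulo 4 are
invariants of the quotient. The eight vertices of the unit cell show four residue classes, and the
first two coordinates tell them apart. -/
theorem label_add (a k : Fin 3 → ℤ) : label (a + 4 • k) = label a := by
  simp [label]

/-- The entries of `k` have equal parity, so a lattice translation is an integral one, possibly
followed by the translation `(4, 4, 4)` to the body centre. Only the latter needs a finite check. -/
theorem exists_eq_of_dvd {k : Fin 3 → ℤ} (h0 : 2 ∣ k 0 - k 2) (h1 : 2 ∣ k 1 - k 2) :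
    ∃ m : Fin 3 → ℤ, 4 • k = 8 • m ∨ 4 • k = 8 • m + fun _ => 4 := by
  refine ⟨fun i => k i / 2, ?_⟩
  rcases Int.emod_two_eq_zero_or_one (k 2) with h | h
  · left
    ext i
    fin_cases i <;> simp <;> omega
  · right
    ext i
    fin_cases i <;> simp <;> omega

theorem exists_eq_add_of_forall_dvd {a b : Fin 3 → ℤ} (h : ∀ j, 8 ∣ a j - b j) :
    ∃ n : Fin 3 → ℤ, a = b + 8 • n := by
  choose n hn using h
  exact ⟨n, by ext j; have := hn j; simp; omega⟩

theorem IsVtx.add {a : Fin 3 → ℤ} (ha : IsVtx a) (k : Fin 3 → ℤ) (h0 : 2 ∣ k 0 - k 2)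
    (h1 : 2 ∣ k 1 - k 2) : IsVtx (a + 4 • k) := by
  obtain ⟨i, n, rfl⟩ := ha
  obtain ⟨m, h | h⟩ := exists_eq_of_dvd h0 h1
  · exact ⟨i, n + m, by rw [h, smul_add, add_assoc]⟩
  -- Modulo 8, translation by `(4, 4, 4)` carries each of the eight vertices to another one of them.
  · have key : ∀ i, ∃ i', ∀ j, 8 ∣ (v8 i + fun _ => 4 : Fin 3 → ℤ) j - v8 i' j := by decide
    obtain ⟨i', hi⟩ := key i
    obtain ⟨q, hq⟩ := exists_eq_add_of_forall_dvd hi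
    refine ⟨i', n + m + q, ?_⟩
    rw [h]
    ext j; have h1 := congrFun hq j; simp at h1 ⊢; omega

theorem IsEdge.symm {a b : Fin 3 → ℤ} (h : IsEdge a b) : IsEdge b a := by
  obtain ⟨k, n, h | h⟩ := h
  · exact ⟨k, n, .inr ⟨h.2, h.1⟩⟩
  · exact ⟨k, n, .inl ⟨h.2, h.1⟩⟩

theorem IsEdge.add {a b : Fin 3 → ℤ} (h : IsEdge a b) (k : Fin 3 → ℤ) (h0 : 2 ∣ k 0 - k 2)
    (h1 : 2 ∣ k 1 - k 2) : IsEdge (a + 4 • k) (b + 4 • k) := by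
  obtain ⟨e, n, hab⟩ := h
  suffices h : IsEdge (edgeSrc e + 8 • n + 4 • k) (edgeTgt e + 8 • n + 4 • k) by
    rcases hab with ⟨rfl, rfl⟩ | ⟨rfl, rfl⟩
    · exact h
    · exact h.symm
  obtain ⟨m, h | h⟩ := exists_eq_of_dvd h0 h1
  · refine ⟨e, n + m, .inl ⟨?_, ?_⟩⟩ <;> rw [h, smul_add, add_assoc]
  -- Modulo 8, translation by `(4, 4, 4)` carries each of the twelve segments to one of them, up to
  -- orientation; equality of the difference vectors makes both endpoints match with the same
  -- integral translation.
  · have key : ∀ e, ∃ e',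
        ((∀ j, 8 ∣ (edgeSrc e + fun _ => 4 : Fin 3 → ℤ) j - edgeSrc e' j) ∧
          edgeTgt e - edgeSrc e = edgeTgt e' - edgeSrc e') ∨
        ((∀ j, 8 ∣ (edgeSrc e + fun _ => 4 : Fin 3 → ℤ) j - edgeTgt e' j) ∧
          edgeTgt e - edgeSrc e = edgeSrc e' - edgeTgt e') := by decide
    obtain ⟨e', ⟨he, he'⟩ | ⟨he, he'⟩⟩ := key e
    · obtain ⟨q, hq⟩ := exists_eq_add_of_forall_dvd he
      refine ⟨e', n + m + q, .inl ⟨?_, ?_⟩⟩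
      · rw [h]
        ext j; have h1 := congrFun hq j; simp at h1 ⊢; omega
      · rw [h]
        ext j; have h1 := congrFun hq j; have h2 := congrFun he' j; simp at h1 h2 ⊢; omega
    · obtain ⟨q, hq⟩ := exists_eq_add_of_forall_dvd he
      refine ⟨e', n + m + q, .inr ⟨?_, ?_⟩⟩
      · rw [h]
        ext j; have h1 := congrFun hq j; simp at h1 ⊢; omega
      · rw [h]
        ext j; have h1 := congrFun hq j; have h2 := congrFun he' j; simp at h1 h2 ⊢; omega

theorem IsVtx.exists_of_label_eq {a b : Fin 3 → ℤ} (ha : IsVtx a) (hb : IsVtx b)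
    (h : label a = label b) :
    ∃ k : Fin 3 → ℤ, (2 ∣ k 0 - k 2 ∧ 2 ∣ k 1 - k 2) ∧ b = a + 4 • k := by
  obtain ⟨i, n, rfl⟩ := ha
  obtain ⟨j, m, rfl⟩ := hb
  have h8 : ∀ n : Fin 3 → ℤ, 8 • n = 4 • (2 • n) := fun n => by rw [← mul_smul]; rfl
  rw [h8, h8, label_add, label_add] at h
  have key : ∀ i j, label (v8 i) = label (v8 j) → (∀ c, 4 ∣ v8 j c - v8 i c) ∧
      2 ∣ (v8 j 0 - v8 i 0) / 4 - (v8 j 2 - v8 i 2) / 4 ∧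
      2 ∣ (v8 j 1 - v8 i 1) / 4 - (v8 j 2 - v8 i 2) / 4 := by decide
  obtain ⟨h4, h02, h12⟩ := key i j h
  refine ⟨fun c => (v8 j c - v8 i c) / 4 + 2 * (m c - n c), ⟨by dsimp only; omega,
    by dsimp only; omega⟩, ?_⟩
  ext c
  have := h4 c
  simp
  omega

theorem IsEdge.isVtx {a b : Fin 3 → ℤ} (h : IsEdge a b) : IsVtx a := by
  obtain ⟨k, n, ⟨rfl, rfl⟩ | ⟨rfl, rfl⟩⟩ := h
  · exact ⟨_, n, rfl⟩
  · exact ⟨(baseIndex k).2.1, (baseIndex k).2.2 + n, by rw [edgeTgt, smul_add, add_assoc]⟩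

theorem label_add_eight (a n : Fin 3 → ℤ) : label (a + 8 • n) = label a := by
  rw [← label_add a (2 • n), ← mul_smul]
  rfl

theorem IsEdge.label_ne {a b : Fin 3 → ℤ} (h : IsEdge a b) : label a ≠ label b := by
  have key : ∀ k, label (edgeSrc k) ≠ label (edgeTgt k) := by decide
  obtain ⟨k, n, ⟨rfl, rfl⟩ | ⟨rfl, rfl⟩⟩ := h <;> rw [label_add_eight, label_add_eight]
  · exact key k
  · exact (key k).symm

/-- The classes of the endpoints determine the edge vector, by inspection of all pairs of segments.
This excludes multiple edges in the quotient. -/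
theorem IsEdge.sub_eq {a b a' b' : Fin 3 → ℤ} (h : IsEdge a b) (h' : IsEdge a' b')
    (ha : label a = label a') (hb : label b = label b') : b - a = b' - a' := by
  have key : ∀ k k', (label (edgeSrc k) = label (edgeSrc k') →
      label (edgeTgt k) = label (edgeTgt k') →
        edgeTgt k - edgeSrc k = edgeTgt k' - edgeSrc k') ∧
      (label (edgeSrc k) = label (edgeTgt k') → label (edgeTgt k) = label (edgeSrc k') →
        edgeTgt k - edgeSrc k = edgeSrc k' - edgeTgt k') := by decide
  obtain ⟨k, n, ⟨rfl, rfl⟩ | ⟨rfl, rfl⟩⟩ := h <;>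
  obtain ⟨k', n', ⟨rfl, rfl⟩ | ⟨rfl, rfl⟩⟩ := h' <;>
  simp only [label_add_eight] at ha hb <;> simp only [add_sub_add_right_eq_sub]
  · exact (key k k').1 ha hb
  · exact (key k k').2 ha hb
  · exact ((key k' k).2 ha.symm hb.symm).symm
  · exact neg_injective (by simpa using (key k k').1 hb ha)

theorem exists_isEdge {i j : Fin 4} (h : i ≠ j) : ∃ a b, IsEdge a b ∧ label a = i ∧ label b = j := by
  have key : ∀ i j : Fin 4, i ≠ j → ∃ k, (label (edgeSrc k) = i ∧ label (edgeTgt k) = j) ∨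
      (label (edgeTgt k) = i ∧ label (edgeSrc k) = j) := by decide
  obtain ⟨k, h | h⟩ := key i j h
  · exact ⟨_, _, ⟨k, 0, .inl ⟨rfl, rfl⟩⟩, by simpa using h⟩
  · exact ⟨_, _, ⟨k, 0, .inr ⟨rfl, rfl⟩⟩, by simpa using h⟩

end

end Gyroid

namespace Gyroid

noncomputable section

/-! ### The quotient graph is the complete graph on four vertices -/

/-- The class of a vertex modulo the body centered cubic lattice, in terms of its coordinates. -/
def realLabel (p : Fin 3 → ℝ) : Fin 4 := label fun j => ⌊8 * p j⌋

/-- The floor only extends the class function to all real points; at vertices the scaled coordinates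
are already integers. -/
theorem realLabel_eighth (a : Fin 3 → ℤ) : realLabel (eighth a) = label a := by
  rw [realLabel]
  congr 1
  ext j
  rw [eighth, mul_div_cancel₀ _ (by norm_num : (8 : ℝ) ≠ 0), Int.floor_intCast]

theorem add_mem_vertexSet {p l : Fin 3 → ℝ} (hp : p ∈ vertexSet) (hl : l ∈ bcc) :
    l + p ∈ vertexSet := by
  obtain ⟨a, ha, rfl⟩ := mem_vertexSet.1 hp
  obtain ⟨k, ⟨h0, h1⟩, rfl⟩ := mem_bcc_iff_eighth.1 hl
  exact mem_vertexSet.2 ⟨_, ha.add k h0 h1, by rw [eighth_add, add_comm]⟩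

theorem add_mem_dartSet {d : (Fin 3 → ℝ) × (Fin 3 → ℝ)} {l : Fin 3 → ℝ} (hd : d ∈ dartSet)
    (hl : l ∈ bcc) : (l + d.1, l + d.2) ∈ dartSet := by
  obtain ⟨a, b, h, rfl⟩ := mem_dartSet.1 hd
  obtain ⟨k, ⟨h0, h1⟩, rfl⟩ := mem_bcc_iff_eighth.1 hl
  exact mem_dartSet.2 ⟨_, _, h.add k h0 h1, by rw [eighth_add, eighth_add, add_comm, add_comm (eighth b)]⟩

theorem realLabel_eq_iff {p q : Fin 3 → ℝ} (hp : p ∈ vertexSet) (hq : q ∈ vertexSet) :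
    realLabel p = realLabel q ↔ q - p ∈ bcc := by
  obtain ⟨a, ha, rfl⟩ := mem_vertexSet.1 hp
  obtain ⟨b, hb, rfl⟩ := mem_vertexSet.1 hq
  rw [realLabel_eighth, realLabel_eighth]
  constructor
  · intro h
    obtain ⟨k, hk, rfl⟩ := ha.exists_of_label_eq hb h
    exact mem_bcc_iff_eighth.2 ⟨k, hk, by rw [eighth_add, add_sub_cancel_left]⟩
  · intro h
    obtain ⟨k, hk, h⟩ := mem_bcc_iff_eighth.1 h
    rw [sub_eq_iff_eq_add', ← eighth_add] at h
    rw [eighth_injective h, label_add]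

theorem realLabel_ne {d : (Fin 3 → ℝ) × (Fin 3 → ℝ)} (hd : d ∈ dartSet) :
    realLabel d.1 ≠ realLabel d.2 := by
  obtain ⟨a, b, h, rfl⟩ := mem_dartSet.1 hd
  simpa only [realLabel_eighth] using h.label_ne

theorem sub_eq_sub_of_realLabel_eq {d e : (Fin 3 → ℝ) × (Fin 3 → ℝ)} (hd : d ∈ dartSet)
    (he : e ∈ dartSet) (h1 : realLabel d.1 = realLabel e.1) (h2 : realLabel d.2 = realLabel e.2) :
    d.2 - d.1 = e.2 - e.1 := by
  obtain ⟨a, b, h, rfl⟩ := mem_dartSet.1 hd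
  obtain ⟨a', b', h', rfl⟩ := mem_dartSet.1 he
  simp only [realLabel_eighth] at h1 h2
  have := h.sub_eq h' h1 h2
  dsimp only
  rw [sub_eq_sub_iff_add_eq_add, ← eighth_add, ← eighth_add, sub_eq_sub_iff_add_eq_add.1 this]

/-- The quotient graph is the complete graph on four vertices. -/
def quotientIso : OrGraph.Iso quotientGraph (OrGraph.ofSimpleGraph (⊤ : SimpleGraph (Fin 4))) where
  onV := Quotient.lift (fun p : vertexSet => (realLabel p.1 : Fin 4))
    fun p q h => (realLabel_eq_iff p.2 q.2).2 h
  onD := Quotient.lift (fun d : dartSet =>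
      OrGraph.completeDart (realLabel d.1.1) (realLabel d.1.2) (realLabel_ne d.2)) (by
    rintro d e ⟨l, hl, h⟩
    apply SimpleGraph.Dart.ext
    have h1 : realLabel d.1.1 = realLabel e.1.1 :=
      (realLabel_eq_iff (dart_fst d.2) (dart_fst e.2)).2 (by simpa [h] using hl)
    have h2 : realLabel d.1.2 = realLabel e.1.2 :=
      (realLabel_eq_iff (dart_fst (dart_swap d.2)) (dart_fst (dart_swap e.2))).2
        (by simpa [h] using hl)
    exact Prod.ext h1 h2)
  src_onD := by
    rintro ⟨d⟩
    rfl
  rev_onD := by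
    rintro ⟨d⟩
    rfl
  onV_bijective := by
    constructor
    · rintro ⟨p⟩ ⟨q⟩ h
      exact Quotient.sound ((realLabel_eq_iff p.2 q.2).1 h)
    · intro i
      change Fin 4 at i
      obtain ⟨j, hj⟩ : ∃ j : Fin 4, i ≠ j := (exists_ne i).imp fun _ => Ne.symm
      obtain ⟨a, b, h, rfl, -⟩ := exists_isEdge hj
      exact ⟨Quotient.mk _ ⟨eighth a, mem_vertexSet.2 ⟨a, h.isVtx, rfl⟩⟩, realLabel_eighth a⟩
  onD_bijective := by
    constructor
    · rintro ⟨d⟩ ⟨e⟩ h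
      have h0 := congrArg SimpleGraph.Dart.toProd h
      have h1 : realLabel d.1.1 = realLabel e.1.1 := congrArg Prod.fst h0
      have h2 : realLabel d.1.2 = realLabel e.1.2 := congrArg Prod.snd h0
      have h3 := sub_eq_sub_of_realLabel_eq d.2 e.2 h1 h2
      refine Quotient.sound ⟨e.1.1 - d.1.1,
        (realLabel_eq_iff (dart_fst d.2) (dart_fst e.2)).1 h1, Prod.ext ?_ ?_⟩
      · exact (add_sub_cancel _ _).symm
      · change e.1.2 = d.1.2 + (e.1.1 - d.1.1)
        rw [add_sub_assoc', add_comm, add_sub_assoc, h3, add_sub_cancel]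
    · rintro ⟨⟨i, j⟩, hij⟩
      obtain ⟨a, b, h, rfl, rfl⟩ := exists_isEdge (i := i) (j := j) hij
      refine ⟨Quotient.mk _ ⟨(eighth a, eighth b), mem_dartSet.2 ⟨a, b, h, rfl⟩⟩, ?_⟩
      exact SimpleGraph.Dart.ext _ _
        (Prod.ext (realLabel_eighth a) (realLabel_eighth b))

/-- A homeomorphism induces an isomorphism of fundamental groups. -/
theorem nonempty_fundamentalGroup_mulEquiv {X Y : Type} [TopologicalSpace X] [TopologicalSpace Y]
    (f : X ≃ₜ Y) (x : X) : Nonempty (FundamentalGroup X x ≃* FundamentalGroup Y (f x)) := by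
  let F : C(X, Y) := ⟨f, f.continuous⟩
  refine ⟨MulEquiv.ofBijective (FundamentalGroup.map F x) ⟨?_, ?_⟩⟩
  · intro γ δ h
    obtain ⟨γ, rfl⟩ := Path.Homotopic.Quotient.mk_surjective γ
    obtain ⟨δ, rfl⟩ := Path.Homotopic.Quotient.mk_surjective δ
    obtain ⟨H⟩ : (γ.map F.continuous).Homotopic (δ.map F.continuous) :=
      Path.Homotopic.Quotient.exact h
    refine Quotient.sound (s := Path.Homotopic.setoid _ _) ⟨⟨⟨⟨f.symm ∘ H, f.symm.continuous.comp H.continuous⟩,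
      fun t => ?_, fun t => ?_⟩, fun s t ht => ?_⟩⟩
    · simp [F]
    · simp [F]
    · rcases ht with rfl | rfl <;> simp [F]
  · intro γ
    obtain ⟨γ, rfl⟩ := Path.Homotopic.Quotient.mk_surjective γ
    refine ⟨Path.Homotopic.Quotient.mk ((γ.map f.symm.continuous).cast
      (f.symm_apply_apply x).symm (f.symm_apply_apply x).symm), ?_⟩
    refine congrArg Path.Homotopic.Quotient.mk ?_
    ext t
    exact f.apply_symm_apply _

theorem nonempty_fundamentalGroup_quotientGraph (y : quotientGraph.Realization) :
    Nonempty (FundamentalGroup quotientGraph.Realization y ≃* FreeGroup (Fin 3)) := by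
  obtain ⟨e⟩ := nonempty_fundamentalGroup_mulEquiv quotientIso.homeomorph y
  obtain ⟨e'⟩ := OrGraph.completeCover.nonempty_mulEquiv (quotientIso.homeomorph y)
  exact ⟨e.trans e'⟩

/-! ### The covering of the quotient graph -/

open OrGraph

/-- The translation of the graph by a vector of the lattice. -/
def translate (l : bcc) : Hom gyroidGraph gyroidGraph where
  onV p := ⟨l.1 + p.1, add_mem_vertexSet p.2 l.2⟩
  onD d := ⟨(l.1 + d.1.1, l.1 + d.1.2), add_mem_dartSet d.2 l.2⟩
  src_onD _ := rfl
  rev_onD _ := rfl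

/-- The action of the lattice on the realization of the graph. -/
instance : AddAction bcc gyroidGraph.Realization where
  vadd l x := (translate l).realize x
  zero_vadd x := by
    rcases exists_point x with ⟨p, rfl⟩ | ⟨d, t, -, -, rfl⟩
    · exact congrArg vertexPoint (Subtype.ext (zero_add _))
    · exact congrArg (edgePoint · t) (Subtype.ext (Prod.ext (zero_add _) (zero_add _)))
  add_vadd l m x := by
    rcases exists_point x with ⟨p, rfl⟩ | ⟨d, t, -, -, rfl⟩
    · exact congrArg vertexPoint (Subtype.ext (add_assoc _ _ _))
    · exact congrArg (edgePoint · t) (Subtype.ext (Prod.ext (add_assoc _ _ _) (add_assoc _ _ _)))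

theorem quotientHom_vadd (l : bcc) (x : gyroidGraph.Realization) :
    quotientHom.realize (l +ᵥ x) = quotientHom.realize x := by
  rcases exists_point x with ⟨p, rfl⟩ | ⟨d, t, -, -, rfl⟩
  · refine congrArg vertexPoint (Quotient.sound ?_)
    change p.1 - (l.1 + p.1) ∈ bcc
    simp
  · refine congrArg (edgePoint · t) (Quotient.sound ?_)
    refine ⟨-l.1, neg_mem l.2, Prod.ext ?_ ?_⟩
    · change d.1.1 = l.1 + d.1.1 + -l.1
      simp
    · change d.1.2 = l.1 + d.1.2 + -l.1
      simp

/-- The map from the realization of the quotient graph to the quotient of the realization. -/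
def orbitMap : quotientGraph.Realization →
    Quotient (AddAction.orbitRel bcc gyroidGraph.Realization) :=
  Quot.lift (Sum.elim
    (fun v => Quotient.lift (fun p : vertexSet => Quotient.mk _ (vertexPoint (G := gyroidGraph) p))
      (by
        intro p q h
        refine Quotient.sound (AddAction.orbitRel_apply.2 ⟨⟨p.1 - q.1, ?_⟩, ?_⟩)
        · simpa using neg_mem h
        · exact congrArg vertexPoint (Subtype.ext (sub_add_cancel _ _))) v.1)
    fun e => Quotient.lift (fun d : dartSet => Quotient.mk _ (edgePoint (G := gyroidGraph) d e.2))
      (by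
        rintro d d' ⟨l, hl, h⟩
        refine Quotient.sound (AddAction.orbitRel_apply.2 ⟨⟨-l, neg_mem hl⟩, ?_⟩)
        refine congrArg (edgePoint · e.2) (Subtype.ext (Prod.ext ?_ ?_))
        · change -l + d'.1.1 = d.1.1
          simp [h]
        · change -l + d'.1.2 = d.1.2
          simp [h]) e.1) (by
  rintro _ _ (d | ⟨d, t⟩)
  · obtain ⟨d⟩ := d
    exact congrArg (Quotient.mk _) (edgePoint_zero (G := gyroidGraph) d)
  · obtain ⟨d⟩ := d
    exact congrArg (Quotient.mk _) (edgePoint_symm (G := gyroidGraph) d t).symm)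

theorem orbitMap_realize (x : gyroidGraph.Realization) :
    orbitMap (quotientHom.realize x) = Quotient.mk _ x := by
  rcases exists_point x with ⟨p, rfl⟩ | ⟨d, t, -, -, rfl⟩
  · rfl
  · rfl

/-- Stars and open edges serve as neighbourhoods disjoint from all their nontrivial translates,
because a translation that fixes a vertex or an oriented edge is zero. -/
theorem isAddQuotientCoveringMap_realize :
    IsAddQuotientCoveringMap quotientHom.realize bcc where
  toIsQuotientMap := by
    refine (Topology.isQuotientMap_iff _).2 ⟨Topology.isCoinducing_iff.2 fun s => ⟨fun h => ?_,
      fun h => h.preimage quotientHom.realize.continuous⟩, fun y => ?_⟩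
    · refine isOpen_realization_iff.2 ?_
      rintro ⟨d⟩
      exact isOpen_realization_iff.1 h d
    · rcases exists_point y with ⟨⟨p⟩, rfl⟩ | ⟨⟨d⟩, t, -, -, rfl⟩
      · exact ⟨vertexPoint p, rfl⟩
      · exact ⟨edgePoint d t, rfl⟩
  continuous_const_vadd l := (translate l).realize.continuous
  apply_eq_iff_mem_orbit {x y} := by
    constructor
    · intro h
      have h1 := congrArg orbitMap h
      rw [orbitMap_realize, orbitMap_realize] at h1
      exact AddAction.orbitRel_apply.1 (Quotient.exact h1)
    · rintro ⟨l, rfl⟩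
      exact quotientHom_vadd l y
  disjoint x := by
    rcases exists_point x with ⟨p, rfl⟩ | ⟨d, t, h0, h1, rfl⟩
    · refine ⟨star p, (isOpen_star p).mem_nhds rfl, ?_⟩
      rintro l ⟨_, ⟨y, hy, rfl⟩, hy'⟩
      have h : l +ᵥ y ∈ star ((translate l).onV p) := by
        rcases exists_of_mem_star hy with rfl | ⟨d, t, rfl, ht, rfl⟩
        · rfl
        · exact .inl ⟨rfl, ht⟩
      have h2 := eq_of_mem_star h hy'
      have h3 : l.1 + p.1 = p.1 := congrArg Subtype.val h2
      exact Subtype.ext (by simpa using h3)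
    · refine ⟨openEdge d, (isOpen_openEdge d).mem_nhds ⟨.inl rfl, h0, h1⟩, ?_⟩
      rintro l ⟨_, ⟨y, hy, rfl⟩, hy'⟩
      have h : l +ᵥ y ∈ openEdge ((translate l).onD d) := by
        obtain ⟨s, h0, h1, rfl⟩ := exists_of_mem_openEdge hy
        exact ⟨.inl rfl, h0, h1⟩
      rcases eq_of_mem_openEdge h hy' with h2 | h2
      · have h3 : l.1 + d.1.1 = d.1.1 := congrArg (fun e => e.1.1) h2
        exact Subtype.ext (by simpa using h3)
      -- No translation reverses an edge: doing it twice would give `2 l = 0`, and the endpoints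
      -- would coincide.
      · exfalso
        have h3 : l.1 + d.1.1 = d.1.2 := congrArg (fun e => e.1.1) h2
        have h4 : l.1 + d.1.2 = d.1.1 := congrArg (fun e => e.1.2) h2
        refine dart_ne d.2 (funext fun i => ?_)
        have h3' := congrFun h3 i
        have h4' := congrFun h4 i
        simp only [Pi.add_apply] at h3' h4'
        linarith

/-! ### The graph is connected -/

theorem eq_add_of_coords (m : Fin 3 → ℤ) :
    m = m 0 • ![1, 0, 0] + m 1 • ![0, 1, 0] + m 2 • ![0, 0, 1] := by
  ext i
  fin_cases i <;> simp

/-- An equivalence relation that contains all edges relates all vertices. -/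
theorem forall_vertex_rel {R : (Fin 3 → ℝ) → (Fin 3 → ℝ) → Prop} (hR : Equivalence R)
    (h : ∀ d ∈ dartSet, R d.1 d.2) : ∀ p ∈ vertexSet, ∀ q ∈ vertexSet, R p q := by
  let P : Fin 8 → (Fin 3 → ℤ) → (Fin 3 → ℝ) := fun i n => v i + intVec n
  have edge : ∀ k n, R (P (baseIndex k).1 n) (P (baseIndex k).2.1 ((baseIndex k).2.2 + n)) := by
    intro k n
    have := h _ ⟨k, n, .inl rfl⟩
    simpa only [P, baseEdge, intVec_add, ← add_assoc] using this
  have edge' : ∀ k n, (baseIndex k).2.2 = 0 → R (P (baseIndex k).1 n) (P (baseIndex k).2.1 n) := by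
    intro k n hk
    have := edge k n
    rwa [hk, zero_add] at this
  have e1 : ∀ n, R (P 0 n) (P 1 n) := fun n => edge' 0 n rfl
  have e3 : ∀ n, R (P 0 n) (P 3 n) := fun n => edge' 1 n rfl
  have e4 : ∀ n, R (P 0 n) (P 4 n) := fun n => edge' 2 n rfl
  have e2 : ∀ n, R (P 0 n) (P 2 n) := fun n => hR.trans (e3 n) (hR.symm (edge' 3 n rfl))
  have e7 : ∀ n, R (P 0 n) (P 7 n) := fun n => hR.trans (e4 n) (edge' 4 n rfl)
  have e5 : ∀ n, R (P 0 n) (P 5 n) := fun n => hR.trans (e1 n) (edge' 5 n rfl)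
  -- The integral translations that relate every translate of `v 0` to its image. For each
  -- coordinate direction, a path through one of the segments that leave the unit cell shows that
  -- the unit vector belongs to this subgroup.
  let H : AddSubgroup (Fin 3 → ℤ) :=
    { carrier := {m | ∀ n, R (P 0 n) (P 0 (m + n))}
      zero_mem' := fun n => by rw [zero_add]; exact hR.refl _
      add_mem' := fun {a b} ha hb n => by
        rw [add_assoc]
        exact hR.trans (hb n) (ha (b + n))
      neg_mem' := fun {a} ha n => by
        have := ha (-a + n)
        rw [add_neg_cancel_left] at this
        exact hR.symm this }
  have hx : ![1, 0, 0] ∈ H := fun n => hR.trans (e4 n) (hR.trans (edge 6 n) (hR.symm (e5 _)))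
  have hy : ![0, 1, 0] ∈ H := fun n => hR.trans (e1 n) (hR.trans (edge 8 n) (hR.symm (e2 _)))
  have hz : ![0, 0, 1] ∈ H := fun n => hR.trans (e3 n) (hR.trans (edge 11 n) (hR.symm (e7 _)))
  have hH : ∀ m, m ∈ H := by
    intro m
    rw [eq_add_of_coords m]
    exact add_mem (add_mem (zsmul_mem hx _) (zsmul_mem hy _)) (zsmul_mem hz _)
  have e6 : ∀ n, R (P 0 n) (P 6 n) := by
    intro n
    -- `v 6` is not an endpoint of any segment inside the unit cell; it is reached from `v 7` in the
    -- cell translated by `-(1, 0, 0)`.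
    have h1 := edge 7 (-![1, 0, 0] + n)
    have h2 : (baseIndex 7).2.2 + (-![1, 0, 0] + n) = n := add_neg_cancel_left ![1, 0, 0] n
    rw [h2] at h1
    exact hR.trans (neg_mem hx n) (hR.trans (e7 _) h1)
  have e : ∀ i n, R (P 0 n) (P i n) := by
    intro i n
    fin_cases i
    exacts [hR.refl _, e1 n, e2 n, e3 n, e4 n, e5 n, e6 n, e7 n]
  rintro _ ⟨i, n, rfl⟩ _ ⟨j, m, rfl⟩
  have h0 := hH (m - n) n
  rw [sub_add_cancel] at h0
  exact hR.trans (hR.symm (e i n)) (hR.trans h0 (e j m))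

instance : PathConnectedSpace gyroidGraph.Realization := by
  have hj : ∀ p q : gyroidGraph.V, Joined (vertexPoint p) (vertexPoint q) := by
    -- Equality is included so that the relation is reflexive also at points of `ℝ³` that are not
    -- vertices.
    have key := forall_vertex_rel (R := fun p q => p = q ∨ ∃ (hp : p ∈ vertexSet)
      (hq : q ∈ vertexSet), Joined (vertexPoint (G := gyroidGraph) ⟨p, hp⟩)
        (vertexPoint (G := gyroidGraph) ⟨q, hq⟩)) ?_ ?_
    · intro p q
      rcases key p.1 p.2 q.1 q.2 with h | ⟨hp, hq, h⟩
      · rw [Subtype.ext h]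
      · exact h
    · refine ⟨fun p => .inl rfl, ?_, ?_⟩
      · rintro p q (rfl | ⟨hp, hq, h⟩)
        · exact .inl rfl
        · exact .inr ⟨hq, hp, h.symm⟩
      · rintro p q r (rfl | ⟨hp, hq, h⟩) (rfl | ⟨hq', hr, h'⟩)
        · exact .inl rfl
        · exact .inr ⟨hq', hr, h'⟩
        · exact .inr ⟨hp, hq, h⟩
        · exact .inr ⟨hp, hr, h.trans h'⟩
    · intro d hd
      exact .inr ⟨dart_fst hd, dart_fst (dart_swap hd),
        ⟨⟨⟨edgePoint (G := gyroidGraph) ⟨d, hd⟩, continuous_edgePoint _⟩,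
          edgePoint_zero (G := gyroidGraph) ⟨d, hd⟩, edgePoint_one (G := gyroidGraph) ⟨d, hd⟩⟩⟩⟩
  have hx : ∀ x : gyroidGraph.Realization, ∃ p, Joined x (vertexPoint p) := by
    intro x
    rcases exists_point x with ⟨p, rfl⟩ | ⟨d, t, -, -, rfl⟩
    · exact ⟨p, .refl _⟩
    · refine ⟨gyroidGraph.src d, ?_⟩
      rw [← edgePoint_zero]
      have : PathConnectedSpace unitInterval :=
        isPathConnected_iff_pathConnectedSpace.1
          ((convex_Icc (0 : ℝ) 1).isPathConnected ⟨0, by norm_num, by norm_num⟩)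
      exact (PathConnectedSpace.joined t 0).map (continuous_edgePoint d)
  refine ⟨⟨vertexPoint ⟨v 0, 0, 0, by ext; simp [intVec]⟩⟩, fun x y => ?_⟩
  obtain ⟨p, hp⟩ := hx x
  obtain ⟨q, hq⟩ := hx y
  exact hp.trans ((hj p q).trans hq.symm)

theorem isMaximalAbelianCover_realize :
    (∀ x : gyroidGraph.Realization, Nonempty (FundamentalGroup gyroidGraph.Realization x ≃*
      commutator (FreeGroup (Fin 3)))) ∧ IsMaximalAbelianCover quotientHom.realize :=
  isMaximalAbelianCover_of_quotientCoveringMap _ isAddQuotientCoveringMap_realize bccEquiv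
    nonempty_fundamentalGroup_quotientGraph

end

end Gyroid

/-! ### Trigonometric identities and estimates for the Gyroid function -/

namespace Gyroid

noncomputable section

open Real

/-! ### The Gyroid function in terms of angles -/

/-- The Gyroid function as a function of three angles. -/
def gy (x y z : ℝ) : ℝ := sin x * cos y + sin y * cos z + sin z * cos x

theorem level_eq (p : Fin 3 → ℝ) : level p = gy (2 * π * p 0) (2 * π * p 1) (2 * π * p 2) := rfl

theorem gy_cyclic (x y z : ℝ) : gy y z x = gy x y z := by
  unfold gy
  ring

theorem gy_rotate (x y z : ℝ) : gy (π - x) (-y) (z + π) = gy x y z := by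
  unfold gy
  rw [sin_pi_sub, cos_pi_sub, sin_add_pi, cos_add_pi, sin_neg, cos_neg]
  ring

theorem gy_neg (x y z : ℝ) : gy (-x) (-y) (-z) = -gy x y z := by
  unfold gy
  simp only [sin_neg, cos_neg]
  ring

/-- The six sines correspond to the six edges of `K₄`. Inside the channel, the value `-1` of one of
them marks the middle section of the corresponding edge. -/
theorem two_mul_gy (x y z : ℝ) : 2 * gy x y z =
    sin (x - y) + sin (y - z) + sin (z - x) + (sin (x + y) + sin (y + z) + sin (z + x)) := by
  unfold gy
  simp only [sin_add, sin_sub]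
  ring

/-! ### The regions around two different edges are disjoint -/

theorem abs_le_of_sq_add_sq {a b : ℝ} (h : a ^ 2 + b ^ 2 = 1) (ha : a ≤ -0.995) :
    |b| ≤ 0.1 := by
  apply abs_le_of_sq_le_sq _ (by norm_num)
  nlinarith

/-- Both angles are close to `-π/2` modulo `2π`, so their sum is close to `π` and their difference
close to `0`. -/
theorem sin_add_bounds {A B : ℝ} (hA : sin A ≤ -0.995) (hB : sin B ≤ -0.995) :
    |sin (A + B)| ≤ 0.2 ∧ |sin (A - B)| ≤ 0.2 ∧ cos (A + B) ≤ -0.98 ∧ 0.98 ≤ cos (A - B) := by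
  obtain ⟨a1, a2⟩ := abs_le.1 (abs_le_of_sq_add_sq (sin_sq_add_cos_sq A) hA)
  obtain ⟨b1, b2⟩ := abs_le.1 (abs_le_of_sq_add_sq (sin_sq_add_cos_sq B) hB)
  have hA' := neg_one_le_sin A
  have hB' := neg_one_le_sin B
  rw [sin_add, sin_sub, cos_add, cos_sub, abs_le, abs_le]
  refine ⟨⟨?_, ?_⟩, ⟨?_, ?_⟩, ?_, ?_⟩ <;> nlinarith

/-- The shift `A + B` is almost half a period, so the two sines nearly cancel. -/
theorem sin_add_sin_le {A B D : ℝ} (hA : sin A ≤ -0.995) (hB : sin B ≤ -0.995) :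
    sin D + sin (D + (A + B)) ≤ 0.3 := by
  obtain ⟨h1, -, h2, -⟩ := sin_add_bounds hA hB
  obtain ⟨h1, h1'⟩ := abs_le.1 h1
  have h3 := neg_one_le_cos (A + B)
  have h4 := sin_le_one D
  have h5 := neg_one_le_sin D
  have h6 := cos_le_one D
  have h7 := neg_one_le_cos D
  rw [sin_add D]
  nlinarith

theorem sin_add_sin_sub_le {A B D : ℝ} (hA : sin A ≤ -0.995) (hB : sin B ≤ -0.995) :
    sin D + sin ((A - B) - D) ≤ 0.3 := by
  obtain ⟨-, h1, -, h2⟩ := sin_add_bounds hA hB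
  obtain ⟨h1, h1'⟩ := abs_le.1 h1
  have h3 := cos_le_one (A - B)
  have h4 := sin_le_one D
  have h5 := neg_one_le_sin D
  have h6 := cos_le_one D
  have h7 := neg_one_le_cos D
  rw [sin_sub (A - B)]
  nlinarith

/-- The two sines add up to `2 sin x cos y`, so this product is close to `-1`. Then `sin y` and `cos
x` are small, and the other two terms cannot compensate. -/
theorem gy_neg_of_opposite {x y z : ℝ} (h1 : sin (x - y) ≤ -0.995) (h2 : sin (x + y) ≤ -0.995) :
    gy x y z < 0 := by
  obtain ⟨h3, -⟩ := abs_le.1 (sin_add_bounds h1 h2).1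
  have hx : sin x * cos y ≤ -0.995 := by
    rw [sin_sub] at h1
    rw [sin_add] at h2
    linarith
  have hx2 : sin x ^ 2 * cos y ^ 2 ≥ 0.99 := by nlinarith
  have e1 := sin_sq_add_cos_sq x
  have e2 := sin_sq_add_cos_sq y
  have hy : sin y ^ 2 ≤ 0.01 := by nlinarith [sq_nonneg (cos x), sq_nonneg (cos y)]
  have hx' : cos x ^ 2 ≤ 0.01 := by nlinarith [sq_nonneg (sin x), sq_nonneg (sin y)]
  have k1 : |sin y| ≤ 0.1 := abs_le_of_sq_le_sq (by linarith) (by norm_num)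
  have k2 : |cos x| ≤ 0.1 := abs_le_of_sq_le_sq (by linarith) (by norm_num)
  have m1 : sin y * cos z ≤ 0.1 := by
    refine (le_abs_self _).trans ?_
    rw [abs_mul]
    nlinarith [abs_cos_le_one z, abs_nonneg (cos z), abs_nonneg (sin y)]
  have m2 : sin z * cos x ≤ 0.1 := by
    refine (le_abs_self _).trans ?_
    rw [abs_mul]
    nlinarith [abs_sin_le_one z, abs_nonneg (sin z), abs_nonneg (cos x)]
  unfold gy
  linarith

/-- Of the six sines in `two_mul_gy`, the two given ones contribute at most `-1.99`, the third side
of their triangle at most `0.2`, two others nearly cancel and give at most `0.3`, and the last is at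
most `1`. The remaining adjacent cases use the same count. -/
theorem gy_neg_of_adjacent₁ {x y z : ℝ} (h1 : sin (x - y) ≤ -0.995) (h2 : sin (y - z) ≤ -0.995) :
    gy x y z < 0 := by
  obtain ⟨h3, h3'⟩ := abs_le.1 (sin_add_bounds h1 h2).1
  have h4 := sin_add_sin_le (D := y + z) h1 h2
  rw [show y + z + (x - y + (y - z)) = x + y by ring] at h4
  rw [show x - y + (y - z) = -(z - x) by ring, sin_neg] at h3
  have := two_mul_gy x y z
  linarith [sin_le_one (z + x)]

theorem gy_neg_of_adjacent₂ {x y z : ℝ} (h1 : sin (x - y) ≤ -0.995) (h2 : sin (y + z) ≤ -0.995) :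
    gy x y z < 0 := by
  obtain ⟨h3, h3'⟩ := abs_le.1 (sin_add_bounds h1 h2).1
  have h4 := sin_add_sin_le (D := y - z) h1 h2
  rw [show y - z + (x - y + (y + z)) = x + y by ring] at h4
  rw [show x - y + (y + z) = z + x by ring] at h3'
  have := two_mul_gy x y z
  linarith [sin_le_one (z - x)]

theorem gy_neg_of_adjacent₃ {x y z : ℝ} (h1 : sin (x - y) ≤ -0.995) (h2 : sin (z + x) ≤ -0.995) :
    gy x y z < 0 := by
  obtain ⟨h3, h3'⟩ := abs_le.1 (sin_add_bounds h2 h1).2.1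
  have h4 := sin_add_sin_sub_le (D := z - x) h2 h1
  rw [show z + x - (x - y) - (z - x) = x + y by ring] at h4
  rw [show z + x - (x - y) = y + z by ring] at h3'
  have := two_mul_gy x y z
  linarith [sin_le_one (y - z)]

theorem gy_neg_of_adjacent₄ {x y z : ℝ} (h1 : sin (x + y) ≤ -0.995) (h2 : sin (y + z) ≤ -0.995) :
    gy x y z < 0 := by
  obtain ⟨h3, h3'⟩ := abs_le.1 (sin_add_bounds h1 h2).2.1
  have h4 := sin_add_sin_sub_le (D := x - y) h1 h2
  rw [show x + y - (y + z) - (x - y) = y - z by ring] at h4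
  rw [show x + y - (y + z) = -(z - x) by ring, sin_neg] at h3
  have := two_mul_gy x y z
  linarith [sin_le_one (z + x)]

/-- The sine of the angle that belongs to an edge of the quotient graph. -/
def edgeSin (j : Fin 3 ⊕ Fin 3) (x y z : ℝ) : ℝ :=
  Sum.elim ![sin (x - y), sin (y - z), sin (z - x)] ![sin (x + y), sin (y + z), sin (z + x)] j

/-- The fifteen pairs of edges of a tetrahedron fall into five classes under cyclic permutation of
the angles, four of adjacent pairs and one of opposite pairs. -/
theorem eq_of_edgeSin_le {x y z : ℝ} (hg : 0 ≤ gy x y z) {i j : Fin 3 ⊕ Fin 3}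
    (hi : edgeSin i x y z ≤ -0.995) (hj : edgeSin j x y z ≤ -0.995) : i = j := by
  have hg1 : 0 ≤ gy y z x := by rwa [gy_cyclic]
  have hg2 : 0 ≤ gy z x y := by rwa [gy_cyclic, gy_cyclic]
  have key : ∀ {x y z : ℝ}, 0 ≤ gy x y z → sin (x - y) ≤ -0.995 → sin (y - z) ≤ -0.995 → False :=
    fun h h1 h2 => absurd h (gy_neg_of_adjacent₁ h1 h2).not_ge
  have key2 : ∀ {x y z : ℝ}, 0 ≤ gy x y z → sin (x - y) ≤ -0.995 → sin (y + z) ≤ -0.995 → False :=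
    fun h h1 h2 => absurd h (gy_neg_of_adjacent₂ h1 h2).not_ge
  have key3 : ∀ {x y z : ℝ}, 0 ≤ gy x y z → sin (x - y) ≤ -0.995 → sin (z + x) ≤ -0.995 → False :=
    fun h h1 h2 => absurd h (gy_neg_of_adjacent₃ h1 h2).not_ge
  have key4 : ∀ {x y z : ℝ}, 0 ≤ gy x y z → sin (x + y) ≤ -0.995 → sin (y + z) ≤ -0.995 → False :=
    fun h h1 h2 => absurd h (gy_neg_of_adjacent₄ h1 h2).not_ge
  have key5 : ∀ {x y z : ℝ}, 0 ≤ gy x y z → sin (x - y) ≤ -0.995 → sin (x + y) ≤ -0.995 → False :=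
    fun h h1 h2 => absurd h (gy_neg_of_opposite h1 h2).not_ge
  rcases i with i | i <;> rcases j with j | j <;> fin_cases i <;> fin_cases j <;>
    first
    | rfl
    | (exfalso
       simp only [edgeSin, Sum.elim_inl, Sum.elim_inr] at hi hj
       first
       | exact key hg hi hj | exact key hg1 hi hj | exact key hg2 hi hj
       | exact key hg hj hi | exact key hg1 hj hi | exact key hg2 hj hi
       | exact key2 hg hi hj | exact key2 hg1 hi hj | exact key2 hg2 hi hj
       | exact key2 hg hj hi | exact key2 hg1 hj hi | exact key2 hg2 hj hi
       | exact key3 hg hi hj | exact key3 hg1 hi hj | exact key3 hg2 hi hj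
       | exact key3 hg hj hi | exact key3 hg1 hj hi | exact key3 hg2 hj hi
       | exact key4 hg hi hj | exact key4 hg1 hi hj | exact key4 hg2 hi hj
       | exact key4 hg hj hi | exact key4 hg1 hj hi | exact key4 hg2 hj hi
       | exact key5 hg hi hj | exact key5 hg1 hi hj | exact key5 hg2 hi hj
       | exact key5 hg hj hi | exact key5 hg1 hj hi | exact key5 hg2 hj hi)

/-! ### The regions around two different vertices are disjoint -/

theorem cos_le_cos_of_abs_le_abs {a b : ℝ} (h : |a| ≤ |b|) (hb : |b| ≤ π) : cos b ≤ cos a := by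
  rw [← cos_abs a, ← cos_abs b]
  exact cos_le_cos_of_nonneg_of_le_pi (abs_nonneg a) hb h

/-- With `h` half of `x - y`, the prism conditions give `|d| ≤ π/2 - h` and `|e| ≤ h`. Then four of
the six sines sum in pairs to `-2 sin h cos d ≤ -2 sin² h` and `-2 cos h cos e ≤ -2 cos² h`,
together at most `-2`, while the other two are at most `1` each. -/
theorem gy_nonpos_of_prisms {x y z : ℝ} (ha : -(π / 2) < x - y) (hb : -(π / 2) < y - z)
    (hc : -(π / 2) < z - x) {l m n : ℤ} (hlmn : l + m + n = 0)
    (ha' : -(π / 2) < π - x + y + 2 * π * l) (hb' : -(π / 2) < -y - z - π + 2 * π * m)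
    (hc' : -(π / 2) < z + x + 2 * π * n) : gy x y z ≤ 0 := by
  have hπ := pi_pos
  have hs : (l : ℝ) + m + n = 0 := by exact_mod_cast hlmn
  -- Each triple has sum zero and entries above `-π/2`, so its entries are below `π`. Applied to `x
  -- - y` and to `π - (x - y) + 2πl`, this leaves no other integer.
  have hl : l = 0 := by
    have h1 : (-1 : ℝ) < l := by
      by_contra! h
      nlinarith
    have h2 : (l : ℝ) < 1 := by
      by_contra! h
      nlinarith
    have h1' : -1 < l := by exact_mod_cast h1
    have h2' : l < 1 := by exact_mod_cast h2
    omega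
  subst hl
  have hm : (m : ℝ) = -n := by push_cast at hs; linarith
  rw [hm] at hb'
  push_cast at ha'
  set h := (x - y) / 2 with hh
  set d := (x + y) / 2 - z with hd
  set e := (-y - z - (z + x)) / 2 - π / 2 - 2 * π * n with he
  have h1 : |d| ≤ |π / 2 - h| := by
    rw [abs_of_nonneg (a := π / 2 - h) (by linarith)]
    exact abs_le.2 ⟨by linarith, by linarith⟩
  have h2 : |e| ≤ |h| := by
    rw [abs_of_nonneg (a := h) (by linarith)]
    exact abs_le.2 ⟨by linarith, by linarith⟩
  have k1 : sin h ≤ cos d := by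
    rw [← cos_pi_div_two_sub]
    exact cos_le_cos_of_abs_le_abs h1 (by
      rw [abs_of_nonneg (a := π / 2 - h) (by linarith)]
      linarith)
  have k2 : cos h ≤ cos e := cos_le_cos_of_abs_le_abs h2 (by
    rw [abs_of_nonneg (a := h) (by linarith)]
    linarith)
  have s1 : sin (y - z) + sin (z - x) = -(2 * sin h * cos d) := by
    rw [show y - z = -h + d by linarith, show z - x = -h - d by linarith, sin_add (-h), sin_sub (-h),
      sin_neg, cos_neg]
    ring
  have s2 : sin (y + z) + sin (z + x) = -(2 * cos h * cos e) := by
    rw [show y + z = -(h + e - π / 2) - π - (n : ℤ) * (2 * π) by linarith,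
      show z + x = (h - e - π / 2) - (n : ℤ) * (2 * π) by linarith, sin_sub_int_mul_two_pi,
      sin_sub_int_mul_two_pi, sin_sub_pi, sin_neg, sin_sub_pi_div_two, sin_sub_pi_div_two,
      cos_add h, cos_sub h]
    ring
  have hsin : 0 ≤ sin h := sin_nonneg_of_nonneg_of_le_pi (by linarith) (by linarith)
  have hcos : 0 ≤ cos h := cos_nonneg_of_neg_pi_div_two_le_of_le (by linarith) (by linarith)
  have := two_mul_gy x y z
  nlinarith [sin_le_one (x - y), sin_le_one (x + y), sin_sq_add_cos_sq h]

end

end Gyroid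

namespace Gyroid

noncomputable section

open Real

/-! ### The region around an edge -/

/-- Here `t` runs along an edge, with `0` in its middle and `±π/4` at its ends, and `u`, `c` are
transversal coordinates. -/
theorem gy_box (u c t : ℝ) : gy (u - t) (π / 2 + u + t) (π / 4 + c) =
    sin t ^ 2 - sin u ^ 2 + √2 * (cos u * cos c * cos t + sin u * sin c * sin t) := by
  have h2 : √2 * √2 = 2 := mul_self_sqrt (by norm_num)
  unfold gy
  rw [show π / 2 + u + t = (u + t) + π / 2 by ring, sin_add_pi_div_two, cos_add_pi_div_two,
    sin_add (π / 4), cos_add (π / 4), cos_pi_div_four, sin_pi_div_four, sin_sub, cos_sub, sin_add,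
    cos_add]
  have e1 := sin_sq_add_cos_sq u
  have e2 := sin_sq_add_cos_sq t
  linear_combination (sin t ^ 2) * e1 - sin u ^ 2 * e2

/-- The bracket in `gy_box` is a combination of `cos (u + c)` and `cos (u - c)` with weights `(cos t
∓ sin t) / 2`, which are nonnegative for `|t| ≤ π/4`. Scaling `u` and `c` down increases both
cosines and decreases `sin² u`. -/
theorem gy_box_le_scale {u c t s : ℝ} (hu : |u| ≤ π / 2) (hc : |c| ≤ π / 2) (ht : |t| ≤ π / 4)
    (hs : s ∈ Set.Icc (0 : ℝ) 1) : gy (u - t) (π / 2 + u + t) (π / 4 + c) ≤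
      gy (s * u - t) (π / 2 + s * u + t) (π / 4 + s * c) := by
  obtain ⟨hs0, hs1⟩ := hs
  have hπ := pi_pos
  obtain ⟨t1, t2⟩ := abs_le.1 ht
  have hsc : ∀ v, |s * v| ≤ |v| := fun v => by
    rw [abs_mul, abs_of_nonneg hs0]
    exact mul_le_of_le_one_left (abs_nonneg v) hs1
  have hcos : ∀ v, |v| ≤ π → cos v ≤ cos (s * v) := fun v hv =>
    cos_le_cos_of_abs_le_abs (hsc v) hv
  have h1 : cos (u + c) ≤ cos (s * (u + c)) := hcos _ ((abs_add_le u c).trans (by linarith))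
  have h2 : cos (u - c) ≤ cos (s * (u - c)) := hcos _ ((abs_sub u c).trans (by linarith))
  have h3 : sin (s * u) ^ 2 ≤ sin u ^ 2 := by
    have h4 := hcos (2 * u) (by rw [abs_mul, abs_two]; linarith)
    rw [show s * (2 * u) = 2 * (s * u) by ring, cos_two_mul, cos_two_mul] at h4
    have e1 := sin_sq_add_cos_sq u
    have e2 := sin_sq_add_cos_sq (s * u)
    linarith
  have h5 : 0 ≤ cos t - sin t := by
    have := sin_nonneg_of_nonneg_of_le_pi (x := π / 4 - t) (by linarith) (by linarith)
    rw [sin_sub, sin_pi_div_four, cos_pi_div_four] at this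
    have h2 : 0 < √2 := by positivity
    nlinarith
  have h6 : 0 ≤ cos t + sin t := by
    have := sin_nonneg_of_nonneg_of_le_pi (x := π / 4 + t) (by linarith) (by linarith)
    rw [sin_add, sin_pi_div_four, cos_pi_div_four] at this
    have h2 : 0 < √2 := by positivity
    nlinarith
  have key : ∀ u c : ℝ, cos u * cos c * cos t + sin u * sin c * sin t =
      (cos (u + c) * (cos t - sin t) + cos (u - c) * (cos t + sin t)) / 2 := by
    intro u c
    rw [cos_add, cos_sub]
    ring
  rw [gy_box, gy_box, key, key, ← mul_add, ← mul_sub]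
  have h7 := mul_le_mul_of_nonneg_right h1 h5
  have h8 := mul_le_mul_of_nonneg_right h2 h6
  have h9 : 0 ≤ √2 := by positivity
  nlinarith

/-- On the axis the function is `sin² t + √2 cos t`, and its excess over `√2` is `(1 - cos t)(1 +
cos t - √2)`. The minimum is attained in the middle of the edge. -/
theorem sqrt_two_le_gy_axis {t : ℝ} (ht : |t| ≤ π / 4) :
    √2 ≤ gy (-t) (π / 2 + t) (π / 4) := by
  have := gy_box 0 0 t
  simp only [zero_sub, add_zero, sin_zero, cos_zero] at this
  rw [this]
  have h1 : √2 / 2 ≤ cos t := by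
    rw [← cos_pi_div_four]
    refine cos_le_cos_of_abs_le_abs ?_ ?_
    · rwa [abs_of_pos (by positivity : 0 < π / 4)]
    · rw [abs_of_pos (by positivity : 0 < π / 4)]
      linarith [pi_pos]
  have h2 : √2 * √2 = 2 := mul_self_sqrt (by norm_num)
  have h3 := sin_sq_add_cos_sq t
  have h4 : 1.4 < √2 := by
    apply lt_sqrt_of_sq_lt
    norm_num
  nlinarith [cos_le_one t]

theorem sqrt_two_bounds : 1.414 < √2 ∧ √2 < 1.415 := by
  constructor
  · apply lt_sqrt_of_sq_lt
    norm_num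
  · rw [sqrt_lt' (by norm_num)]
    norm_num

/-- On the negative half of the region around an edge, a positive value of the Gyroid function
forces the point to lie in the prism around the first endpoint. -/
theorem sub_lt_of_gy_box_pos {u c t : ℝ} (hu : |u| ≤ π / 2) (hc : |c| ≤ π / 2) (ht : t ≤ 0)
    (ht' : -(1 / 20) ≤ t) (hg : 0 < gy (u - t) (π / 2 + u + t) (π / 4 + c)) :
    c - u < 3 * (π / 4) + t := by
  -- As `c ≤ π/2`, the negation pushes `u` down to about `-π/4`, so `sin² u` is nearly `1/2` or
  -- more, while `cos u cos c` is small.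
  by_contra! h
  rw [gy_box] at hg
  have hπ := pi_gt_three
  obtain ⟨u1, u2⟩ := abs_le.1 hu
  obtain ⟨c1, c2⟩ := abs_le.1 hc
  obtain ⟨q1, q2⟩ := sqrt_two_bounds
  have hsu : sin u ≤ 0 := sin_nonpos_of_nonpos_of_neg_pi_le (by linarith) (by linarith)
  have hsc : 0 ≤ sin c := sin_nonneg_of_nonneg_of_le_pi (by linarith) (by linarith)
  have ht1 : |sin t| ≤ 1 / 20 := by
    refine abs_sin_le_abs.trans ?_
    rw [abs_of_nonpos ht]
    linarith
  obtain ⟨t1, t2⟩ := abs_le.1 ht1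
  have hst : sin t ≤ 0 := sin_nonpos_of_nonpos_of_neg_pi_le ht (by linarith)
  have ht2 : 0.99 ≤ cos t := by
    have h1 := one_sub_sq_div_two_le_cos (x := t)
    nlinarith
  -- the term with the sine of `u`
  have h1 : cos (2 * u) ≤ 0.1 := by
    have h3 : cos (2 * u) ≤ cos (π / 2 + 2 * t) := by
      rw [← cos_neg (2 * u)]
      exact cos_le_cos_of_nonneg_of_le_pi (by linarith) (by linarith) (by linarith)
    rw [add_comm, cos_add_pi_div_two] at h3
    have h4 : |sin (2 * t)| ≤ 1 / 10 := by
      refine abs_sin_le_abs.trans ?_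
      rw [abs_of_nonpos (by linarith)]
      linarith
    have := (abs_le.1 h4).1
    linarith
  have h2 : 0.45 ≤ sin u ^ 2 := by
    rw [cos_two_mul] at h1
    have := sin_sq_add_cos_sq u
    linarith
  -- the term with the cosines
  have h3 : cos (c - u) ≤ -0.65 := by
    have h4 : cos (c - u) ≤ cos (3 * (π / 4) + t) :=
      cos_le_cos_of_nonneg_of_le_pi (by linarith) (by linarith) h
    rw [show 3 * (π / 4) + t = π - (π / 4 - t) by ring, cos_pi_sub, cos_sub (π / 4), cos_pi_div_four,
      sin_pi_div_four] at h4
    nlinarith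
  have h4 : cos u * cos c ≤ 0.175 := by
    have h5 := cos_le_one (c + u)
    rw [cos_sub] at h3
    rw [cos_add] at h5
    nlinarith
  have h5 : 0 ≤ cos u * cos c := mul_nonneg (cos_nonneg_of_neg_pi_div_two_le_of_le u1 u2)
    (cos_nonneg_of_neg_pi_div_two_le_of_le c1 c2)
  have h6 : cos u * cos c * cos t ≤ 0.175 :=
    (mul_le_of_le_one_right h5 (cos_le_one t)).trans h4
  have h7 : sin u * sin c * sin t ≤ 0.05 := by
    have h8 : -(sin u * sin c) ≤ 1 := by nlinarith [neg_one_le_sin u, sin_le_one c]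
    nlinarith [mul_nonneg (neg_nonneg.2 hsu) hsc]
  -- The value is at most `0.0025 - 0.45 + √2 (0.175 + 0.05)`, which is negative.
  nlinarith

/-! ### The region around a vertex -/

theorem cos_sum_eq (q r : ℝ) : 3 + 2 * (cos (q + r) + cos q + cos r) =
    1 + 8 * (cos ((q + r) / 2) * cos (q / 2) * cos (r / 2)) := by
  have e1 := sin_sq_add_cos_sq (q / 2)
  have e2 := sin_sq_add_cos_sq (r / 2)
  have h1 : cos q = 2 * cos (q / 2) ^ 2 - 1 := by rw [← cos_two_mul]; congr 1; ring
  have h2 : cos r = 2 * cos (r / 2) ^ 2 - 1 := by rw [← cos_two_mul]; congr 1; ring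
  have h3 : cos (q + r) = 2 * cos ((q + r) / 2) ^ 2 - 1 := by rw [← cos_two_mul]; congr 1; ring
  have h4 : cos ((q + r) / 2) = cos (q / 2) * cos (r / 2) - sin (q / 2) * sin (r / 2) := by
    rw [← cos_add]; congr 1; ring
  rw [h1, h2, h3, h4]
  linear_combination 4 * (sin (r / 2) ^ 2) * e1 + (4 - 4 * cos (q / 2) ^ 2) * e2

theorem sin_sum_eq (q r : ℝ) : sin (q + r) - sin q - sin r =
    -(4 * (sin ((q + r) / 2) * sin (q / 2) * sin (r / 2))) := by
  have e1 := sin_sq_add_cos_sq (q / 2)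
  have e2 := sin_sq_add_cos_sq (r / 2)
  have h1 : sin q = 2 * sin (q / 2) * cos (q / 2) := by rw [← sin_two_mul]; congr 1; ring
  have h2 : sin r = 2 * sin (r / 2) * cos (r / 2) := by rw [← sin_two_mul]; congr 1; ring
  have h3 : sin (q + r) = 2 * sin ((q + r) / 2) * cos ((q + r) / 2) := by
    rw [← sin_two_mul]; congr 1; ring
  have h4 : cos ((q + r) / 2) = cos (q / 2) * cos (r / 2) - sin (q / 2) * sin (r / 2) := by
    rw [← cos_add]; congr 1; ring
  have h5 : sin ((q + r) / 2) = sin (q / 2) * cos (r / 2) + cos (q / 2) * sin (r / 2) := by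
    rw [← sin_add]; congr 1; ring
  rw [h1, h2, h3, h4, h5]
  linear_combination (2 * sin (q / 2) * cos (q / 2)) * e2 + (2 * sin (r / 2) * cos (r / 2)) * e1

/-- The amplitude of the Gyroid function along a diagonal of the cubic unit cell. -/
def amp (a b c : ℝ) : ℝ := √(3 + 2 * (cos a + cos b + cos c))

/-- The mean value of twice the Gyroid function along a diagonal of the cubic unit cell. -/
def offset (a b c : ℝ) : ℝ := sin a + sin b + sin c

theorem amp_cyclic (a b c : ℝ) : amp b c a = amp a b c := by
  unfold amp
  congr 1
  ring

theorem offset_cyclic (a b c : ℝ) : offset b c a = offset a b c := by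
  unfold offset
  ring

theorem amp_neg {q r : ℝ} : amp (q + r) (-q) (-r) =
    √(1 + 8 * (cos ((q + r) / 2) * cos (q / 2) * cos (r / 2))) := by
  rw [amp, cos_neg, cos_neg, cos_sum_eq]

theorem offset_neg {q r : ℝ} : offset (q + r) (-q) (-r) =
    -(4 * (sin ((q + r) / 2) * sin (q / 2) * sin (r / 2))) := by
  rw [offset, sin_neg, sin_neg, ← sin_sum_eq]
  ring

/-- Written in half the sum and half the difference of `q` and `r`, so that these two parameters can
be varied separately. -/
theorem amp_pos {q r : ℝ} : amp (-(q + r)) q r =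
    √(1 + 4 * (cos ((q + r) / 2) * (cos ((q + r) / 2) + cos ((q - r) / 2)))) := by
  rw [amp, cos_neg, cos_sum_eq]
  congr 2
  rw [show (q + r) / 2 = q / 2 + r / 2 by ring, show (q - r) / 2 = q / 2 - r / 2 by ring, cos_sub,
    cos_add]
  ring

theorem offset_pos {q r : ℝ} : offset (-(q + r)) q r =
    2 * sin ((q + r) / 2) * (cos ((q - r) / 2) - cos ((q + r) / 2)) := by
  have h := sin_sum_eq q r
  have h1 : cos ((q - r) / 2) - cos ((q + r) / 2) = 2 * (sin (q / 2) * sin (r / 2)) := by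
    rw [show (q + r) / 2 = q / 2 + r / 2 by ring, show (q - r) / 2 = q / 2 - r / 2 by ring, cos_sub,
      cos_add]
    ring
  rw [h1, offset, sin_neg]
  linarith

/-- The three differences of the angles of a point around a vertex. -/
structure InPrism (a b c : ℝ) : Prop where
  sum : a + b + c = 0
  left : -(π / 2) < a
  middle : -(π / 2) < b
  right : -(π / 2) < c

theorem InPrism.cyclic {a b c : ℝ} (h : InPrism a b c) : InPrism b c a :=
  ⟨by linarith [h.sum], h.middle, h.right, h.left⟩

/-- To prove something about a prism, two cases suffice by symmetry. -/
theorem InPrism.induction {P : ℝ → ℝ → ℝ → Prop} (hP : ∀ a b c, P a b c → P b c a)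
    (hneg : ∀ q r, 0 ≤ q → 0 ≤ r → q < π / 2 → r < π / 2 → P (q + r) (-q) (-r))
    (hpos : ∀ q r, 0 ≤ q → 0 ≤ r → q + r < π / 2 → P (-(q + r)) q r) {a b c : ℝ}
    (h : InPrism a b c) : P a b c := by
  have key : ∀ {a b c : ℝ}, InPrism a b c → (b ≤ 0 ∧ c ≤ 0 ∨ 0 ≤ b ∧ 0 ≤ c) → P a b c := by
    intro a b c h hbc
    obtain ⟨h0, h1, h2, h3⟩ := h
    rcases hbc with ⟨hb, hc⟩ | ⟨hb, hc⟩
    · have := hneg (-b) (-c) (by linarith) (by linarith) (by linarith) (by linarith)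
      rwa [neg_neg, neg_neg, show -b + -c = a by linarith] at this
    · have := hpos b c hb hc (by linarith)
      rwa [show -(b + c) = a by linarith] at this
  rcases le_total a 0 with ha | ha <;> rcases le_total b 0 with hb | hb <;>
    rcases le_total c 0 with hc | hc
  · exact key h (.inl ⟨hb, hc⟩)
  · exact hP _ _ _ (key h.cyclic.cyclic (.inl ⟨ha, hb⟩))
  · exact hP _ _ _ (hP _ _ _ (key h.cyclic (.inl ⟨hc, ha⟩)))
  · exact key h (.inr ⟨hb, hc⟩)
  · exact key h (.inl ⟨hb, hc⟩)
  · exact hP _ _ _ (hP _ _ _ (key h.cyclic (.inr ⟨hc, ha⟩)))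
  · exact hP _ _ _ (key h.cyclic.cyclic (.inr ⟨ha, hb⟩))
  · exact key h (.inr ⟨hb, hc⟩)

theorem cos_sin_bounds {k : ℝ} (h0 : 0 ≤ k) (h1 : k ≤ π / 4) :
    0 ≤ sin k ∧ sin k ≤ √2 / 2 ∧ √2 / 2 ≤ cos k ∧ cos k ≤ 1 := by
  have := pi_pos
  refine ⟨sin_nonneg_of_nonneg_of_le_pi h0 (by linarith), ?_, ?_, cos_le_one k⟩
  · rw [← sin_pi_div_four]
    exact sin_le_sin_of_le_of_le_pi_div_two (by linarith) (by linarith) h1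
  · rw [← cos_pi_div_four]
    exact cos_le_cos_of_nonneg_of_le_pi h0 (by linarith) h1

/-- If two of the differences are nonpositive, the offset is nonpositive and the amplitude positive.
Otherwise the offset is at most `2 · (√2/2) · (1 - √2/2) = √2 - 1`, while the amplitude is at least
`1`. It means that the function is negative at its minimum on each diagonal in the prism. -/
theorem offset_lt_amp {a b c : ℝ} (h : InPrism a b c) : offset a b c < amp a b c := by
  have hπ := pi_pos
  refine InPrism.induction (P := fun a b c => offset a b c < amp a b c) ?_ ?_ ?_ h
  · intro a b c h
    rwa [offset_cyclic, amp_cyclic]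
  · intro q r hq hr hq' hr'
    rw [offset_neg, amp_neg]
    have h1 : 0 ≤ sin ((q + r) / 2) * sin (q / 2) * sin (r / 2) := by
      refine mul_nonneg (mul_nonneg ?_ ?_) ?_ <;>
        exact sin_nonneg_of_nonneg_of_le_pi (by linarith) (by linarith)
    have h2 : 0 ≤ cos ((q + r) / 2) * cos (q / 2) * cos (r / 2) := by
      refine mul_nonneg (mul_nonneg ?_ ?_) ?_ <;>
        exact cos_nonneg_of_neg_pi_div_two_le_of_le (by linarith) (by linarith)
    have h3 : 0 < √(1 + 8 * (cos ((q + r) / 2) * cos (q / 2) * cos (r / 2))) := by positivity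
    linarith
  · intro q r hq hr hqr
    rw [offset_pos, amp_pos]
    obtain ⟨s0, s1, c0, c1⟩ := cos_sin_bounds (k := (q + r) / 2) (by linarith) (by linarith)
    have hc := cos_le_one ((q - r) / 2)
    have h2 : 0 ≤ cos ((q - r) / 2) :=
      cos_nonneg_of_neg_pi_div_two_le_of_le (by linarith) (by linarith)
    obtain ⟨q1, q2⟩ := sqrt_two_bounds
    have h3 : (1 : ℝ) ≤ √(1 + 4 * (cos ((q + r) / 2) * (cos ((q + r) / 2) + cos ((q - r) / 2)))) := by
      rw [one_le_sqrt]
      have : 0 ≤ cos ((q + r) / 2) := by linarith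
      have : 0 ≤ cos ((q + r) / 2) * (cos ((q + r) / 2) + cos ((q - r) / 2)) := by positivity
      linarith
    nlinarith

/-- The algebraic core of the monotonicity of the maximum of the Gyroid function on diagonals. -/
theorem sqrt_add_le_sqrt_add {C₁ C₂ S₁ S₂ c : ℝ} (h1 : S₁ ^ 2 + C₁ ^ 2 = 1)
    (h2 : S₂ ^ 2 + C₂ ^ 2 = 1) (hS : S₁ ≤ S₂) (hC : C₂ ≤ C₁) (hS1 : 0 ≤ S₁) (hS2 : S₂ ≤ √2 / 2)
    (hC2 : √2 / 2 ≤ C₂) (hc0 : 0 ≤ c) (hc : c ≤ 1) :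
    √(1 + 4 * (C₂ * (C₂ + c))) + 2 * S₂ * (c - C₂) ≤
      √(1 + 4 * (C₁ * (C₁ + c))) + 2 * S₁ * (c - C₁) := by
  obtain ⟨q1, q2⟩ := sqrt_two_bounds
  set R₁ := √(1 + 4 * (C₁ * (C₁ + c))) with hR₁
  set R₂ := √(1 + 4 * (C₂ * (C₂ + c))) with hR₂
  have hC2' : 0 ≤ C₂ := by linarith
  have hC1' : 0 ≤ C₁ := by linarith
  have r1 : R₁ ^ 2 = 1 + 4 * (C₁ * (C₁ + c)) := sq_sqrt (by positivity)
  have r2 : R₂ ^ 2 = 1 + 4 * (C₂ * (C₂ + c)) := sq_sqrt (by positivity)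
  have p1 : 1 ≤ R₁ := by
    rw [hR₁, one_le_sqrt]
    have : 0 ≤ C₁ * (C₁ + c) := by positivity
    linarith
  have p2 : 1 ≤ R₂ := by
    rw [hR₂, one_le_sqrt]
    have : 0 ≤ C₂ * (C₂ + c) := by positivity
    linarith
  have b1 : R₁ ≤ 1 + 2 * C₁ := by
    apply le_of_sq_le_sq _ (by linarith)
    have := mul_le_of_le_one_right hC1' hc
    linarith
  have b2 : R₂ ≤ 1 + 2 * C₂ := by
    apply le_of_sq_le_sq _ (by linarith)
    have := mul_le_of_le_one_right hC2' hc
    linarith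
  set D := 1 + C₁ + C₂ with hD
  have hDpos : 0 < D := by linarith
  have hS0 : 0 ≤ S₂ - S₁ := by linarith
  have hC0 : 0 ≤ C₁ - C₂ := by linarith
  have hP : 0 < C₁ + C₂ := by linarith
  have hSP : S₁ + S₂ ≤ C₁ + C₂ := by linarith
  have hdiff : (S₂ - S₁) * (S₁ + S₂) = (C₁ - C₂) * (C₁ + C₂) := by linear_combination h2 - h1
  have hdiff' := mul_le_mul_of_nonneg_left hSP hS0
  rw [hdiff] at hdiff'
  have k2 : C₁ - C₂ ≤ S₂ - S₁ := le_of_mul_le_mul_right hdiff' hP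
  -- the difference of the cosines is controlled by the difference of the sines
  have k1 : 2 * (C₁ - C₂) ≤ (S₂ - S₁) * D :=
    calc 2 * (C₁ - C₂) ≤ (S₂ - S₁) * 2 := by linarith
      _ ≤ (S₂ - S₁) * D := mul_le_mul_of_nonneg_left (by linarith) hS0
  -- the difference of the square roots
  have k3 : 2 * (C₁ - C₂) * (C₁ + C₂ + c) ≤ (R₁ - R₂) * D := by
    have e : (R₁ - R₂) * (R₁ + R₂) = 4 * (C₁ - C₂) * (C₁ + C₂ + c) := by
      linear_combination r1 - r2
    have hR : 0 ≤ R₁ - R₂ := by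
      have : 0 ≤ (R₁ - R₂) * (R₁ + R₂) := by
        rw [e]
        positivity
      exact nonneg_of_mul_nonneg_left this (by linarith)
    have h3 : R₁ + R₂ ≤ 2 * D := by linarith
    have h4 := mul_le_mul_of_nonneg_left h3 hR
    linarith
  have hc1 : 0 ≤ 1 - c := by linarith
  have k4 : 2 * (C₁ - C₂) - (1 - c) * (S₂ - S₁) ≤ R₁ - R₂ := by
    have h3 := mul_le_mul_of_nonneg_left k1 hc1
    have h4 : (2 * (C₁ - C₂) - (1 - c) * (S₂ - S₁)) * D ≤ (R₁ - R₂) * D :=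
      calc (2 * (C₁ - C₂) - (1 - c) * (S₂ - S₁)) * D
          = 2 * (C₁ - C₂) * D - (1 - c) * ((S₂ - S₁) * D) := by ring
        _ ≤ 2 * (C₁ - C₂) * D - (1 - c) * (2 * (C₁ - C₂)) := by linarith
        _ = 2 * (C₁ - C₂) * (C₁ + C₂ + c) := by rw [hD]; ring
        _ ≤ _ := k3
    exact le_of_mul_le_mul_right h4 hDpos
  have hm : ∀ S C : ℝ, S ^ 2 + C ^ 2 = 1 → 0 ≤ S → 0 ≤ C → 1 ≤ S + C := by
    intro S C h hS hC
    apply le_of_sq_le_sq _ (add_nonneg hS hC)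
    linarith only [h, mul_nonneg hS hC]
  -- Since `(S + C)² = 1 + 2 S C` and `x² - 2 x` increases for `x ≥ 1`, this bounds the growth of `2
  -- S C` from below by that of `2 (S + C)`.
  have k5 : 0 ≤ (S₂ + C₂ - (S₁ + C₁)) * (S₂ + C₂ + (S₁ + C₁) - 2) :=
    mul_nonneg (by linarith)
      (by linarith [hm S₁ C₁ h1 hS1 hC1', hm S₂ C₂ h2 (by linarith) hC2'])
  have k6 := mul_nonneg hc1 hS0
  linarith only [k6, k5, k4, h1, h2]

theorem sin_mono_scale {k s : ℝ} (h0 : 0 ≤ k) (h1 : k ≤ π / 2) (hs : s ∈ Set.Icc (0 : ℝ) 1) :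
    sin (s * k) ≤ sin k := by
  have h2 : s * k ≤ k := mul_le_of_le_one_left h0 hs.2
  have h3 := mul_nonneg hs.1 h0
  exact sin_le_sin_of_le_of_le_pi_div_two (by linarith [pi_pos]) h1 h2

theorem cos_mono_scale {k s : ℝ} (h1 : |k| ≤ π) (hs : s ∈ Set.Icc (0 : ℝ) 1) :
    cos k ≤ cos (s * k) := by
  refine cos_le_cos_of_abs_le_abs ?_ h1
  rw [abs_mul, abs_of_nonneg hs.1]
  exact mul_le_of_le_one_left (abs_nonneg k) hs.2

/-- The left side is twice the maximum of the Gyroid function on a diagonal. With two nonpositive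
differences every factor is monotone by itself. With two nonnegative ones the half-sum `k` is shrunk
first, by `sqrt_add_le_sqrt_add`; then shrinking `m` raises `cos m`, in which both summands
increase. -/
theorem amp_add_offset_le_scale {a b c s : ℝ} (h : InPrism a b c) (hs : s ∈ Set.Icc (0 : ℝ) 1) :
    amp a b c + offset a b c ≤ amp (s * a) (s * b) (s * c) + offset (s * a) (s * b) (s * c) := by
  have hπ := pi_pos
  refine InPrism.induction (P := fun a b c => amp a b c + offset a b c ≤
    amp (s * a) (s * b) (s * c) + offset (s * a) (s * b) (s * c)) ?_ ?_ ?_ h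
  · intro a b c h
    rwa [offset_cyclic, amp_cyclic, offset_cyclic (s * a), amp_cyclic (s * a)]
  · intro q r hq hr hq' hr'
    rw [mul_add, mul_neg, mul_neg, offset_neg, amp_neg, offset_neg, amp_neg, ← mul_add,
      mul_div_assoc, mul_div_assoc, mul_div_assoc]
    have hpos : ∀ k, 0 ≤ k → k < π / 2 → 0 ≤ sin (s * k) ∧ sin (s * k) ≤ sin k ∧ 0 ≤ cos k ∧
        cos k ≤ cos (s * k) := by
      intro k h0 h1
      have h2 : s * k ≤ k := mul_le_of_le_one_left h0 hs.2
      exact ⟨sin_nonneg_of_nonneg_of_le_pi (mul_nonneg hs.1 h0) (by linarith),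
        sin_mono_scale h0 h1.le hs, cos_nonneg_of_neg_pi_div_two_le_of_le (by linarith) h1.le,
        cos_mono_scale (by rw [abs_of_nonneg h0]; linarith) hs⟩
    obtain ⟨a1, a2, a3, a4⟩ := hpos ((q + r) / 2) (by linarith) (by linarith)
    obtain ⟨b1, b2, b3, b4⟩ := hpos (q / 2) (by linarith) (by linarith)
    obtain ⟨c1, c2, c3, c4⟩ := hpos (r / 2) (by linarith) (by linarith)
    have a5 := a3.trans a4
    have b5 := b3.trans b4
    have a6 := a1.trans a2
    have b6 := b1.trans b2
    have ab5 := mul_nonneg a5 b5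
    have ab6 := mul_nonneg a6 b6
    have h1 : √(1 + 8 * (cos ((q + r) / 2) * cos (q / 2) * cos (r / 2))) ≤
        √(1 + 8 * (cos (s * ((q + r) / 2)) * cos (s * (q / 2)) * cos (s * (r / 2)))) := by
      gcongr
    have h2 : sin (s * ((q + r) / 2)) * sin (s * (q / 2)) * sin (s * (r / 2)) ≤
        sin ((q + r) / 2) * sin (q / 2) * sin (r / 2) := by
      gcongr
    linarith
  · intro q r hq hr hqr
    rw [mul_neg, mul_add, offset_pos, amp_pos, offset_pos, amp_pos, ← mul_add, ← mul_sub,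
      mul_div_assoc, mul_div_assoc]
    set k := (q + r) / 2 with hk
    set m := (q - r) / 2 with hm
    have hk0 : 0 ≤ k := by linarith
    have hk1 : k ≤ π / 4 := by linarith
    have hsk : s * k ≤ k := mul_le_of_le_one_left hk0 hs.2
    have hsk0 : 0 ≤ s * k := mul_nonneg hs.1 hk0
    obtain ⟨s0, s1, c0, c1⟩ := cos_sin_bounds hk0 hk1
    obtain ⟨s0', s1', c0', c1'⟩ := cos_sin_bounds hsk0 (hsk.trans hk1)
    have hm1 : |m| ≤ π / 2 := abs_le.2 ⟨by linarith, by linarith⟩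
    have hm0 : 0 ≤ cos m := by
      obtain ⟨h3, h4⟩ := abs_le.1 hm1
      exact cos_nonneg_of_neg_pi_div_two_le_of_le h3 h4
    have h1 := sqrt_add_le_sqrt_add (sin_sq_add_cos_sq (s * k)) (sin_sq_add_cos_sq k)
      (sin_mono_scale hk0 (by linarith) hs) (cos_mono_scale (by rw [abs_of_nonneg hk0]; linarith) hs)
      s0' s1 c0 hm0 (cos_le_one m)
    have h2 : cos m ≤ cos (s * m) := cos_mono_scale (by linarith) hs
    have hC : 0 ≤ cos (s * k) := le_trans (by positivity) c0'
    refine h1.trans (add_le_add ?_ ?_)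
    · gcongr
    · gcongr

end

end Gyroid

/-! ### Symmetric covers, lattice quotients and lifting of connectedness -/

namespace Gyroid

noncomputable section

/-! ### Covers with tetrahedral symmetry -/

section Symmetric

variable {X : Type} [TopologicalSpace X]

/-- The symmetry that carries the set of a vertex to the set of the base vertex. -/
def vertexSymm (c r : X ≃ₜ X) (i : Option (Fin 3)) : X ≃ₜ X :=
  i.elim (Homeomorph.refl X) ![r, c.trans r, (c.trans c).trans r]

/-- The symmetry that carries the set of an edge to the set of the base edge. -/
def edgeSymm (c r : X ≃ₜ X) (j : Fin 3 ⊕ Fin 3) : X ≃ₜ X :=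
  j.elim ![Homeomorph.refl X, c, c.trans c]
    ![c.trans (r.trans (c.trans c)), (c.trans c).trans (r.trans (c.trans c)), r.trans (c.trans c)]

/-- A cover that is obtained from the sets of one vertex and one edge of the complete graph on four
vertices by the symmetries of a tetrahedron. -/
def symmetricCover (c r : X ≃ₜ X) (O T : Set X) (hc : ∀ x, c (c (c x)) = x) (hr : ∀ x, r (r x) = x)
    (hcr : ∀ x, r (c (r x)) = c (c (r (c (c x))))) (hO : IsOpen O) (hT : IsOpen T)
    (hOc : ∀ x, c x ∈ O ↔ x ∈ O) (hTr : ∀ x, r x ∈ T ↔ x ∈ T) (hOs : IsSimplyConnected O)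
    (hTs : IsSimplyConnected T) (hOT : IsPathConnected (O ∩ T))
    (cover : ∀ x, (∃ i, vertexSymm c r i x ∈ O) ∨ ∃ j, edgeSymm c r j x ∈ T)
    (hOO : ∀ x ∈ O, r x ∉ O)
    (hTT : ∀ x j j', edgeSymm c r j x ∈ T → edgeSymm c r j' x ∈ T → j = j')
    (hcl : ∀ x ∈ T, x ∈ closure O ∨ r x ∈ closure O) :
    GraphCover X (Fin 3) (Fin 3) (fun k => some (k + 1)) (fun k => some (k + 2)) := by
  -- The hypotheses on `c` and `r` are the relations `c³ = r² = (c r)³ = 1` of the tetrahedral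
  -- group; this is another form of the last one.
  have hcr' : ∀ x, r (c (c (r x))) = c (r (c x)) := by
    intro x
    have h : r (c (r (c (r (c x))))) = x := by rw [hcr, hc, hr, hc]
    calc r (c (c (r x))) = r (c (c (r (r (c (r (c (r (c x))))))))) := by rw [h]
      _ = c (r (c x)) := by rw [hr, hc, hr]
  have hOcc : ∀ x, c (c x) ∈ O ↔ x ∈ O := fun x => (hOc _).trans (hOc _)
  have h01 : ∀ x, r x ∈ O → r (c x) ∉ O := by
    intro x h h'
    rw [← hr x, hcr, hOcc] at h'
    exact hOO _ ((hOcc _).2 h) h'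
  have h02 : ∀ x, r x ∈ O → r (c (c x)) ∉ O := by
    intro x h h'
    rw [← hr x, hcr', hOc] at h'
    exact hOO _ ((hOc _).2 h) h'
  have hinj : ∀ x i i', x ∈ vertexSymm c r i ⁻¹' O → x ∈ vertexSymm c r i' ⁻¹' O → i = i' := by
    have key : ∀ x, (x ∈ O → r x ∉ O) ∧ (x ∈ O → r (c x) ∉ O) ∧ (x ∈ O → r (c (c x)) ∉ O) ∧
        (r x ∈ O → r (c x) ∉ O) ∧ (r x ∈ O → r (c (c x)) ∉ O) ∧
        (r (c x) ∈ O → r (c (c x)) ∉ O) := fun x =>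
      ⟨hOO x, fun h => hOO _ ((hOc x).2 h), fun h => hOO _ ((hOcc x).2 h), h01 x, h02 x,
        h01 (c x)⟩
    intro x i i' h h'
    obtain ⟨k1, k2, k3, k4, k5, k6⟩ := key x
    rcases i with _ | i <;> rcases i' with _ | i'
    · rfl
    · exfalso
      fin_cases i'
      exacts [k1 h h', k2 h h', k3 h h']
    · exfalso
      fin_cases i
      exacts [k1 h' h, k2 h' h, k3 h' h]
    · fin_cases i <;> fin_cases i'
      exacts [rfl, (k4 h h').elim, (k5 h h').elim, (k4 h' h).elim, rfl, (k6 h h').elim,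
        (k5 h' h).elim, (k6 h' h).elim, rfl]
  -- An open vertex set containing a point of the closure of another vertex set would meet it, and
  -- different vertex sets are disjoint. So the closure hypothesis restricts the vertices incident
  -- to the base edge to its two ends.
  have hinc : ∀ x ∈ T, ∀ i, vertexSymm c r i x ∈ O → i = none ∨ i = some 0 := by
    intro x hx i hi
    have hV : IsOpen (vertexSymm c r i ⁻¹' O) := hO.preimage (vertexSymm c r i).continuous
    rcases hcl x hx with h | h
    · obtain ⟨y, hy, hy'⟩ := mem_closure_iff.1 h _ hV hi
      exact .inl (hinj y _ none hy hy')
    · obtain ⟨y, hy, hy'⟩ := mem_closure_iff.1 h _ (hV.preimage r.continuous)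
        (show r (r x) ∈ vertexSymm c r i ⁻¹' O by rw [hr]; exact hi)
      refine .inr (hinj (r y) _ (some 0) hy ?_)
      change r (r y) ∈ O
      rwa [hr]
  have hrTO : ∀ x, (r x ∈ O ∧ x ∈ T) ↔ r x ∈ O ∩ T := fun x => and_congr_right' (hTr x).symm
  have pre : ∀ (f : X ≃ₜ X) {S : Set X}, (∀ x, x ∈ S ↔ f x ∈ O ∩ T) → IsPathConnected S := by
    intro f S hS
    rw [show S = f ⁻¹' (O ∩ T) from Set.ext hS, Homeomorph.isPathConnected_preimage]
    exact hOT
  exact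
  { O := fun i => vertexSymm c r i ⁻¹' O
    T := fun j => edgeSymm c r j ⁻¹' T
    isOpen_O := fun i => hO.preimage (vertexSymm c r i).continuous
    isOpen_T := fun j => hT.preimage (edgeSymm c r j).continuous
    cover := cover
    eq_of_mem_O := hinj
    eq_of_mem_T := hTT
    isSimplyConnected_O := fun i => ((vertexSymm c r i).isSimplyConnected_preimage).2 hOs
    isSimplyConnected_T := fun j => ((edgeSymm c r j).isSimplyConnected_preimage).2 hTs
    isPathConnected_src := by
      rintro (k | k)
      · fin_cases k
        · exact pre (Homeomorph.refl X) fun x => .rfl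
        · exact pre c fun x => and_congr_left' (hOc x).symm
        · exact pre (c.trans c) fun x => and_congr_left' (hOcc x).symm
      · fin_cases k
        · exact pre (c.trans (r.trans (c.trans c))) fun x => and_congr_left' (hOcc _).symm
        · exact pre ((c.trans c).trans (r.trans (c.trans c))) fun x =>
            and_congr_left' (hOcc _).symm
        · exact pre (r.trans (c.trans c)) fun x => and_congr_left' (hOcc _).symm
    isPathConnected_tgt := by
      have h3 : ∀ x, (r (c (c x)) ∈ O ∧ c (c (r (c x))) ∈ T) ↔ r (c (c (r (c x)))) ∈ O ∩ T := by
        intro x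
        rw [← hrTO, hcr', hOc]
      rintro (k | k)
      · fin_cases k
        · exact pre r hrTO
        · exact pre (c.trans r) fun x => hrTO (c x)
        · exact pre ((c.trans c).trans r) fun x => hrTO (c (c x))
      · fin_cases k
        · exact pre ((c.trans (r.trans (c.trans c))).trans r) h3
        · refine pre (((c.trans c).trans (r.trans (c.trans c))).trans r) fun x => ?_
          have := h3 (c x)
          rw [hc] at this
          exact this
        · refine pre ((r.trans (c.trans c)).trans r) fun x => ?_
          have := h3 (c (c x))
          rw [hc, hc] at this
          exact this
    incident := by
      have hi : ∀ x ∈ T, r (c x) ∉ O ∧ r (c (c x)) ∉ O := by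
        intro x hx
        constructor
        · intro h
          have := hinc x hx (some 1) h
          simp at this
        · intro h
          have := hinc x hx (some 2) h
          simp at this
      -- The edge opposite to the base edge avoids both ends of the base edge.
      have hj : ∀ x, c (c (r (c x))) ∈ T → x ∉ O ∧ r x ∉ O := by
        intro x hx
        obtain ⟨h1, h2⟩ := hi _ hx
        rw [hc, hr, hOc] at h1
        rw [hc, hcr, hc, hOcc] at h2
        exact ⟨h1, h2⟩
      intro x i j h h'
      rcases j with k | k <;> fin_cases k <;> rcases i with _ | i
      · exact .inl rfl
      · fin_cases i
        exacts [.inr rfl, ((hi _ h').1 h).elim, ((hi _ h').2 h).elim]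
      · exact .inl rfl
      · have h2 := (hi _ h').2
        change r (c (c (c x))) ∉ O at h2
        rw [hc] at h2
        fin_cases i
        exacts [(h2 h).elim, .inr rfl, ((hi _ h').1 h).elim]
      · exact .inl rfl
      · have h1 := (hi _ h').1
        have h2 := (hi _ h').2
        change r (c (c (c x))) ∉ O at h1
        change r (c (c (c (c x)))) ∉ O at h2
        rw [hc] at h1 h2
        fin_cases i
        exacts [(h1 h).elim, (h2 h).elim, .inr rfl]
      · exact ((hj x h').1 h).elim
      · fin_cases i
        exacts [((hj x h').2 h).elim, .inl rfl, .inr rfl]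
      · exact ((hj (c x) h').1 ((hOc x).2 h)).elim
      · fin_cases i
        exacts [.inr rfl, ((hj (c x) h').2 h).elim, .inl rfl]
      · refine ((hj (c (c x)) ?_).1 ((hOcc x).2 h)).elim
        rw [hc]
        exact h'
      · fin_cases i
        · exact .inl rfl
        · exact .inr rfl
        · refine ((hj (c (c x)) ?_).2 h).elim
          rw [hc]
          exact h'
    ne := by decide }

end Symmetric

/-! ### Quotients by the lattice -/

section Quotient

variable {C : Set (Fin 3 → ℝ)}

/-- The action of the lattice on an invariant set. -/
abbrev bccAction (hC : ∀ p ∈ C, ∀ l ∈ bcc, l + p ∈ C) : AddAction bcc C where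
  vadd l p := ⟨l.1 + p.1, hC p.1 p.2 l.1 l.2⟩
  zero_vadd p := Subtype.ext (zero_add p.1)
  add_vadd l m p := Subtype.ext (add_assoc l.1 m.1 p.1)

theorem eq_zero_of_mem_bcc {l : Fin 3 → ℝ} (hl : l ∈ bcc) (h : ∀ i, |l i| < 1 / 2) : l = 0 := by
  obtain ⟨k, -, hk⟩ := mem_bcc_iff.1 hl
  ext i
  have h1 := h i
  rw [hk i, abs_div, abs_two, div_lt_div_iff_of_pos_right two_pos] at h1
  have h2 : k i = 0 := by
    rw [← Int.abs_lt_one_iff]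
    exact_mod_cast h1
  rw [hk i, h2]
  simp

/-- Nonzero lattice vectors have sup norm at least `1/2`, so a ball of radius `1/4` is disjoint from
its nontrivial translates. -/
theorem isAddQuotientCoveringMap_bccProj (hC : ∀ p ∈ C, ∀ l ∈ bcc, l + p ∈ C) :
    letI := bccAction hC
    IsAddQuotientCoveringMap (bccProj C) bcc :=
  letI := bccAction hC
  { toIsQuotientMap := isQuotientMap_quotient_mk'
    continuous_const_vadd := fun l =>
      (continuous_const.add continuous_subtype_val).subtype_mk _
    apply_eq_iff_mem_orbit := by
      intro x y
      constructor
      · intro h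
        have h1 : y.1 - x.1 ∈ bcc := Quotient.exact h
        exact ⟨⟨x.1 - y.1, by simpa using neg_mem h1⟩, Subtype.ext (sub_add_cancel _ _)⟩
      · rintro ⟨l, rfl⟩
        refine Quotient.sound ?_
        change y.1 - (l.1 + y.1) ∈ bcc
        simp
    disjoint := by
      intro e
      refine ⟨Subtype.val ⁻¹' Metric.ball e.1 (1 / 4),
        (Metric.isOpen_ball.preimage continuous_subtype_val).mem_nhds
          (Metric.mem_ball_self (by norm_num)), ?_⟩
      rintro l ⟨_, ⟨y, hy, rfl⟩, hy'⟩
      have h1 : dist y.1 e.1 < 1 / 4 := hy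
      have h2 : dist (l.1 + y.1) e.1 < 1 / 4 := hy'
      refine Subtype.ext (eq_zero_of_mem_bcc l.2 fun i => ?_)
      have h3 := (dist_le_pi_dist y.1 e.1 i).trans_lt h1
      have h4 := (dist_le_pi_dist (l.1 + y.1) e.1 i).trans_lt h2
      rw [Real.dist_eq, abs_lt] at h3 h4
      simp only [Pi.add_apply] at h4
      rw [abs_lt]
      constructor <;> linarith }

theorem isOpenMap_bccProj (hC : ∀ p ∈ C, ∀ l ∈ bcc, l + p ∈ C) : IsOpenMap (bccProj C) :=
  letI := bccAction hC
  (isAddQuotientCoveringMap_bccProj hC).isOpenQuotientMap.isOpenMap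

theorem bccProj_eq_iff {p q : C} : bccProj C p = bccProj C q ↔ (q : Fin 3 → ℝ) - p ∈ bcc :=
  Quotient.eq (r := bccSetoid C)

theorem bccProj_surjective (x : BccQuotient C) : ∃ p, bccProj C p = x := Quotient.exists_rep x

/-- The homeomorphism of quotients that is induced by a homeomorphism of `ℝ³` that respects the
lattice. -/
def bccHomeomorph {C D : Set (Fin 3 → ℝ)} (f : (Fin 3 → ℝ) ≃ₜ (Fin 3 → ℝ))
    (hf : ∀ p q, f q - f p ∈ bcc ↔ q - p ∈ bcc) (hC : ∀ p, f p ∈ D ↔ p ∈ C) :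
    BccQuotient C ≃ₜ BccQuotient D where
  toFun := Quotient.map (fun p : C => (⟨f p, (hC p).2 p.2⟩ : D)) fun p q h => (hf p q).2 h
  invFun := Quotient.map (fun p : D => (⟨f.symm p, (hC _).1 (by simp)⟩ : C)) fun p q h =>
    (hf _ _).1 (by
      have h' : q.1 - p.1 ∈ bcc := h
      simpa using h')
  left_inv := by
    rintro ⟨p⟩
    exact congrArg (bccProj C) (Subtype.ext (f.symm_apply_apply p.1))
  right_inv := by
    rintro ⟨p⟩
    exact congrArg (bccProj D) (Subtype.ext (f.apply_symm_apply p.1))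
  continuous_toFun := continuous_quot_lift _ (continuous_quot_mk.comp
    ((f.continuous.comp continuous_subtype_val).subtype_mk _))
  continuous_invFun := continuous_quot_lift _ (continuous_quot_mk.comp
    ((f.symm.continuous.comp continuous_subtype_val).subtype_mk _))

/-- The image of a set in the quotient. -/
def bccImage (C A : Set (Fin 3 → ℝ)) : Set (BccQuotient C) := bccProj C '' (Subtype.val ⁻¹' A)

theorem mem_bccImage {A : Set (Fin 3 → ℝ)} (hC : ∀ p ∈ C, ∀ l ∈ bcc, l + p ∈ C) (p : C) :
    bccProj C p ∈ bccImage C A ↔ ∃ l ∈ bcc, l + p ∈ A := by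
  constructor
  · rintro ⟨q, hq, h⟩
    refine ⟨q - p, ?_, by simpa using hq⟩
    simpa using neg_mem (bccProj_eq_iff.1 h)
  · rintro ⟨l, hl, h⟩
    exact ⟨⟨l + p, hC p p.2 l hl⟩, h, bccProj_eq_iff.2 (by simpa using hl)⟩

theorem isOpen_bccImage {A : Set (Fin 3 → ℝ)} (hC : ∀ p ∈ C, ∀ l ∈ bcc, l + p ∈ C)
    (hA : IsOpen A) : IsOpen (bccImage C A) :=
  isOpenMap_bccProj hC _ (hA.preimage continuous_subtype_val)

/-- If no two points of `C ∩ A` are congruent modulo the lattice, the open projection restricts to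
an open embedding of `C ∩ A`. -/
theorem isSimplyConnected_bccImage {A : Set (Fin 3 → ℝ)} (hC : ∀ p ∈ C, ∀ l ∈ bcc, l + p ∈ C)
    (hA : IsOpen A) (hinj : ∀ p ∈ C ∩ A, ∀ q ∈ C ∩ A, q - p ∈ bcc → p = q)
    (hs : IsSimplyConnected (C ∩ A)) : IsSimplyConnected (bccImage C A) := by
  let f : ↥(C ∩ A) → BccQuotient C := fun p => bccProj C ⟨p.1, p.2.1⟩
  have hf : Topology.IsOpenEmbedding f := by
    refine .of_continuous_injective_isOpenMap ((bccProj C).continuous.comp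
      (continuous_subtype_val.subtype_mk _)) ?_ ?_
    · intro p q h
      exact Subtype.ext (hinj p p.2 q q.2 ((bccProj_eq_iff (C := C)).1 h))
    · refine (isOpenMap_bccProj hC).comp (f := fun p : ↥(C ∩ A) => (⟨p.1, p.2.1⟩ : C)) ?_
      intro s hs
      obtain ⟨t, ht, rfl⟩ := isOpen_induced_iff.1 hs
      rw [show (fun p : ↥(C ∩ A) => (⟨p.1, p.2.1⟩ : C)) '' (Subtype.val ⁻¹' t) =
        Subtype.val ⁻¹' (t ∩ A) from ?_]
      · exact (ht.inter hA).preimage continuous_subtype_val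
      · ext p
        constructor
        · rintro ⟨q, hq, rfl⟩
          exact ⟨hq, q.2.2⟩
        · rintro ⟨h1, h2⟩
          exact ⟨⟨p.1, p.2, h2⟩, h1, rfl⟩
  have himage : bccImage C A = f '' Set.univ := by
    ext x
    constructor
    · rintro ⟨p, hp, rfl⟩
      exact ⟨⟨p.1, p.2, hp⟩, trivial, rfl⟩
    · rintro ⟨p, -, rfl⟩
      exact ⟨⟨p.1, p.2.1⟩, p.2.2, rfl⟩
  rw [himage, hf.isEmbedding.isSimplyConnected_image]
  have := hs.simplyConnectedSpace
  exact (Homeomorph.Set.univ _).toHomotopyEquiv.simplyConnectedSpace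

end Quotient

/-! ### Lifting connectedness and contracting in two steps -/

/-- A path downstairs lifts to a path from any point to the orbit of `e`, so it suffices that this
single orbit can be joined. -/
theorem pathConnectedSpace_of_quotientCoveringMap {E B G : Type} [TopologicalSpace E]
    [TopologicalSpace B] [AddCommGroup G] [AddAction G E] {p : E → B}
    (hp : IsAddQuotientCoveringMap p G) [PathConnectedSpace B] (e : E)
    (he : ∀ g : G, Joined e (g +ᵥ e)) : PathConnectedSpace E := by
  have key : ∀ x : E, Joined e x := by
    intro x
    obtain ⟨γ⟩ := PathConnectedSpace.joined (p x) (p e)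
    let Γ := hp.isCoveringMap.liftPath γ.toContinuousMap x γ.source
    have h0 : Γ 0 = x := hp.isCoveringMap.liftPath_zero _ _ _
    have h1 : p (Γ 1) = p e := by
      have := congrFun (hp.isCoveringMap.liftPath_lifts γ.toContinuousMap x γ.source) 1
      exact this.trans γ.target
    obtain ⟨g, hg⟩ := hp.apply_eq_iff_mem_orbit.1 h1
    have h2 : Joined x (Γ 1) := ⟨⟨Γ, h0, rfl⟩⟩
    rw [← hg] at h2
    exact (he g).trans h2.symm
  exact ⟨⟨e⟩, fun x y => (key x).symm.trans (key y)⟩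

theorem isSimplyConnected_of_two_homotopies {E : Type} [TopologicalSpace E] {S : Set E} {a : E}
    (ha : a ∈ S) {H K : ℝ → E → E}
    (hH : ContinuousOn (Function.uncurry H) (Set.Icc 0 1 ×ˢ S))
    (hK : ContinuousOn (Function.uncurry K) (Set.Icc 0 1 ×ˢ S))
    (hHS : ∀ s ∈ Set.Icc (0 : ℝ) 1, ∀ p ∈ S, H s p ∈ S)
    (hKS : ∀ s ∈ Set.Icc (0 : ℝ) 1, ∀ p ∈ S, K s p ∈ S)
    (h0 : ∀ p ∈ S, H 0 p = p) (h1 : ∀ p ∈ S, H 1 p = K 0 p) (h2 : ∀ p ∈ S, K 1 p = a) :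
    IsSimplyConnected S := by
  have mk : ∀ {L : ℝ → E → E}, ContinuousOn (Function.uncurry L) (Set.Icc 0 1 ×ˢ S) →
      (∀ s ∈ Set.Icc (0 : ℝ) 1, ∀ p ∈ S, L s p ∈ S) → ∃ F : C(unitInterval × S, S),
        ∀ s p, (F (s, p) : E) = L s p := by
    intro L hL hLS
    refine ⟨⟨fun x => ⟨L x.1 x.2, hLS _ x.1.2 _ x.2.2⟩, Continuous.subtype_mk ?_ _⟩,
      fun s p => rfl⟩
    exact hL.comp_continuous (f := fun x : unitInterval × S => ((x.1 : ℝ), (x.2 : E)))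
      (by fun_prop) fun x => ⟨x.1.2, x.2.2⟩
  obtain ⟨F, hF⟩ := mk hH hHS
  obtain ⟨G, hG⟩ := mk hK hKS
  have e1 : (ContinuousMap.id S).Homotopic ⟨fun p => F (1, p), by fun_prop⟩ :=
    ⟨⟨F, fun p => Subtype.ext ((hF _ _).trans (h0 _ p.2)), fun p => rfl⟩⟩
  have e2 : ContinuousMap.Homotopic ⟨fun p => F (1, p), by fun_prop⟩
      (ContinuousMap.const S (⟨a, ha⟩ : S)) :=
    ⟨⟨G, fun p => Subtype.ext ((hG 0 p).trans ((h1 _ p.2).symm.trans (hF 1 p).symm)),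
      fun p => Subtype.ext ((hG _ _).trans (h2 _ p.2))⟩⟩
  have : ContractibleSpace S := (contractible_iff_id_nullhomotopic S).2 ⟨⟨a, ha⟩, e1.trans e2⟩
  exact inferInstanceAs (SimplyConnectedSpace S)

end

end Gyroid

/-! ### The pieces of the channel, their combinatorics, and the two channels -/

namespace Gyroid

noncomputable section

open Real

/-! ### The channel and its symmetries -/

/-- The channel on which the Gyroid function is larger than `w`. -/
def channel (w : ℝ) : Set (Fin 3 → ℝ) := {p | w < level p}

theorem continuous_level : Continuous level := by
  unfold level
  fun_prop

theorem isOpen_channel (w : ℝ) : IsOpen (channel w) := isOpen_lt continuous_const continuous_level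

theorem mem_bcc_iff_exists {l : Fin 3 → ℝ} : l ∈ bcc ↔ ∃ a b c : ℤ, 2 ∣ a - c ∧ 2 ∣ b - c ∧
    l 0 = a / 2 ∧ l 1 = b / 2 ∧ l 2 = c / 2 := by
  rw [mem_bcc_iff]
  constructor
  · rintro ⟨k, ⟨h0, h1⟩, h⟩
    exact ⟨k 0, k 1, k 2, h0, h1, h 0, h 1, h 2⟩
  · rintro ⟨a, b, c, h0, h1, ha, hb, hc⟩
    refine ⟨![a, b, c], ⟨h0, h1⟩, fun i => ?_⟩
    fin_cases i
    exacts [ha, hb, hc]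

/-- Shifts by multiples of `π` of equal parity change the sign of both factors in each product or of
neither. -/
theorem gy_add {x y z : ℝ} {a b c : ℤ} (h0 : 2 ∣ a - c) (h1 : 2 ∣ b - c) :
    gy (x + a * π) (y + b * π) (z + c * π) = gy x y z := by
  obtain ⟨m, hm⟩ := h0
  obtain ⟨n, hn⟩ := h1
  have ha : ((-1 : ℝ)) ^ a = (-1) ^ c := by
    rw [show a = c + 2 * m by omega, zpow_add₀ (by norm_num), zpow_mul]
    simp
  have hb : ((-1 : ℝ)) ^ b = (-1) ^ c := by
    rw [show b = c + 2 * n by omega, zpow_add₀ (by norm_num), zpow_mul]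
    simp
  have hc : ((-1 : ℝ)) ^ c * (-1) ^ c = 1 := by
    rw [← mul_zpow]
    simp
  unfold gy
  simp only [sin_add_int_mul_pi, cos_add_int_mul_pi, ha, hb]
  linear_combination (sin x * cos y + sin y * cos z + sin z * cos x) * hc

theorem level_add {l : Fin 3 → ℝ} (hl : l ∈ bcc) (p : Fin 3 → ℝ) : level (l + p) = level p := by
  obtain ⟨a, b, c, h0, h1, ha, hb, hc⟩ := mem_bcc_iff_exists.1 hl
  rw [level_eq, level_eq]
  refine Eq.trans ?_ (gy_add h0 h1)
  simp only [Pi.add_apply, ha, hb, hc]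
  congr 1 <;> ring

theorem add_mem_channel {w : ℝ} (p) (hp : p ∈ channel w) (l) (hl : l ∈ bcc) :
    l + p ∈ channel w := by
  change w < level (l + p)
  rwa [level_add hl]

/-- The rotation of order three about the diagonal. -/
def cyc : (Fin 3 → ℝ) ≃ₜ (Fin 3 → ℝ) where
  toFun p := ![p 1, p 2, p 0]
  invFun p := ![p 2, p 0, p 1]
  left_inv p := by ext i; fin_cases i <;> rfl
  right_inv p := by ext i; fin_cases i <;> rfl
  continuous_toFun := by
    refine continuous_pi fun i => ?_
    fin_cases i <;> exact continuous_apply _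
  continuous_invFun := by
    refine continuous_pi fun i => ?_
    fin_cases i <;> exact continuous_apply _

/-- A symmetry of the Gyroid function that has order two modulo the lattice. -/
def rot : (Fin 3 → ℝ) ≃ₜ (Fin 3 → ℝ) where
  toFun p := ![1 / 2 - p 0, -p 1, p 2 + 1 / 2]
  invFun p := ![1 / 2 - p 0, -p 1, p 2 - 1 / 2]
  left_inv p := by ext i; fin_cases i <;> simp
  right_inv p := by ext i; fin_cases i <;> simp
  continuous_toFun := by
    refine continuous_pi fun i => ?_
    fin_cases i <;> simp <;> fun_prop
  continuous_invFun := by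
    refine continuous_pi fun i => ?_
    fin_cases i <;> simp <;> fun_prop

theorem cyc_apply (p : Fin 3 → ℝ) : cyc p = ![p 1, p 2, p 0] := rfl

theorem rot_apply (p : Fin 3 → ℝ) : rot p = ![1 / 2 - p 0, -p 1, p 2 + 1 / 2] := rfl

theorem cyc_sub_mem (p q : Fin 3 → ℝ) : cyc q - cyc p ∈ bcc ↔ q - p ∈ bcc := by
  rw [mem_bcc_iff_exists, mem_bcc_iff_exists]
  constructor
  · rintro ⟨a, b, c, h0, h1, ha, hb, hc⟩
    exact ⟨c, a, b, by omega, by omega, hc, ha, hb⟩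
  · rintro ⟨a, b, c, h0, h1, ha, hb, hc⟩
    exact ⟨b, c, a, by omega, by omega, hb, hc, ha⟩

theorem rot_sub_mem (p q : Fin 3 → ℝ) : rot q - rot p ∈ bcc ↔ q - p ∈ bcc := by
  rw [mem_bcc_iff_exists, mem_bcc_iff_exists]
  simp only [rot_apply, Pi.sub_apply, Matrix.cons_val]
  constructor
  · rintro ⟨a, b, c, h0, h1, ha, hb, hc⟩
    refine ⟨-a, -b, c, by omega, by omega, ?_, ?_, ?_⟩ <;> push_cast <;> linarith
  · rintro ⟨a, b, c, h0, h1, ha, hb, hc⟩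
    refine ⟨-a, -b, c, by omega, by omega, ?_, ?_, ?_⟩ <;> push_cast <;> linarith

theorem level_cyc (p : Fin 3 → ℝ) : level (cyc p) = level p := by
  rw [level_eq, level_eq]
  exact gy_cyclic _ _ _

theorem level_rot (p : Fin 3 → ℝ) : level (rot p) = level p := by
  rw [level_eq, level_eq]
  refine Eq.trans ?_ (gy_rotate _ _ _)
  simp only [rot_apply, Matrix.cons_val]
  congr 1 <;> ring

theorem level_neg (p : Fin 3 → ℝ) : level (-p) = -level p := by
  rw [level_eq, level_eq, ← gy_neg]
  simp only [Pi.neg_apply]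
  congr 1 <;> ring

theorem cyc_mem_channel {w : ℝ} (p : Fin 3 → ℝ) : cyc p ∈ channel w ↔ p ∈ channel w := by
  change w < level (cyc p) ↔ w < level p
  rw [level_cyc]

theorem rot_mem_channel {w : ℝ} (p : Fin 3 → ℝ) : rot p ∈ channel w ↔ p ∈ channel w := by
  change w < level (rot p) ↔ w < level p
  rw [level_rot]

/-- The quotient of the channel by the lattice. -/
abbrev ChannelQuotient (w : ℝ) : Type := BccQuotient (channel w)

/-- The symmetry of order three of the quotient of the channel. -/
def quotientCyc (w : ℝ) : ChannelQuotient w ≃ₜ ChannelQuotient w :=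
  bccHomeomorph cyc cyc_sub_mem cyc_mem_channel

/-- The symmetry of order two of the quotient of the channel. -/
def quotientRot (w : ℝ) : ChannelQuotient w ≃ₜ ChannelQuotient w :=
  bccHomeomorph rot rot_sub_mem rot_mem_channel

theorem quotientCyc_cube (w : ℝ) (x) : quotientCyc w (quotientCyc w (quotientCyc w x)) = x := by
  obtain ⟨p, rfl⟩ := bccProj_surjective x
  refine congrArg (bccProj (channel w)) (Subtype.ext ?_)
  ext i
  fin_cases i <;> rfl

/-- In space `rot` is a screw motion, whose square is the translation by `(0, 0, 1)`; it becomes an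
involution only modulo the lattice. -/
theorem quotientRot_sq (w : ℝ) (x) : quotientRot w (quotientRot w x) = x := by
  obtain ⟨p, rfl⟩ := bccProj_surjective x
  refine bccProj_eq_iff.2 (mem_bcc_iff_exists.2 ⟨0, 0, -2, by decide, by decide, ?_, ?_, ?_⟩) <;>
    simp [rot_apply]
  ring

/-- In space the two sides differ by the lattice vector `(0, 1, -1)`. -/
theorem quotientRot_cyc_rot (w : ℝ) (x) :
    quotientRot w (quotientCyc w (quotientRot w x)) =
      quotientCyc w (quotientCyc w (quotientRot w (quotientCyc w (quotientCyc w x)))) := by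
  obtain ⟨p, rfl⟩ := bccProj_surjective x
  refine bccProj_eq_iff.2 (mem_bcc_iff_exists.2 ⟨0, 2, -2, by decide, by decide, ?_, ?_, ?_⟩) <;>
    simp [rot_apply, cyc_apply] <;> ring

/-! ### The prism around a vertex -/

/-- The infinite prism around the diagonal through a vertex. -/
def prism : Set (Fin 3 → ℝ) :=
  {p | -(1 / 4) < p 0 - p 1 ∧ -(1 / 4) < p 1 - p 2 ∧ -(1 / 4) < p 2 - p 0}

theorem isOpen_prism : IsOpen prism := by
  have h : ∀ i j : Fin 3, IsOpen {p : Fin 3 → ℝ | -(1 / 4) < p i - p j} := fun i j =>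
    isOpen_lt continuous_const (by fun_prop)
  exact (h 0 1).inter ((h 1 2).inter (h 2 0))

theorem inPrism_of_mem_prism {p : Fin 3 → ℝ} (hp : p ∈ prism) :
    InPrism (2 * π * (p 0 - p 1)) (2 * π * (p 1 - p 2)) (2 * π * (p 2 - p 0)) := by
  obtain ⟨h0, h1, h2⟩ := hp
  have hπ := pi_pos
  refine ⟨by ring, ?_, ?_, ?_⟩ <;> nlinarith

/-- The mean of the coordinates. -/
def mean (p : Fin 3 → ℝ) : ℝ := (p 0 + p 1 + p 2) / 3

/-- The sum of the exponentials of the deviations of the coordinates from their mean. -/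
def expSum (p : Fin 3 → ℝ) : ℂ :=
  (∑ i, cos (2 * π * (p i - mean p)) : ℝ) + (∑ i, sin (2 * π * (p i - mean p)) : ℝ) * Complex.I

theorem expSum_re (p : Fin 3 → ℝ) : (expSum p).re = ∑ i, cos (2 * π * (p i - mean p)) := by
  unfold expSum
  rw [Complex.add_re, Complex.ofReal_re, Complex.re_ofReal_mul]
  simp

theorem expSum_im (p : Fin 3 → ℝ) : (expSum p).im = ∑ i, sin (2 * π * (p i - mean p)) := by
  unfold expSum
  rw [Complex.add_im, Complex.ofReal_im, Complex.im_ofReal_mul]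
  simp

theorem continuous_expSum : Continuous expSum := by
  unfold expSum mean
  fun_prop

/-- In the prism every coordinate differs from the mean by less than a quarter, so all three cosines
are positive. Hence the argument of the sum is continuous there. -/
theorem expSum_re_pos {p : Fin 3 → ℝ} (hp : p ∈ prism) : 0 < (expSum p).re := by
  obtain ⟨h0, h1, h2⟩ := hp
  have hπ := pi_pos
  rw [expSum_re]
  refine Finset.sum_pos (fun i _ => ?_) Finset.univ_nonempty
  have h : |p i - mean p| < 1 / 4 := by
    unfold mean
    rw [abs_lt]
    fin_cases i <;> simp only [Fin.zero_eta, Fin.mk_one, Fin.reduceFinMk] <;>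
      constructor <;> linarith
  rw [abs_lt] at h
  exact cos_pos_of_mem_Ioo ⟨by nlinarith, by nlinarith⟩

/-- The position of the maximum of the Gyroid function on the diagonal through a point. -/
def phase (p : Fin 3 → ℝ) : ℝ := (expSum p).arg

theorem continuousOn_phase : ContinuousOn phase prism := by
  intro p hp
  have h : expSum p ∈ Complex.slitPlane := .inl (expSum_re_pos hp)
  exact (Complex.continuousAt_arg h).comp_continuousWithinAt
    continuous_expSum.continuousWithinAt

/-- The angle between a point and the maximum of the Gyroid function on the diagonal through it. -/
def deviation (p : Fin 3 → ℝ) : ℝ := 4 * π * mean p - phase p - π / 2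

theorem continuousOn_deviation : ContinuousOn deviation prism := by
  refine ((Continuous.continuousOn ?_).sub continuousOn_phase).sub continuousOn_const
  unfold mean
  fun_prop

theorem norm_expSum (p : Fin 3 → ℝ) : ‖expSum p‖ =
    amp (2 * π * (p 0 - p 1)) (2 * π * (p 1 - p 2)) (2 * π * (p 2 - p 0)) := by
  rw [Complex.norm_eq_sqrt_sq_add_sq, amp, expSum_re, expSum_im, Fin.sum_univ_three,
    Fin.sum_univ_three]
  congr 1
  set A := 2 * π * (p 0 - mean p)
  set B := 2 * π * (p 1 - mean p)
  set D := 2 * π * (p 2 - mean p)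
  rw [show 2 * π * (p 0 - p 1) = A - B by simp only [A, B]; ring,
    show 2 * π * (p 1 - p 2) = B - D by simp only [D, B]; ring,
    show 2 * π * (p 2 - p 0) = D - A by simp only [A, D]; ring, cos_sub, cos_sub, cos_sub]
  linear_combination sin_sq_add_cos_sq A + sin_sq_add_cos_sq B + sin_sq_add_cos_sq D

/-- Along a diagonal the sines of differences are constant and form the offset. The angle of a sum
of two coordinates is `4π` times the mean minus the angle of the deviation of the third, so the
other three sines combine into one oscillation with amplitude `‖expSum p‖`. -/
theorem two_mul_level (p : Fin 3 → ℝ) : 2 * level p =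
    amp (2 * π * (p 0 - p 1)) (2 * π * (p 1 - p 2)) (2 * π * (p 2 - p 0)) * cos (deviation p) +
    offset (2 * π * (p 0 - p 1)) (2 * π * (p 1 - p 2)) (2 * π * (p 2 - p 0)) := by
  have h1 : cos (deviation p) = sin (4 * π * mean p - phase p) := by
    rw [deviation, cos_sub_pi_div_two]
  have h2 : ‖expSum p‖ * cos (phase p) = (expSum p).re := Complex.norm_mul_cos_arg _
  have h3 : ‖expSum p‖ * sin (phase p) = (expSum p).im := Complex.norm_mul_sin_arg _
  rw [expSum_re, Fin.sum_univ_three] at h2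
  rw [expSum_im, Fin.sum_univ_three] at h3
  rw [h1, ← norm_expSum, sin_sub, level_eq, two_mul_gy, offset]
  have h4 : ∀ i j k, mean p = (p i + p j + p k) / 3 → sin (2 * π * p i + 2 * π * p j) =
      sin (4 * π * mean p) * cos (2 * π * (p k - mean p)) -
        cos (4 * π * mean p) * sin (2 * π * (p k - mean p)) := by
    intro i j k h
    rw [← sin_sub]
    congr 1
    linear_combination (-6 * π) * h
  rw [h4 0 1 2 rfl, h4 1 2 0 (by rw [mean]; ring), h4 2 0 1 (by rw [mean]; ring), ← mul_sub,
    ← mul_sub, ← mul_sub]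
  linear_combination (-sin (4 * π * mean p)) * h2 + cos (4 * π * mean p) * h3

/-- The point on the diagonal through a point that has a given deviation. -/
def slide (p : Fin 3 → ℝ) (t : ℝ) : Fin 3 → ℝ :=
  fun i => p i - mean p + (t + phase p + π / 2) / (4 * π)

theorem slide_sub (p : Fin 3 → ℝ) (t : ℝ) (i j : Fin 3) :
    slide p t i - slide p t j = p i - p j := by
  unfold slide
  ring

theorem mean_slide (p : Fin 3 → ℝ) (t : ℝ) :
    mean (slide p t) = (t + phase p + π / 2) / (4 * π) := by
  unfold slide
  simp only [mean]
  ring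

theorem expSum_slide (p : Fin 3 → ℝ) (t : ℝ) : expSum (slide p t) = expSum p := by
  unfold expSum
  rw [mean_slide]
  simp only [slide, add_sub_cancel_right]

theorem phase_slide (p : Fin 3 → ℝ) (t : ℝ) : phase (slide p t) = phase p := by
  rw [phase, expSum_slide, phase]

theorem deviation_slide (p : Fin 3 → ℝ) (t : ℝ) : deviation (slide p t) = t := by
  have := pi_pos
  rw [deviation, mean_slide, phase_slide]
  field_simp
  ring

theorem slide_deviation (p : Fin 3 → ℝ) : slide p (deviation p) = p := by
  have := pi_pos
  ext i
  unfold slide deviation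
  field_simp
  ring

theorem slide_mem_prism {p : Fin 3 → ℝ} {t : ℝ} : slide p t ∈ prism ↔ p ∈ prism := by
  change _ ∧ _ ∧ _ ↔ _ ∧ _ ∧ _
  simp only [slide_sub]

theorem two_mul_level_slide (p : Fin 3 → ℝ) (t : ℝ) : 2 * level (slide p t) =
    amp (2 * π * (p 0 - p 1)) (2 * π * (p 1 - p 2)) (2 * π * (p 2 - p 0)) * cos t +
    offset (2 * π * (p 0 - p 1)) (2 * π * (p 1 - p 2)) (2 * π * (p 2 - p 0)) := by
  rw [two_mul_level, deviation_slide]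
  simp only [slide_sub]

theorem continuousOn_slide {Y : Type} [TopologicalSpace Y] {s : Set Y} {f : Y → Fin 3 → ℝ}
    {g : Y → ℝ} (hf : ContinuousOn f s) (hg : ContinuousOn g s) (hfs : ∀ y ∈ s, f y ∈ prism) :
    ContinuousOn (fun y => slide (f y) (g y)) s := by
  refine continuousOn_pi.2 fun i => ?_
  have h : ∀ j, ContinuousOn (fun y => f y j) s := fun j => continuousOn_pi.1 hf j
  refine ((h i).sub ?_).add (((hg.add (continuousOn_phase.comp hf hfs)).add
    continuousOn_const).div_const _)
  exact (((h 0).add (h 1)).add (h 2)).div_const 3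

/-- The part of the prism around one vertex. -/
def cell : Set (Fin 3 → ℝ) := {p | p ∈ prism ∧ |deviation p| < π}

theorem isOpen_cell : IsOpen cell :=
  (continuous_abs.comp_continuousOn continuousOn_deviation).isOpen_inter_preimage isOpen_prism
    isOpen_Iio

theorem smul_mem_prism {p : Fin 3 → ℝ} (hp : p ∈ prism) {s : ℝ} (hs : s ∈ Set.Icc (0 : ℝ) 1) :
    s • p ∈ prism := by
  obtain ⟨h0, h1, h2⟩ := hp
  obtain ⟨s0, s1⟩ := hs
  refine ⟨?_, ?_, ?_⟩ <;> simp only [Pi.smul_apply, smul_eq_mul, ← mul_sub] <;> nlinarith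

theorem zero_mem_prism : (0 : Fin 3 → ℝ) ∈ prism := by
  refine ⟨?_, ?_, ?_⟩ <;> norm_num

/-- The vertex inside the cell. -/
def center : Fin 3 → ℝ := slide 0 0

/-- At the vertex the amplitude is `3` and the offset `0`, so the level is `3/2`, which exceeds
`√2`. -/
theorem center_mem {w : ℝ} (hw : w < √2) : center ∈ channel w ∩ cell := by
  obtain ⟨-, q⟩ := sqrt_two_bounds
  refine ⟨?_, slide_mem_prism.2 zero_mem_prism, ?_⟩
  · change w < level (slide 0 0)
    have h := two_mul_level_slide 0 0
    simp only [Pi.zero_apply, sub_zero, mul_zero, amp, offset, cos_zero, sin_zero] at h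
    rw [show (3 : ℝ) + 2 * (1 + 1 + 1) = 3 ^ 2 by norm_num, sqrt_sq (by norm_num)] at h
    linarith
  · change |deviation (slide 0 0)| < π
    rw [deviation_slide, abs_zero]
    exact pi_pos

/-- Each point is moved along its diagonal to the maximum there, where the cosine in `two_mul_level`
grows. Then the differences of the coordinates are scaled to zero while the point stays at the
maximum of its diagonal, and this maximum grows by `amp_add_offset_le_scale`. -/
theorem isSimplyConnected_cell {w : ℝ} (hw : w < √2) : IsSimplyConnected (channel w ∩ cell) := by
  have hflip : ∀ {s : ℝ}, s ∈ Set.Icc (0 : ℝ) 1 → 1 - s ∈ Set.Icc (0 : ℝ) 1 := fun h =>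
    ⟨by linarith [h.2], by linarith [h.1]⟩
  refine isSimplyConnected_of_two_homotopies (center_mem hw)
    (H := fun s p => slide p ((1 - s) * deviation p)) (K := fun s p => slide ((1 - s) • p) 0)
    ?_ ?_ ?_ ?_ ?_ ?_ ?_
  · refine continuousOn_slide continuousOn_snd ?_ fun y hy => hy.2.2.1
    exact (by fun_prop : ContinuousOn (fun y : ℝ × (Fin 3 → ℝ) => 1 - y.1) _).mul
      (continuousOn_deviation.comp continuousOn_snd fun y hy => hy.2.2.1)
  · exact continuousOn_slide (by fun_prop) continuousOn_const fun y hy =>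
      smul_mem_prism hy.2.2.1 (hflip hy.1)
  · rintro s hs p ⟨hp, hp', hd⟩
    refine ⟨?_, slide_mem_prism.2 hp', ?_⟩
    · change w < level _
      change w < level p at hp
      have h1 := two_mul_level p
      have h2 := two_mul_level_slide p ((1 - s) * deviation p)
      have h3 := cos_mono_scale hd.le (hflip hs)
      have h4 : 0 ≤ amp (2 * π * (p 0 - p 1)) (2 * π * (p 1 - p 2)) (2 * π * (p 2 - p 0)) :=
        sqrt_nonneg _
      have h5 := mul_le_mul_of_nonneg_left h3 h4
      linarith
    · rw [deviation_slide, abs_mul, abs_of_nonneg (hflip hs).1]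
      exact (mul_le_of_le_one_left (abs_nonneg _) (hflip hs).2).trans_lt hd
  · rintro s hs p ⟨hp, hp', hd⟩
    refine ⟨?_, slide_mem_prism.2 (smul_mem_prism hp' (hflip hs)), ?_⟩
    · change w < level _
      change w < level p at hp
      have h1 := two_mul_level p
      have h2 := two_mul_level_slide ((1 - s) • p) 0
      have h3 := amp_add_offset_le_scale (inPrism_of_mem_prism hp') (hflip hs)
      have h4 : 0 ≤ amp (2 * π * (p 0 - p 1)) (2 * π * (p 1 - p 2)) (2 * π * (p 2 - p 0)) :=
        sqrt_nonneg _
      have h5 := mul_le_of_le_one_right h4 (cos_le_one (deviation p))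
      simp only [Pi.smul_apply, smul_eq_mul, ← mul_sub, cos_zero, mul_one] at h2
      simp only [mul_left_comm (1 - s)] at h3
      linarith
    · rw [deviation_slide, abs_zero]
      exact pi_pos
  · intro p hp
    simp only [sub_zero, one_mul]
    exact slide_deviation p
  · intro p hp
    simp
  · intro p hp
    simp [center]

end

end Gyroid

namespace Gyroid

noncomputable section

open Real

/-! ### The set of a vertex -/

theorem add_const_mem_prism {p : Fin 3 → ℝ} (hp : p ∈ prism) (t : ℝ) : (fun _ => t) + p ∈ prism := by
  obtain ⟨h0, h1, h2⟩ := hp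
  refine ⟨?_, ?_, ?_⟩ <;> simp only [Pi.add_apply, add_sub_add_left_eq_sub] <;> assumption

theorem deviation_add_const (p : Fin 3 → ℝ) (t : ℝ) :
    deviation ((fun _ => t) + p) = deviation p + 4 * π * t := by
  have h1 : mean ((fun _ => t) + p) = t + mean p := by
    simp only [mean, Pi.add_apply]
    ring
  have h2 : phase ((fun _ => t) + p) = phase p := by
    unfold phase expSum
    simp only [h1, Pi.add_apply, add_sub_add_left_eq_sub]
  rw [deviation, h1, h2, deviation]
  ring

theorem diagonal_mem_bcc (n : ℤ) : (fun _ => (n : ℝ) / 2 : Fin 3 → ℝ) ∈ bcc :=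
  mem_bcc_iff_exists.2 ⟨n, n, n, by simp, by simp, rfl, rfl, rfl⟩

/-- Every number is congruent to one of absolute value at most a half. -/
theorem exists_abs_add_int_le (t : ℝ) : ∃ n : ℤ, |t + n| ≤ 1 / 2 :=
  ⟨-round t, by
    have := abs_sub_round t
    push_cast
    rwa [← sub_eq_add_neg]⟩

/-- The diagonal translation by `n/2` changes the deviation by `2πn`, so it can be brought into
`[-π, π]`. The ends are excluded, as the function is negative there by `offset_lt_amp`. -/
theorem exists_add_mem_cell {w : ℝ} (hw : 0 ≤ w) {p : Fin 3 → ℝ} (hp : p ∈ channel w)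
    (hp' : p ∈ prism) : ∃ l ∈ bcc, l + p ∈ cell := by
  have hπ := pi_pos
  obtain ⟨n, hn⟩ := exists_abs_add_int_le (deviation p / (2 * π))
  set q : Fin 3 → ℝ := (fun _ => (n : ℝ) / 2) + p with hq
  have hqp : q ∈ prism := add_const_mem_prism hp' _
  have hqc : q ∈ channel w := add_mem_channel _ hp _ (diagonal_mem_bcc n)
  have hd : deviation q = 2 * π * (deviation p / (2 * π) + n) := by
    rw [hq, deviation_add_const]
    field_simp
    ring
  have h1 : |deviation q| ≤ π := by
    rw [hd, abs_mul, abs_of_pos (by positivity)]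
    nlinarith
  refine ⟨_, diagonal_mem_bcc n, hqp, lt_of_le_of_ne h1 fun h2 => ?_⟩
  have h3 := two_mul_level q
  rw [← cos_abs (deviation q), h2, cos_pi] at h3
  have h4 := offset_lt_amp (inPrism_of_mem_prism hqp)
  change w < level q at hqc
  linarith

/-- Coordinate differences in the prism are too restricted for a lattice vector off the diagonal. A
diagonal one changes the deviation by a multiple of `2π`, which must be zero as both deviations are
below `π` in absolute value. -/
theorem mem_cell_inj {w : ℝ} (p) (hp : p ∈ channel w ∩ cell) (q) (hq : q ∈ channel w ∩ cell)
    (h : q - p ∈ bcc) : p = q := by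
  have hπ := pi_pos
  obtain ⟨-, ⟨p0, p1, p2⟩, hp⟩ := hp
  obtain ⟨-, ⟨q0, q1, q2⟩, hq⟩ := hq
  obtain ⟨a, b, c, ⟨m, hm⟩, ⟨n, hn⟩, ha, hb, hc⟩ := mem_bcc_iff_exists.1 h
  simp only [Pi.sub_apply] at ha hb hc
  have ha' : (a : ℝ) = c + 2 * m := by rw [show a = c + 2 * m by omega]; push_cast; ring
  have hb' : (b : ℝ) = c + 2 * n := by rw [show b = c + 2 * n by omega]; push_cast; ring
  have bound : ∀ k : ℤ, (k : ℝ) < 1 → -1 < (k : ℝ) → k = 0 := by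
    intro k h1 h2
    have h1' : k < 1 := by exact_mod_cast h1
    have h2' : -1 < k := by exact_mod_cast h2
    omega
  have hm0 : m = 0 := bound m (by linarith) (by linarith)
  have hn0 : n = 0 := bound n (by linarith) (by linarith)
  subst hm0 hn0
  have hpq : q = (fun _ => (c : ℝ) / 2) + p := by
    ext i
    fin_cases i <;> simp <;> push_cast at ha' hb' <;> linarith
  have hd := deviation_add_const p ((c : ℝ) / 2)
  rw [← hpq] at hd
  rw [abs_lt] at hp hq
  have hc0 : c = 0 := bound c (by nlinarith) (by nlinarith)
  rw [hpq, hc0]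
  ext i
  simp

/-- The set of the base vertex in the quotient of the channel. -/
def vertexRegion (w : ℝ) : Set (ChannelQuotient w) := bccImage (channel w) prism

/-- The prism exhibits the cyclic symmetry and the separation of vertices; the cell is the part of
it that projects injectively. -/
theorem vertexRegion_eq {w : ℝ} (hw : 0 ≤ w) : vertexRegion w = bccImage (channel w) cell := by
  apply Set.Subset.antisymm
  · rintro _ ⟨p, hp, rfl⟩
    exact (mem_bccImage add_mem_channel p).2 (exists_add_mem_cell hw p.2 hp)
  · exact Set.image_mono fun p hp => hp.1

theorem isSimplyConnected_vertexRegion {w : ℝ} (hw : 0 ≤ w) (hw' : w < √2) :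
    IsSimplyConnected (vertexRegion w) := by
  rw [vertexRegion_eq hw]
  exact isSimplyConnected_bccImage add_mem_channel isOpen_cell mem_cell_inj
    (isSimplyConnected_cell hw')

theorem isOpen_vertexRegion (w : ℝ) : IsOpen (vertexRegion w) :=
  isOpen_bccImage add_mem_channel isOpen_prism

theorem cyc_mem_vertexRegion {w : ℝ} (x) : quotientCyc w x ∈ vertexRegion w ↔ x ∈ vertexRegion w := by
  have h : ∀ x ∈ vertexRegion w, quotientCyc w x ∈ vertexRegion w := by
    rintro _ ⟨p, ⟨h0, h1, h2⟩, rfl⟩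
    exact ⟨⟨cyc p, (cyc_mem_channel _).2 p.2⟩, ⟨h1, h2, h0⟩, rfl⟩
  refine ⟨fun hx => ?_, h x⟩
  rw [← quotientCyc_cube w x]
  exact h _ (h _ hx)

/-- A common point would satisfy the inequalities of two prisms at once, where the Gyroid function
is not positive. The integers passed to `gy_nonpos_of_prisms` are half-differences of the doubled
coordinates of the lattice vector. -/
theorem rot_notMem_vertexRegion {w : ℝ} (hw : 0 ≤ w) (x) (hx : x ∈ vertexRegion w) :
    quotientRot w x ∉ vertexRegion w := by
  obtain ⟨p, ⟨h0, h1, h2⟩, rfl⟩ := hx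
  intro h
  obtain ⟨l, hl, k0, k1, k2⟩ := (mem_bccImage add_mem_channel _).1 h
  obtain ⟨a, b, c, ⟨m, hm⟩, ⟨n, hn⟩, ha, hb, hc⟩ := mem_bcc_iff_exists.1 hl
  have hπ := pi_pos
  have ha' : (a : ℝ) = c + 2 * m := by rw [show a = c + 2 * m by omega]; push_cast; ring
  have hb' : (b : ℝ) = c + 2 * n := by rw [show b = c + 2 * n by omega]; push_cast; ring
  simp only [rot_apply, Pi.add_apply, Matrix.cons_val, ha, hb, hc] at k0 k1 k2
  have hp : w < level p := p.2
  rw [level_eq] at hp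
  have := gy_nonpos_of_prisms (x := 2 * π * p.1 0) (y := 2 * π * p.1 1) (z := 2 * π * p.1 2)
    (l := m - n) (m := n) (n := -m) (by nlinarith) (by nlinarith) (by nlinarith) (by ring)
    (by push_cast; nlinarith) (by nlinarith) (by push_cast; nlinarith)
  linarith

/-! ### The set of an edge -/

/-- The point with given coordinates along and transversal to the base edge. -/
def boxPoint (u c t : ℝ) : Fin 3 → ℝ := ![u - t, 1 / 4 + u + t, 1 / 8 + c]

/-- The first transversal coordinate. -/
def boxU (p : Fin 3 → ℝ) : ℝ := (p 0 + p 1 - 1 / 4) / 2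

/-- The second transversal coordinate. -/
def boxC (p : Fin 3 → ℝ) : ℝ := p 2 - 1 / 8

/-- The coordinate along the edge. -/
def boxT (p : Fin 3 → ℝ) : ℝ := (p 1 - p 0 - 1 / 4) / 2

theorem boxPoint_eq (p : Fin 3 → ℝ) : boxPoint (boxU p) (boxC p) (boxT p) = p := by
  unfold boxPoint boxU boxC boxT
  ext i
  fin_cases i <;> simp <;> ring

theorem boxU_boxPoint (u c t : ℝ) : boxU (boxPoint u c t) = u := by
  simp [boxU, boxPoint]
  ring

theorem boxC_boxPoint (u c t : ℝ) : boxC (boxPoint u c t) = c := by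
  simp [boxC, boxPoint]

theorem boxT_boxPoint (u c t : ℝ) : boxT (boxPoint u c t) = t := by
  simp [boxT, boxPoint]
  ring

theorem level_boxPoint (u c t : ℝ) : level (boxPoint u c t) =
    gy (2 * π * u - 2 * π * t) (π / 2 + 2 * π * u + 2 * π * t) (π / 4 + 2 * π * c) := by
  rw [level_eq]
  simp only [boxPoint, Matrix.cons_val]
  congr 1 <;> ring

theorem continuous_boxPoint {Y : Type} [TopologicalSpace Y] {u c t : Y → ℝ} (hu : Continuous u)
    (hc : Continuous c) (ht : Continuous t) : Continuous fun y => boxPoint (u y) (c y) (t y) := by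
  refine continuous_pi fun i => ?_
  fin_cases i <;> simp [boxPoint] <;> fun_prop

/-- A box around the middle of the base edge. -/
def box : Set (Fin 3 → ℝ) := {p | |boxU p| < 1 / 4 ∧ |boxC p| < 1 / 4 ∧ |boxT p| < 1 / 130}

/-- The part of a box with a restricted coordinate along the edge. -/
def boxPart (J : Set ℝ) : Set (Fin 3 → ℝ) := {p | p ∈ box ∧ boxT p ∈ J}

theorem continuous_boxU : Continuous boxU := by
  unfold boxU
  fun_prop

theorem continuous_boxC : Continuous boxC := by
  unfold boxC
  fun_prop

theorem continuous_boxT : Continuous boxT := by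
  unfold boxT
  fun_prop

theorem isOpen_box : IsOpen box := by
  refine IsOpen.inter ?_ (IsOpen.inter ?_ ?_)
  · exact isOpen_lt continuous_boxU.abs continuous_const
  · exact isOpen_lt continuous_boxC.abs continuous_const
  · exact isOpen_lt continuous_boxT.abs continuous_const

theorem isOpen_boxPart {J : Set ℝ} (hJ : IsOpen J) : IsOpen (boxPart J) :=
  isOpen_box.inter (hJ.preimage continuous_boxT)

theorem abs_two_pi_mul_le {t a b : ℝ} (h : |t| < a) (hb : 2 * π * a ≤ b) : |2 * π * t| ≤ b := by
  have hπ := pi_pos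
  rw [abs_mul, abs_of_pos (by positivity)]
  nlinarith

/-- The half-length `1/130` of the box is chosen for this bound: an angle of at most `1/20` makes
the cosine of its double at least `0.995`, the constant in the separation of edges. -/
theorem two_pi_div_le : 2 * π * (1 / 130) ≤ 1 / 20 := by
  have := pi_lt_d2
  linarith

/-- The transversal coordinates are scaled to zero, which does not decrease the function; then the
axis, which lies in the channel since `w < √2`, is contracted. The set `J` allows for the whole box
and for one half of it. -/
theorem isSimplyConnected_boxPart {w : ℝ} (hw : w < √2) {J : Set ℝ} (hJ : Convex ℝ J) {t₀ : ℝ}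
    (h0 : t₀ ∈ J) (h0' : |t₀| < 1 / 130) : IsSimplyConnected (channel w ∩ boxPart J) := by
  have hπ := pi_gt_three
  have h20 := two_pi_div_le
  have hflip : ∀ {s : ℝ}, s ∈ Set.Icc (0 : ℝ) 1 → 1 - s ∈ Set.Icc (0 : ℝ) 1 := fun h =>
    ⟨by linarith [h.2], by linarith [h.1]⟩
  have haxis : ∀ t ∈ J, |t| < 1 / 130 → boxPoint 0 0 t ∈ channel w ∩ boxPart J := by
    intro t ht ht'
    refine ⟨?_, ⟨?_, ?_, ?_⟩, ?_⟩
    · change w < level _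
      rw [level_boxPoint]
      have := sqrt_two_le_gy_axis (t := 2 * π * t)
        ((abs_two_pi_mul_le ht' h20).trans (by linarith))
      simp only [mul_zero, zero_sub, add_zero]
      linarith
    · rw [boxU_boxPoint]
      norm_num
    · rw [boxC_boxPoint]
      norm_num
    · rwa [boxT_boxPoint]
    · rwa [boxT_boxPoint]
  refine isSimplyConnected_of_two_homotopies (haxis t₀ h0 h0')
    (H := fun s p => boxPoint ((1 - s) * boxU p) ((1 - s) * boxC p) (boxT p))
    (K := fun s p => boxPoint 0 0 ((1 - s) * boxT p + s * t₀)) ?_ ?_ ?_ ?_ ?_ ?_ ?_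
  · refine Continuous.continuousOn (continuous_boxPoint ?_ ?_ ?_) <;>
      simp only [boxU, boxC, boxT] <;> fun_prop
  · refine Continuous.continuousOn (continuous_boxPoint continuous_const continuous_const ?_)
    simp only [boxT]
    fun_prop
  · rintro s hs p ⟨hp, ⟨h1, h2, h3⟩, h4⟩
    have habs : ∀ v : ℝ, |v| < 1 / 4 → |(1 - s) * v| < 1 / 4 := fun v hv => by
      rw [abs_mul, abs_of_nonneg (hflip hs).1]
      exact (mul_le_of_le_one_left (abs_nonneg _) (hflip hs).2).trans_lt hv
    refine ⟨?_, ⟨?_, ?_, ?_⟩, ?_⟩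
    · change w < level _
      change w < level p at hp
      rw [← boxPoint_eq p, level_boxPoint] at hp
      rw [level_boxPoint, mul_left_comm (2 * π), mul_left_comm (2 * π)]
      exact hp.trans_le (gy_box_le_scale (abs_two_pi_mul_le h1 (by linarith))
        (abs_two_pi_mul_le h2 (by linarith)) ((abs_two_pi_mul_le h3 h20).trans (by linarith))
        (hflip hs))
    · rw [boxU_boxPoint]
      exact habs _ h1
    · rw [boxC_boxPoint]
      exact habs _ h2
    · rwa [boxT_boxPoint]
    · rwa [boxT_boxPoint]
  · rintro s hs p ⟨hp, ⟨h1, h2, h3⟩, h4⟩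
    refine haxis _ ?_ ?_
    · exact hJ h4 h0 (hflip hs).1 hs.1 (by ring)
    · rw [abs_lt] at h3 h0' ⊢
      have h5 := (convex_Ioo (-(1 / 130 : ℝ)) (1 / 130)) h3 h0' (hflip hs).1 hs.1 (by ring)
      exact h5
  · intro p hp
    simp only [sub_zero, one_mul]
    exact boxPoint_eq p
  · intro p hp
    simp
  · intro p hp
    simp

/-- The size of the box leaves only doubled coordinates with `|a + b|`, `|a - b|` and `|c|` below
`2`; equal parity then forces them to vanish. -/
theorem mem_box_inj {w : ℝ} (p) (hp : p ∈ channel w ∩ box) (q) (hq : q ∈ channel w ∩ box)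
    (h : q - p ∈ bcc) : p = q := by
  obtain ⟨-, hp0, hp1, hp2⟩ := hp
  obtain ⟨-, hq0, hq1, hq2⟩ := hq
  rw [abs_lt] at hp0 hp1 hp2 hq0 hq1 hq2
  unfold boxU at hp0 hq0
  unfold boxC at hp1 hq1
  unfold boxT at hp2 hq2
  obtain ⟨a, b, c, ⟨m, hm⟩, ⟨n, hn⟩, ha, hb, hc⟩ := mem_bcc_iff_exists.1 h
  simp only [Pi.sub_apply] at ha hb hc
  have bound : ∀ k : ℤ, (k : ℝ) < 2 → -2 < (k : ℝ) → k < 2 ∧ -2 < k := by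
    intro k h1 h2
    exact ⟨by exact_mod_cast h1, by exact_mod_cast h2⟩
  obtain ⟨k1, k2⟩ := bound (a + b) (by push_cast; linarith) (by push_cast; linarith)
  obtain ⟨k3, k4⟩ := bound (a - b) (by push_cast; linarith) (by push_cast; linarith)
  obtain ⟨k5, k6⟩ := bound c (by linarith) (by linarith)
  have hab : a = 0 ∧ b = 0 ∧ c = 0 := by omega
  obtain ⟨rfl, rfl, rfl⟩ := hab
  simp only [Int.cast_zero, zero_div] at ha hb hc
  ext i
  fin_cases i <;> simp <;> linarith

/-- The set of the base edge in the quotient of the channel. -/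
def edgeRegion (w : ℝ) : Set (ChannelQuotient w) := bccImage (channel w) box

theorem isOpen_edgeRegion (w : ℝ) : IsOpen (edgeRegion w) :=
  isOpen_bccImage add_mem_channel isOpen_box

theorem boxPart_univ : boxPart Set.univ = box := by
  ext p
  exact and_iff_left trivial

theorem isSimplyConnected_edgeRegion {w : ℝ} (hw : w < √2) : IsSimplyConnected (edgeRegion w) := by
  have h := isSimplyConnected_boxPart hw convex_univ (Set.mem_univ 0) (by norm_num)
  rw [boxPart_univ] at h
  exact isSimplyConnected_bccImage add_mem_channel isOpen_box mem_box_inj h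

/-- Followed by the lattice translation `(-1/2, 1/2, -1/2)`, the symmetry becomes a half-turn of the
box that replaces `(u, c, t)` by `(-u, c, -t)`. -/
theorem rot_mem_edgeRegion {w : ℝ} (x) : quotientRot w x ∈ edgeRegion w ↔ x ∈ edgeRegion w := by
  have h : ∀ x ∈ edgeRegion w, quotientRot w x ∈ edgeRegion w := by
    rintro _ ⟨p, ⟨h0, h1, h2⟩, rfl⟩
    refine (mem_bccImage add_mem_channel _).2 ⟨![-(1 / 2), 1 / 2, -(1 / 2)],
      mem_bcc_iff_exists.2 ⟨-1, 1, -1, by decide, by decide, ?_, ?_, ?_⟩, ?_⟩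
    · simp; norm_num
    · simp
    · simp; norm_num
    · rw [abs_lt] at h0 h1 h2
      unfold boxU at h0
      unfold boxC at h1
      unfold boxT at h2
      refine ⟨?_, ?_, ?_⟩ <;>
        simp only [boxU, boxC, boxT, rot_apply, Pi.add_apply, Matrix.cons_val, abs_lt] <;>
        constructor <;> linarith
  refine ⟨fun hx => ?_, h x⟩
  rw [← quotientRot_sq w x]
  exact h _ hx

/-- In box coordinates the prism is given by `t < 0` and `|c - u| < 3/8 + t`. The two halves of the
second condition follow from `sub_lt_of_gy_box_pos`, since `gy_box` is invariant under changing the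
signs of `u` and `c`. -/
theorem mem_prism_of_boxPart {w : ℝ} (hw : 0 ≤ w) {p : Fin 3 → ℝ} (hp : p ∈ channel w)
    (hp' : p ∈ boxPart (Set.Iio 0)) : p ∈ prism := by
  obtain ⟨⟨h0, h1, h2⟩, h3⟩ := hp'
  have hπ := pi_gt_three
  change boxT p < 0 at h3
  change w < level p at hp
  rw [← boxPoint_eq p, level_boxPoint] at hp
  have hu := abs_two_pi_mul_le h0 (b := π / 2) (by linarith)
  have hc := abs_two_pi_mul_le h1 (b := π / 2) (by linarith)
  have ht := (abs_le.1 (abs_two_pi_mul_le h2 two_pi_div_le)).1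
  have ht' : 2 * π * boxT p ≤ 0 := mul_nonpos_of_nonneg_of_nonpos (by linarith) h3.le
  have k1 := sub_lt_of_gy_box_pos hu hc ht' ht (by linarith)
  have k2 := sub_lt_of_gy_box_pos (u := -(2 * π * boxU p)) (c := -(2 * π * boxC p))
    (by rwa [abs_neg]) (by rwa [abs_neg]) ht' ht (by
      rw [gy_box] at hp ⊢
      simp only [sin_neg, cos_neg] at hp ⊢
      linarith)
  have k1' : boxC p - boxU p < 3 / 8 + boxT p := by nlinarith
  have k2' : boxU p - boxC p < 3 / 8 + boxT p := by nlinarith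
  unfold boxU boxC boxT at *
  exact ⟨by linarith, by linarith, by linarith⟩

/-- A point on the middle section `t = 0` is a limit of points with `t < 0`, which still lie in the
open channel and box. -/
theorem mem_closure_vertexRegion {w : ℝ} (hw : 0 ≤ w) (p : channel w) (hp : p.1 ∈ box)
    (ht : boxT p ≤ 0) : bccProj (channel w) p ∈ closure (vertexRegion w) := by
  have h1 : p.1 ∈ closure (channel w ∩ boxPart (Set.Iio 0)) := by
    have hcont : Continuous fun s => boxPoint (boxU p) (boxC p) (boxT p + s) :=
      continuous_boxPoint continuous_const continuous_const (by fun_prop)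
    have h2 : boxPoint (boxU p) (boxC p) (boxT p + 0) = p.1 := by
      rw [add_zero, boxPoint_eq]
    refine mem_closure_of_tendsto (b := nhdsWithin (0 : ℝ) (Set.Iio 0))
      (f := fun s => boxPoint (boxU p) (boxC p) (boxT p + s)) ?_ ?_
    · have := (hcont.tendsto 0).mono_left (nhdsWithin_le_nhds (s := Set.Iio 0))
      rwa [h2] at this
    · have h3 : ∀ᶠ s in nhdsWithin (0 : ℝ) (Set.Iio 0),
          boxPoint (boxU p) (boxC p) (boxT p + s) ∈ channel w ∩ box := by
        refine nhdsWithin_le_nhds (hcont.continuousAt.eventually_mem ?_)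
        rw [h2]
        exact ((isOpen_channel w).inter isOpen_box).mem_nhds ⟨p.2, hp⟩
      filter_upwards [h3, self_mem_nhdsWithin] with s hs hs'
      refine ⟨hs.1, hs.2, ?_⟩
      rw [boxT_boxPoint]
      exact add_neg_of_nonpos_of_neg ht hs'
  have h2 : p ∈ closure (Subtype.val ⁻¹' prism : Set (channel w)) := by
    rw [closure_subtype]
    refine closure_mono ?_ h1
    rintro q ⟨hq, hq'⟩
    exact ⟨⟨q, hq⟩, mem_prism_of_boxPart hw hq hq', rfl⟩
  exact image_closure_subset_closure_image (bccProj (channel w)).continuous ⟨p, h2, rfl⟩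

theorem rot_mem_closure_vertexRegion {w : ℝ} (hw : 0 ≤ w) (p : channel w) (hp : p.1 ∈ box)
    (ht : 0 ≤ boxT p) :
    quotientRot w (bccProj (channel w) p) ∈ closure (vertexRegion w) := by
  let l : Fin 3 → ℝ := ![-(1 / 2), 1 / 2, -(1 / 2)]
  have hl : l ∈ bcc := mem_bcc_iff_exists.2 ⟨-1, 1, -1, by decide, by decide,
    by simp [l]; norm_num, by simp [l], by simp [l]; norm_num⟩
  have hq : l + rot p ∈ channel w := add_mem_channel _ ((rot_mem_channel _).2 p.2) _ hl
  have h1 : quotientRot w (bccProj (channel w) p) = bccProj (channel w) ⟨l + rot p, hq⟩ :=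
    bccProj_eq_iff.2 (by simpa using hl)
  have h2 : l + rot p = boxPoint (-boxU p) (boxC p) (-boxT p) := by
    ext i
    fin_cases i <;> simp [l, rot_apply, boxPoint, boxU, boxC, boxT] <;> ring
  obtain ⟨k0, k1, k2⟩ := hp
  rw [h1]
  refine mem_closure_vertexRegion hw _ ?_ ?_
  · change l + rot p ∈ box
    rw [h2]
    refine ⟨?_, ?_, ?_⟩
    · rwa [boxU_boxPoint, abs_neg]
    · rwa [boxC_boxPoint]
    · rwa [boxT_boxPoint, abs_neg]
  · change boxT (l + rot p) ≤ 0
    rw [h2, boxT_boxPoint]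
    linarith

theorem mem_closure_of_mem_edgeRegion {w : ℝ} (hw : 0 ≤ w) (x) (hx : x ∈ edgeRegion w) :
    x ∈ closure (vertexRegion w) ∨ quotientRot w x ∈ closure (vertexRegion w) := by
  obtain ⟨p, hp, rfl⟩ := hx
  exact (le_total (boxT p) 0).imp (mem_closure_vertexRegion hw p hp)
    (rot_mem_closure_vertexRegion hw p hp)

/-- The overlap is exactly the half of the box on the side of the vertex, and that half is
contracted like the whole box. -/
theorem isPathConnected_inter {w : ℝ} (hw : 0 ≤ w) (hw' : w < √2) :
    IsPathConnected (vertexRegion w ∩ edgeRegion w) := by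
  have h : vertexRegion w ∩ edgeRegion w = bccImage (channel w) (boxPart (Set.Iio 0)) := by
    apply Set.Subset.antisymm
    · rintro _ ⟨hx, p, hp, rfl⟩
      refine ⟨p, ⟨hp, ?_⟩, rfl⟩
      -- On the other half the image under the symmetry lies in the closure of the vertex set. If
      -- the point itself were in the vertex set, the vertex set would meet its own image.
      by_contra ht
      rw [Set.mem_Iio, not_lt] at ht
      obtain ⟨y, hy, hy'⟩ := mem_closure_iff.1 (rot_mem_closure_vertexRegion hw p hp ht) _
        ((isOpen_vertexRegion w).preimage (quotientRot w).continuous)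
        (show quotientRot w (quotientRot w _) ∈ _ by
          rw [quotientRot_sq]
          exact hx)
      exact rot_notMem_vertexRegion hw y hy' hy
    · rintro _ ⟨p, hp, rfl⟩
      exact ⟨⟨p, mem_prism_of_boxPart hw p.2 hp, rfl⟩, ⟨p, hp.1, rfl⟩⟩
  rw [h]
  exact (isSimplyConnected_bccImage add_mem_channel (isOpen_boxPart isOpen_Iio)
    (fun p hp q hq => mem_box_inj p ⟨hp.1, hp.2.1⟩ q ⟨hq.1, hq.2.1⟩)
    (isSimplyConnected_boxPart hw' (convex_Iio 0) (t₀ := -(1 / 200)) (by norm_num)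
      (by norm_num))).isPathConnected

end

end Gyroid

namespace Gyroid

noncomputable section

open Real

/-! ### The regions cover the quotient of the channel -/

theorem cos_ne_zero_exists {t : ℝ} (h : cos (2 * π * t) ≠ 0) :
    ∃ n : ℤ, |t + n / 2| < 1 / 4 ∧ 0 < cos (2 * π * t + n * π) := by
  have hπ := pi_pos
  obtain ⟨n, hn⟩ := exists_abs_add_int_le (2 * t)
  have h1 : |t + n / 2| ≤ 1 / 4 := by
    rw [abs_le] at hn ⊢
    constructor <;> linarith
  have h2 : |t + n / 2| < 1 / 4 := by
    refine lt_of_le_of_ne h1 fun h3 => h ?_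
    have h4 : cos (2 * π * t + n * π) = 0 := by
      rw [← cos_abs, show 2 * π * t + n * π = 2 * π * (t + n / 2) by ring, abs_mul, h3,
        abs_of_pos (by positivity), show 2 * π * (1 / 4) = π / 2 by ring, cos_pi_div_two]
    rw [cos_add_int_mul_pi] at h4
    exact (mul_eq_zero.1 h4).resolve_left (zpow_ne_zero _ (by norm_num))
  refine ⟨n, h2, ?_⟩
  rw [show 2 * π * t + n * π = 2 * π * (t + n / 2) by ring]
  rw [abs_lt] at h2
  exact cos_pos_of_mem_Ioo ⟨by nlinarith, by nlinarith⟩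

/-- A point whose position along an edge is the middle of the edge lies in the set of the edge. -/
theorem mem_edgeRegion_of_sin_eq {w : ℝ} (hw : 0 ≤ w) (p : channel w)
    (h : sin (2 * π * (p.1 0 - p.1 1)) = -1) : bccProj (channel w) p ∈ edgeRegion w := by
  have hπ := pi_pos
  obtain ⟨n, hn⟩ : ∃ n : ℤ, p.1 1 = p.1 0 + 1 / 4 + n := by
    obtain ⟨n, hn⟩ := sin_eq_neg_one_iff.1 h
    refine ⟨-n, ?_⟩
    have h1 : (-(1 / 4) + n : ℝ) = p.1 0 - p.1 1 := by
      apply mul_left_cancel₀ (by positivity : 2 * π ≠ 0)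
      linarith
    push_cast
    linarith
  set u := p.1 0 with hu
  set c := p.1 2 - 1 / 8 with hc
  have hlev : level p.1 = level (boxPoint u c 0) := by
    have hl : (![0, -n, 0] : Fin 3 → ℝ) ∈ bcc :=
      mem_bcc_iff_exists.2 ⟨0, -2 * n, 0, by simp, by simp, by simp,
        by simp; ring, by simp⟩
    rw [← level_add hl]
    congr 1
    ext i
    fin_cases i <;> simp [boxPoint, hu, hc, hn]
    ring
  -- At `t = 0` the level is `-sin² u + √2 cos u cos c` in terms of the angles, and it is positive
  -- in the channel.
  have hpos : 0 < cos (2 * π * u) * cos (2 * π * c) := by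
    have h1 : w < level p.1 := p.2
    rw [hlev, level_boxPoint, mul_zero, gy_box, sin_zero, cos_zero] at h1
    have h2 : 0 < √2 := by positivity
    have h3 : 0 < √2 * (cos (2 * π * u) * cos (2 * π * c)) := by
      nlinarith [sq_nonneg (sin (2 * π * u))]
    exact (mul_pos_iff_of_pos_left h2).1 h3
  obtain ⟨a, ha, ha'⟩ := cos_ne_zero_exists (left_ne_zero_of_mul hpos.ne')
  obtain ⟨b, hb, hb'⟩ := cos_ne_zero_exists (right_ne_zero_of_mul hpos.ne')
  -- The two cosines have the same sign, so the half-integral shifts that make both positive have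
  -- equal parity. This is what membership in the lattice requires.
  have hab : Even (a + b) := by
    by_contra hodd
    rw [Int.not_even_iff_odd] at hodd
    rw [cos_add_int_mul_pi] at ha' hb'
    have h1 := mul_pos ha' hb'
    rw [mul_mul_mul_comm, ← zpow_add₀ (by norm_num), hodd.neg_one_zpow] at h1
    linarith
  obtain ⟨m, hm⟩ := hab
  refine (mem_bccImage add_mem_channel p).2 ⟨![a / 2, a / 2 - n, b / 2],
    mem_bcc_iff_exists.2 ⟨a, a - 2 * n, b, by omega, by omega, by simp, ?_, by simp⟩, ?_⟩
  · simp
    ring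
  · rw [show ![(a : ℝ) / 2, a / 2 - n, b / 2] + p.1 = boxPoint (u + a / 2) (c + b / 2) 0 from ?_]
    · refine ⟨?_, ?_, ?_⟩
      · rwa [boxU_boxPoint]
      · rwa [boxC_boxPoint]
      · rw [boxT_boxPoint]
        norm_num
    · ext i
      fin_cases i <;> simp [boxPoint, hu, hc, hn] <;> ring

/-- The symmetry belonging to an edge carries its sine to `sin (x - y)`, the one of the base edge;
so statements about the base edge apply to all six. -/
theorem edgeSin_eq_of_edgeSymm {w : ℝ} (j : Fin 3 ⊕ Fin 3) (p : channel w) : ∃ q : channel w,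
    edgeSymm (quotientCyc w) (quotientRot w) j (bccProj (channel w) p) = bccProj (channel w) q ∧
      sin (2 * π * (q.1 0 - q.1 1)) =
        edgeSin j (2 * π * p.1 0) (2 * π * p.1 1) (2 * π * p.1 2) := by
  have hc : ∀ q : channel w, cyc q.1 ∈ channel w := fun q => (cyc_mem_channel _).2 q.2
  have hr : ∀ q : channel w, rot q.1 ∈ channel w := fun q => (rot_mem_channel _).2 q.2
  rcases j with k | k <;> fin_cases k
  · refine ⟨p, rfl, ?_⟩
    simp [edgeSin, mul_sub]
  · refine ⟨⟨_, hc p⟩, rfl, ?_⟩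
    simp [edgeSin, mul_sub, cyc_apply]
  · refine ⟨⟨_, hc ⟨_, hc p⟩⟩, rfl, ?_⟩
    simp [edgeSin, mul_sub, cyc_apply]
  · refine ⟨⟨_, hc ⟨_, hc ⟨_, hr ⟨_, hc p⟩⟩⟩⟩, rfl, ?_⟩
    simp [edgeSin, cyc_apply, rot_apply]
    congr 1
    ring
  · refine ⟨⟨_, hc ⟨_, hc ⟨_, hr ⟨_, hc ⟨_, hc p⟩⟩⟩⟩⟩, rfl, ?_⟩
    simp [edgeSin, cyc_apply, rot_apply]
    congr 1
    ring
  · refine ⟨⟨_, hc ⟨_, hc ⟨_, hr p⟩⟩⟩, rfl, ?_⟩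
    simp [edgeSin, cyc_apply, rot_apply]
    congr 1
    ring

theorem sin_le_of_mem_edgeRegion {w : ℝ} {q : channel w}
    (h : bccProj (channel w) q ∈ edgeRegion w) : sin (2 * π * (q.1 0 - q.1 1)) ≤ -0.995 := by
  obtain ⟨l, hl, -, -, ht⟩ := (mem_bccImage add_mem_channel q).1 h
  obtain ⟨a, b, c, ⟨m, hm⟩, ⟨n, hn⟩, ha, hb, hc⟩ := mem_bcc_iff_exists.1 hl
  have h1 : 2 * π * (q.1 0 - q.1 1) =
      -(2 * (2 * π * boxT (l + q)) + π / 2) - ((m - n : ℤ) : ℝ) * (2 * π) := by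
    have ha' : (a : ℝ) = c + 2 * m := by rw [show a = c + 2 * m by omega]; push_cast; ring
    have hb' : (b : ℝ) = c + 2 * n := by rw [show b = c + 2 * n by omega]; push_cast; ring
    simp only [boxT, Pi.add_apply, ha, hb, ha', hb']
    push_cast
    ring
  rw [h1, sin_sub_int_mul_two_pi, sin_neg, sin_add_pi_div_two]
  have h2 := one_sub_sq_div_two_le_cos (x := 2 * (2 * π * boxT (l + q)))
  have h3 := sq_le_sq' (abs_le.1 (abs_two_pi_mul_le ht two_pi_div_le)).1
    (abs_le.1 (abs_two_pi_mul_le ht two_pi_div_le)).2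
  rw [mul_pow] at h2
  linarith

theorem eq_of_mem_edgeRegion {w : ℝ} (hw : 0 ≤ w) (x) (j j')
    (h : edgeSymm (quotientCyc w) (quotientRot w) j x ∈ edgeRegion w)
    (h' : edgeSymm (quotientCyc w) (quotientRot w) j' x ∈ edgeRegion w) : j = j' := by
  obtain ⟨p, rfl⟩ := bccProj_surjective x
  obtain ⟨q, hq, hs⟩ := edgeSin_eq_of_edgeSymm j p
  obtain ⟨q', hq', hs'⟩ := edgeSin_eq_of_edgeSymm j' p
  rw [hq] at h
  rw [hq'] at h'
  have k := sin_le_of_mem_edgeRegion h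
  have k' := sin_le_of_mem_edgeRegion h'
  rw [hs] at k
  rw [hs'] at k'
  have hp : w < level p.1 := p.2
  rw [level_eq] at hp
  exact eq_of_edgeSin_le (hw.trans hp.le) k k'

theorem exists_abs_lt_of_sin_ne {t : ℝ} (h : sin (2 * π * t) ≠ -1) :
    ∃ n : ℤ, -(1 / 4) < t + n ∧ t + n < 3 / 4 := by
  obtain ⟨n, hn⟩ := exists_abs_add_int_le (t - 1 / 4)
  obtain ⟨h1, h2⟩ := abs_le.1 hn
  have h3 : ∀ s : ℝ, sin (2 * π * s) = -1 → t + n ≠ s := by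
    intro s hs h4
    apply h
    rw [show 2 * π * t = 2 * π * s - n * (2 * π) by rw [← h4]; ring, sin_sub_int_mul_two_pi, hs]
  refine ⟨n, lt_of_le_of_ne (by linarith) (Ne.symm (h3 _ ?_)), lt_of_le_of_ne (by linarith)
    (h3 _ ?_)⟩
  · rw [show 2 * π * -(1 / 4) = -(π / 2) by ring, sin_neg, sin_pi_div_two]
  · rw [show 2 * π * (3 / 4) = π / 2 + π by ring, sin_add_pi, sin_pi_div_two]

theorem mem_vertexRegion_of_int {w : ℝ} (p : channel w) {a b c : ℤ} (h : a + b + c = 0)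
    (h0 : -(1 / 4) < p.1 0 - p.1 1 + a) (h1 : -(1 / 4) < p.1 1 - p.1 2 + b)
    (h2 : -(1 / 4) < p.1 2 - p.1 0 + c) : bccProj (channel w) p ∈ vertexRegion w := by
  have hc : (c : ℝ) = -a - b := by
    rw [show c = -a - b by omega]
    push_cast
    ring
  refine (mem_bccImage add_mem_channel p).2 ⟨![a + b, b, 0], mem_bcc_iff_exists.2
    ⟨2 * (a + b), 2 * b, 0, by omega, by omega, ?_, ?_, by simp⟩, ?_⟩
  · simp
  · simp
  · refine ⟨?_, ?_, ?_⟩ <;> simp <;> linarith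

/-- If no angle is critical at a point, then the point lies in the set of some vertex. -/
theorem exists_mem_vertexRegion {w : ℝ} (p : channel w)
    (h : ∀ j, edgeSin j (2 * π * p.1 0) (2 * π * p.1 1) (2 * π * p.1 2) ≠ -1) :
    ∃ i, vertexSymm (quotientCyc w) (quotientRot w) i (bccProj (channel w) p) ∈
      vertexRegion w := by
  have lift : ∀ t j, edgeSin j (2 * π * p.1 0) (2 * π * p.1 1) (2 * π * p.1 2) =
      sin (2 * π * t) → ∃ n : ℤ, -(1 / 4) < t + n ∧ t + n < 3 / 4 := fun t j hj =>
    exists_abs_lt_of_sin_ne (hj ▸ h j)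
  obtain ⟨n₁, l₁, u₁⟩ := lift (p.1 0 - p.1 1) (.inl 0) (by simp [edgeSin, mul_sub])
  obtain ⟨n₂, l₂, u₂⟩ := lift (p.1 1 - p.1 2) (.inl 1) (by simp [edgeSin, mul_sub])
  obtain ⟨n₃, l₃, u₃⟩ := lift (p.1 2 - p.1 0) (.inl 2) (by simp [edgeSin, mul_sub])
  obtain ⟨m₁, l₁', u₁'⟩ := lift (p.1 0 + p.1 1) (.inr 0) (by simp [edgeSin, mul_add])
  obtain ⟨m₂, l₂', u₂'⟩ := lift (p.1 1 + p.1 2) (.inr 1) (by simp [edgeSin, mul_add])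
  obtain ⟨m₃, l₃', u₃'⟩ := lift (p.1 2 + p.1 0) (.inr 2) (by simp [edgeSin, mul_add])
  have nonneg : ∀ k : ℤ, -1 < (k : ℝ) → 0 ≤ k := by
    intro k hk
    have : -1 < k := by exact_mod_cast hk
    omega
  -- For each of the four vertices this is an integer above `-1` that vanishes only if the point,
  -- suitably translated, lies in the prism of that vertex. The four integers have sum `3`, so one
  -- of them is zero.
  have k0 := nonneg (n₁ + n₂ + n₃) (by push_cast; linarith)
  have k1 := nonneg (1 - n₁ - m₂ + m₃) (by push_cast; linarith)
  have k2 := nonneg (1 - n₂ - m₃ + m₁) (by push_cast; linarith)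
  have k3 := nonneg (1 - n₃ - m₁ + m₂) (by push_cast; linarith)
  have hc : ∀ q : channel w, cyc q.1 ∈ channel w := fun q => (cyc_mem_channel _).2 q.2
  have hr : ∀ q : channel w, rot q.1 ∈ channel w := fun q => (rot_mem_channel _).2 q.2
  have hzero : n₁ + n₂ + n₃ = 0 ∨ 1 - n₁ - m₂ + m₃ = 0 ∨ 1 - n₂ - m₃ + m₁ = 0 ∨
      1 - n₃ - m₁ + m₂ = 0 := by omega
  rcases hzero with h0 | h0 | h0 | h0
  · exact ⟨none, mem_vertexRegion_of_int p h0 l₁ l₂ l₃⟩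
  · refine ⟨some 0, mem_vertexRegion_of_int ⟨_, hr p⟩ (a := -n₁) (b := 1 - m₂) (c := m₃)
      (by omega) ?_ ?_ ?_⟩ <;> simp [rot_apply] <;> linarith
  · refine ⟨some 1, mem_vertexRegion_of_int ⟨_, hr ⟨_, hc p⟩⟩ (a := -n₂) (b := 1 - m₃) (c := m₁)
      (by omega) ?_ ?_ ?_⟩ <;> simp [rot_apply, cyc_apply] <;> linarith
  · refine ⟨some 2, mem_vertexRegion_of_int ⟨_, hr ⟨_, hc ⟨_, hc p⟩⟩⟩ (a := -n₃) (b := 1 - m₁)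
      (c := m₂) (by omega) ?_ ?_ ?_⟩ <;> simp [rot_apply, cyc_apply] <;> linarith

theorem exists_mem_region {w : ℝ} (hw : 0 ≤ w) (x : ChannelQuotient w) :
    (∃ i, vertexSymm (quotientCyc w) (quotientRot w) i x ∈ vertexRegion w) ∨
      ∃ j, edgeSymm (quotientCyc w) (quotientRot w) j x ∈ edgeRegion w := by
  obtain ⟨p, rfl⟩ := bccProj_surjective x
  by_cases h : ∀ j, edgeSin j (2 * π * p.1 0) (2 * π * p.1 1) (2 * π * p.1 2) ≠ -1
  · exact .inl (exists_mem_vertexRegion p h)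
  · push Not at h
    obtain ⟨j, hj⟩ := h
    obtain ⟨q, hq, hs⟩ := edgeSin_eq_of_edgeSymm j p
    refine .inr ⟨j, ?_⟩
    rw [hq]
    exact mem_edgeRegion_of_sin_eq hw q (hs.trans hj)

/-- The quotient of the channel is covered like the complete graph on four vertices. -/
def channelCover {w : ℝ} (hw : 0 ≤ w) (hw' : w < √2) : GraphCover (ChannelQuotient w) (Fin 3)
    (Fin 3) (fun k => some (k + 1)) (fun k => some (k + 2)) :=
  symmetricCover (quotientCyc w) (quotientRot w) (vertexRegion w) (edgeRegion w)
    (quotientCyc_cube w) (quotientRot_sq w) (quotientRot_cyc_rot w) (isOpen_vertexRegion w)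
    (isOpen_edgeRegion w) cyc_mem_vertexRegion rot_mem_edgeRegion
    (isSimplyConnected_vertexRegion hw hw') (isSimplyConnected_edgeRegion hw')
    (isPathConnected_inter hw hw') (exists_mem_region hw) (rot_notMem_vertexRegion hw)
    (eq_of_mem_edgeRegion hw) (mem_closure_of_mem_edgeRegion hw)

/-! ### The channel is connected -/

theorem sqrt_two_le_sin_sq {t : ℝ} (ht : |t| ≤ π / 4) : √2 ≤ sin t ^ 2 + √2 * cos t := by
  have h1 := sqrt_two_le_gy_axis ht
  have h2 := gy_box 0 0 t
  simp only [zero_sub, add_zero, sin_zero, cos_zero] at h2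
  rw [h2] at h1
  linarith

/-- On each segment every angle is `π/4` or `±t` up to multiples of `π/2`. Writing these multiples
as repeated summands `π/2` lets the shift formulas reduce every case to one identity. -/
theorem level_edge (k : Fin 12) (t : ℝ) :
    level (fun i => (1 / 2 - 2 * t / π) * (baseEdge k).1 i + (1 / 2 + 2 * t / π) *
      (baseEdge k).2 i) = sin t ^ 2 + √2 * cos t := by
  have hπ := pi_ne_zero
  have key : ∀ a b d : ℝ, gy a b d = sin t ^ 2 + √2 * cos t →
      2 * π * ((1 / 2 - 2 * t / π) * (baseEdge k).1 0 + (1 / 2 + 2 * t / π) * (baseEdge k).2 0) = a →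
      2 * π * ((1 / 2 - 2 * t / π) * (baseEdge k).1 1 + (1 / 2 + 2 * t / π) * (baseEdge k).2 1) = b →
      2 * π * ((1 / 2 - 2 * t / π) * (baseEdge k).1 2 + (1 / 2 + 2 * t / π) * (baseEdge k).2 2) = d →
      level (fun i => (1 / 2 - 2 * t / π) * (baseEdge k).1 i + (1 / 2 + 2 * t / π) *
        (baseEdge k).2 i) = sin t ^ 2 + √2 * cos t := by
    rintro _ _ _ h rfl rfl rfl
    exact h
  fin_cases k
  · refine key (-t + π / 2 + π / 2)
      (t + π / 2 + π / 2 + π / 2)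
      (π / 4 + π / 2 + π / 2) ?_ ?_ ?_ ?_
    · simp only [gy, sin_add_pi_div_two, cos_add_pi_div_two, sin_neg, cos_neg, sin_pi_div_four,
        cos_pi_div_four]
      ring
    all_goals
      simp [baseEdge, baseIndex, v, v8, intVec]
      field_simp
      ring
  · refine key (π / 4 + π / 2 + π / 2)
      (-t + π / 2 + π / 2)
      (t + π / 2 + π / 2 + π / 2) ?_ ?_ ?_ ?_
    · simp only [gy, sin_add_pi_div_two, cos_add_pi_div_two, sin_neg, cos_neg, sin_pi_div_four,
        cos_pi_div_four]
      ring
    all_goals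
      simp [baseEdge, baseIndex, v, v8, intVec]
      field_simp
      ring
  · refine key (t + π / 2 + π / 2 + π / 2)
      (π / 4 + π / 2 + π / 2)
      (-t + π / 2 + π / 2) ?_ ?_ ?_ ?_
    · simp only [gy, sin_add_pi_div_two, cos_add_pi_div_two, sin_neg, cos_neg, sin_pi_div_four,
        cos_pi_div_four]
      ring
    all_goals
      simp [baseEdge, baseIndex, v, v8, intVec]
      field_simp
      ring
  · refine key (t + π / 2 + π / 2)
      (t + π / 2)
      (π / 4 + π / 2 + π / 2 + π / 2) ?_ ?_ ?_ ?_
    · simp only [gy, sin_add_pi_div_two, cos_add_pi_div_two, sin_pi_div_four,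
        cos_pi_div_four]
      ring
    all_goals
      simp [baseEdge, baseIndex, v, v8, intVec]
      field_simp
      ring
  · refine key (π / 4 + π / 2 + π / 2 + π / 2)
      (-t + π / 2 + π / 2)
      (-t + π / 2) ?_ ?_ ?_ ?_
    · simp only [gy, sin_add_pi_div_two, cos_add_pi_div_two, sin_neg, cos_neg, sin_pi_div_four,
        cos_pi_div_four]
      ring
    all_goals
      simp [baseEdge, baseIndex, v, v8, intVec]
      field_simp
      ring
  · refine key (-t + π / 2)
      (π / 4 + π / 2 + π / 2 + π / 2)
      (-t + π / 2 + π / 2) ?_ ?_ ?_ ?_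
    · simp only [gy, sin_add_pi_div_two, cos_add_pi_div_two, sin_neg, cos_neg, sin_pi_div_four,
        cos_pi_div_four]
      ring
    all_goals
      simp [baseEdge, baseIndex, v, v8, intVec]
      field_simp
      ring
  · refine key (t + π / 2 + π / 2 + π / 2 + π / 2)
      (t + π / 2 + π / 2 + π / 2)
      (π / 4 + π / 2) ?_ ?_ ?_ ?_
    · simp only [gy, sin_add_pi_div_two, cos_add_pi_div_two, sin_pi_div_four,
        cos_pi_div_four]
      ring
    all_goals
      simp [baseEdge, baseIndex, v, v8, intVec]
      field_simp
      ring
  · refine key (t + π / 2 + π / 2 + π / 2 + π / 2)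
      (-t + π / 2)
      (π / 4) ?_ ?_ ?_ ?_
    · simp only [gy, sin_add_pi_div_two, cos_add_pi_div_two, sin_neg, cos_neg, sin_pi_div_four,
        cos_pi_div_four]
      ring
    all_goals
      simp [baseEdge, baseIndex, v, v8, intVec]
      field_simp
      ring
  · refine key (π / 4 + π / 2)
      (t + π / 2 + π / 2 + π / 2 + π / 2)
      (t + π / 2 + π / 2 + π / 2) ?_ ?_ ?_ ?_
    · simp only [gy, sin_add_pi_div_two, cos_add_pi_div_two, sin_pi_div_four,
        cos_pi_div_four]
      ring
    all_goals
      simp [baseEdge, baseIndex, v, v8, intVec]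
      field_simp
      ring
  · refine key (π / 4)
      (t + π / 2 + π / 2 + π / 2 + π / 2)
      (-t + π / 2) ?_ ?_ ?_ ?_
    · simp only [gy, sin_add_pi_div_two, cos_add_pi_div_two, sin_neg, cos_neg, sin_pi_div_four,
        cos_pi_div_four]
      ring
    all_goals
      simp [baseEdge, baseIndex, v, v8, intVec]
      field_simp
      ring
  · refine key (-t + π / 2)
      (π / 4)
      (t + π / 2 + π / 2 + π / 2 + π / 2) ?_ ?_ ?_ ?_
    · simp only [gy, sin_add_pi_div_two, cos_add_pi_div_two, sin_neg, cos_neg, sin_pi_div_four,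
        cos_pi_div_four]
      ring
    all_goals
      simp [baseEdge, baseIndex, v, v8, intVec]
      field_simp
      ring
  · refine key (t + π / 2 + π / 2 + π / 2)
      (π / 4 + π / 2)
      (t + π / 2 + π / 2 + π / 2 + π / 2) ?_ ?_ ?_ ?_
    · simp only [gy, sin_add_pi_div_two, cos_add_pi_div_two, sin_pi_div_four,
        cos_pi_div_four]
      ring
    all_goals
      simp [baseEdge, baseIndex, v, v8, intVec]
      field_simp
      ring

theorem joinedIn_channel {w : ℝ} (hw : w < √2) (d) (hd : d ∈ dartSet) :
    JoinedIn (channel w) d.1 d.2 := by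
  have hπ := pi_pos
  have key : ∀ k n, JoinedIn (channel w) ((baseEdge k).1 + intVec n)
      ((baseEdge k).2 + intVec n) := by
    intro k n
    -- The substitution `t = π/2 (s - 1/2)` takes the unit interval to `[-π/4, π/4]`.
    refine JoinedIn.ofLine (f := fun s => intVec n + fun i =>
      (1 / 2 - 2 * (π / 2 * (s - 1 / 2)) / π) * (baseEdge k).1 i +
        (1 / 2 + 2 * (π / 2 * (s - 1 / 2)) / π) * (baseEdge k).2 i) ?_ ?_ ?_ ?_
    · fun_prop
    · ext i
      simp only [Pi.add_apply]
      field_simp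
      ring
    · ext i
      simp only [Pi.add_apply]
      field_simp
      ring
    · rintro _ ⟨s, ⟨h0, h1⟩, rfl⟩
      change w < level _
      rw [level_add (intVec_mem_bcc n), level_edge]
      refine hw.trans_le (sqrt_two_le_sin_sq (abs_le.2 ⟨?_, ?_⟩)) <;> nlinarith
  obtain ⟨k, n, rfl | rfl⟩ := hd
  · exact key k n
  · exact (key k n).symm

/-- The quotient is path connected by its cover, and the lattice orbit of `v 0` is joined along
edges of the graph, which lie in the channel. -/
theorem pathConnectedSpace_channel {w : ℝ} (hw : 0 ≤ w) (hw' : w < √2) :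
    PathConnectedSpace (channel w) := by
  have key := forall_vertex_rel (R := fun p q => p = q ∨ JoinedIn (channel w) p q) ?_
    fun d hd => .inr (joinedIn_channel hw' d hd)
  · let := bccAction (add_mem_channel (w := w))
    have := (channelCover hw hw').pathConnectedSpace
    have h0 : v 0 ∈ vertexSet := baseEdge_fst 0
    have hv : v 0 ∈ channel w := by
      have h := (joinedIn_channel hw' _ ⟨0, 0, .inl rfl⟩).source_mem
      have h1 : (baseEdge 0).1 + intVec 0 = v 0 := by
        ext i
        simp [baseEdge, baseIndex, intVec]
      rwa [h1] at h
    refine pathConnectedSpace_of_quotientCoveringMap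
      (isAddQuotientCoveringMap_bccProj (add_mem_channel (w := w))) ⟨v 0, hv⟩ fun l => ?_
    rcases key _ h0 _ (add_mem_vertexSet h0 l.2) with h | h
    · have h1 : l +ᵥ (⟨v 0, hv⟩ : channel w) = ⟨v 0, hv⟩ := Subtype.ext h.symm
      rw [h1]
    · exact joinedIn_iff_joined hv h.target_mem |>.1 h
  · refine ⟨fun p => .inl rfl, ?_, ?_⟩
    · rintro p q (rfl | h)
      · exact .inl rfl
      · exact .inr h.symm
    · rintro p q r (rfl | h) (rfl | h')
      · exact .inl rfl
      · exact .inr h'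
      · exact .inr h
      · exact .inr (h.trans h')

/-! ### All channels -/

/-- The connected components of the complement of the double Gyroid on which the Gyroid function is
large in absolute value are the two channels. -/
theorem IsChannel.eq {w : ℝ} (hw : 0 ≤ w) (hw' : w < √2) {C : Set (Fin 3 → ℝ)}
    (hC : IsChannel w C) : C = channel w ∨ C = Neg.neg ⁻¹' channel w := by
  have hconn : IsPathConnected (channel w) :=
    isPathConnected_iff_pathConnectedSpace.2 (pathConnectedSpace_channel hw hw')
  have hconn' : IsPathConnected (Neg.neg ⁻¹' channel w) :=
    (Homeomorph.neg (Fin 3 → ℝ)).isPathConnected_preimage.2 hconn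
  have mem_neg : ∀ q : Fin 3 → ℝ, q ∈ Neg.neg ⁻¹' channel w ↔ level q < -w := by
    intro q
    change w < level (-q) ↔ _
    rw [level_neg, lt_neg]
  obtain ⟨p, hp, rfl⟩ := hC
  have himage : ∀ q ∈ connectedComponentIn (doubleGyroid w)ᶜ p, level q ≠ w ∧ level q ≠ -w := by
    intro q hq
    exact not_or.1 (connectedComponentIn_subset _ _ hq)
  have hpre : IsPreconnected (level '' connectedComponentIn (doubleGyroid w)ᶜ p) :=
    isPreconnected_connectedComponentIn.image _ continuous_level.continuousOn
  rcases lt_abs.1 hp with hp | hp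
  · left
    have hpS : p ∈ (doubleGyroid w)ᶜ := by
      rintro (h | h) <;> linarith
    apply Set.Subset.antisymm
    · intro q hq
      change w < level q
      by_contra! h
      -- By the intermediate value theorem a component containing values on both sides of `w` would
      -- contain a point of the surface.
      obtain ⟨r, hr, hr'⟩ := hpre.Icc_subset ⟨q, hq, rfl⟩
        ⟨p, mem_connectedComponentIn hpS, rfl⟩ ⟨h, hp.le⟩
      exact (himage r hr).1 hr'
    · refine hconn.isConnected.isPreconnected.subset_connectedComponentIn hp ?_
      intro q hq
      change w < level q at hq
      rintro (h | h) <;> linarith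
  · right
    have hpS : p ∈ (doubleGyroid w)ᶜ := by
      rintro (h | h) <;> linarith
    apply Set.Subset.antisymm
    · intro q hq
      rw [mem_neg]
      by_contra! h
      obtain ⟨r, hr, hr'⟩ := hpre.Icc_subset ⟨p, mem_connectedComponentIn hpS, rfl⟩
        ⟨q, hq, rfl⟩ ⟨by linarith, h⟩
      exact (himage r hr).2 hr'
    · refine hconn'.isConnected.isPreconnected.subset_connectedComponentIn
        ((mem_neg p).2 (by linarith)) ?_
      intro q hq
      rw [mem_neg] at hq
      rintro (h | h) <;> linarith

/-- A set that is carried to the channel by a symmetry of the lattice is the maximal abelian cover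
of its quotient. -/
theorem isMaximalAbelianCover_of_homeomorph {w : ℝ} (hw : 0 ≤ w) (hw' : w < √2)
    {C : Set (Fin 3 → ℝ)} (f : (Fin 3 → ℝ) ≃ₜ (Fin 3 → ℝ))
    (hf : ∀ p q, f q - f p ∈ bcc ↔ q - p ∈ bcc) (hC : f ⁻¹' channel w = C) :
    (∀ x : C, Nonempty (FundamentalGroup C x ≃* commutator (FreeGroup (Fin 3)))) ∧
      (∀ y : BccQuotient C, Nonempty (FundamentalGroup (BccQuotient C) y ≃* FreeGroup (Fin 3))) ∧
      IsMaximalAbelianCover (bccProj C) := by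
  have hadd : ∀ p ∈ C, ∀ l ∈ bcc, l + p ∈ C := by
    intro p hp l hl
    rw [← hC] at hp ⊢
    have h : f (l + p) - f p ∈ bcc := (hf _ _).2 (by simpa using hl)
    have := add_mem_channel _ hp _ h
    rwa [sub_add_cancel] at this
  have hB : ∀ y : BccQuotient C,
      Nonempty (FundamentalGroup (BccQuotient C) y ≃* FreeGroup (Fin 3)) := by
    intro y
    let F : BccQuotient C ≃ₜ ChannelQuotient w := bccHomeomorph f hf fun p => by
      rw [← hC, Set.mem_preimage]
    obtain ⟨e⟩ := nonempty_fundamentalGroup_mulEquiv F y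
    obtain ⟨e'⟩ := (channelCover hw hw').nonempty_mulEquiv (F y)
    exact ⟨e.trans e'⟩
  have hpath : PathConnectedSpace C := by
    rw [← isPathConnected_iff_pathConnectedSpace, ← hC, f.isPathConnected_preimage,
      isPathConnected_iff_pathConnectedSpace]
    exact pathConnectedSpace_channel hw hw'
  let := bccAction hadd
  obtain ⟨h1, h2⟩ := isMaximalAbelianCover_of_quotientCoveringMap _
    (isAddQuotientCoveringMap_bccProj hadd) bccEquiv hB
  exact ⟨h1, hB, h2⟩

theorem IsChannel.isMaximalAbelianCover {w : ℝ} (hw : 0 ≤ w) (hw' : w < √2)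
    {C : Set (Fin 3 → ℝ)} (hC : IsChannel w C) :
    (∀ x : C, Nonempty (FundamentalGroup C x ≃* commutator (FreeGroup (Fin 3)))) ∧
      (∀ y : BccQuotient C, Nonempty (FundamentalGroup (BccQuotient C) y ≃* FreeGroup (Fin 3))) ∧
      IsMaximalAbelianCover (bccProj C) := by
  rcases hC.eq hw hw' with h | h
  · exact isMaximalAbelianCover_of_homeomorph hw hw' (Homeomorph.refl _) (fun p q => .rfl) h.symm
  · refine isMaximalAbelianCover_of_homeomorph hw hw' (Homeomorph.neg _) (fun p q => ?_) h.symm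
    simp only [Homeomorph.coe_neg]
    rw [← neg_mem_iff, neg_sub, sub_neg_eq_add, neg_add_eq_sub]

end

end Gyroid

theorem mainTheorem5 :
    -- the fundamental group of the Gyroid graph, at every base point
    (∀ x : Gyroid.gyroidGraph.Realization,
      Nonempty (FundamentalGroup Gyroid.gyroidGraph.Realization x ≃*
        commutator (FreeGroup (Fin 3)))) ∧
    -- the quotient graph is the complete graph on four vertices
    Nonempty (Gyroid.OrGraph.Iso Gyroid.quotientGraph
      (Gyroid.OrGraph.ofSimpleGraph (⊤ : SimpleGraph (Fin 4)))) ∧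
    -- the fundamental group of the quotient graph
    (∀ y : Gyroid.quotientGraph.Realization,
      Nonempty (FundamentalGroup Gyroid.quotientGraph.Realization y ≃* FreeGroup (Fin 3))) ∧
    -- the Gyroid graph is the maximal abelian cover of the quotient graph
    Gyroid.IsMaximalAbelianCover Gyroid.quotientHom.realize ∧
    -- the same for each channel
    (∀ (w : ℝ), 0 ≤ w → w < Real.sqrt 2 → ∀ C : Set (Fin 3 → ℝ), Gyroid.IsChannel w C →
      (∀ x : C, Nonempty (FundamentalGroup C x ≃* commutator (FreeGroup (Fin 3)))) ∧
      (∀ y : Gyroid.BccQuotient C,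
        Nonempty (FundamentalGroup (Gyroid.BccQuotient C) y ≃* FreeGroup (Fin 3))) ∧
      Gyroid.IsMaximalAbelianCover (Gyroid.bccProj C)) :=
  ⟨Gyroid.isMaximalAbelianCover_realize.1, ⟨Gyroid.quotientIso⟩,
    Gyroid.nonempty_fundamentalGroup_quotientGraph, Gyroid.isMaximalAbelianCover_realize.2,
    fun _ hw hw' _ hC => hC.isMaximalAbelianCover hw hw'⟩
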